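/- **Setting.** Let $\mathcal X$ be a compact metric space, $K:\mathcal X\times\mathcal X\to\mathbb R$ a Mercer kernel (continuous, symmetric, positive semidefinite) with reproducing kernel Hilbert space $(\mathcal H_K,\|\cdot\|_K)$ and $K_x:=K(x,\cdot)$. Let $\rho$ be a Borel probability measure on $\mathcal X\times\mathbb R$ with marginal $\rho_X$ on $\mathcal X$ and conditional distributions $\rho(y|x)$, let $f_\rho(x)=\int y\,d\rho(y|x)$ be the regression function, $\|\cdot\|_\rho$ the norm of $L^2_{\rho_X}$, and $L_Kf=\int_{\mathcal X}K_xf(x)\,d\rho_X(x)$ the integral operator (on $\mathcal H_K$ and on $L^2_{\rho_X}$). For $\lambda>0$ put $\mathcal N(\lambda)=\mathrm{Tr}((\lambda I+L_K)^{-1}L_K)$. For a finite random sequence $z_1,\dots,z_n$ on a probability space $(\Omega,P)$ define its strong mixing coefficients by $$\alpha_\ell(z)=\sup_{k\ge1}\ \sup\{|P(A\cap B)-P(A)P(B)|:\ A\in\sigma(z_i:i\le k),\ B\in\sigma(z_i:i\ge k+\ell)\},\qquad \ell\ge1;$$ the sequence is stationary if any two blocks of consecutive terms of equal length have the same law. Data: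 $D_1,\dots,D_m$ ($m\ge1$) are data sets, $D_j=(z_{j,i})_{i=1}^{|D_j|}$ with $|D_j|\ge1$, $z_{j,i}=(x_{j,i},y_{j,i})$ random variables with values in $\mathcal X\times\mathbb R$ and law $\rho$, and $|D|=\sum_j|D_j|$. With $$f_{D_j,\lambda}=\arg\min_{f\in\mathcal H_K}\Big\{\tfrac1{|D_j|}\sum_{(x,y)\in D_j}(f(x)-y)^2+\lambda\|f\|_K^2\Big\},$$ the distributed kernel ridge regression estimator is $\overline f_{D,\lambda}=\sum_{j=1}^m\frac{|D_j|}{|D|}f_{D_j,\lambda}$. **Assumptions.** 1. (Mixing.) Each of $D_1,\dots,D_m$ is stationary, and under some arrangement of all the samples into one sequence, $D=\bigcup_jD_j$ is stationary as well; and $(\alpha_\ell)_{\ell\ge1}$ is a sequence with $\alpha_\ell\to0$ such that the strong mixing coefficients at lag $\ell$ of each $D_j$ and of the arranged $D$ are at most $\alpha_\ell$, for every $\ell\geq 1$. 2. (Boundedness.) There is $M>0$ with $|y|\le M$ almost surely. 3. (Capacity.) There are $s\in(0,1]$ and $C_0\ge1$ with $\mathcal N(\lambda)\le C_0\lambda^{-s}$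 for all $\lambda>0$. 4. (Regularity.) $f_\rho=L_K^rh_\rho$ ($\rho_X$-almost everywhere) for some $h_\rho\in L^2_{\rho_X}$, where $L_K^r$ is the $r$-th power of $L_K:L^2_{\rho_X}\to L^2_{\rho_X}$. **Theorem.** Let $\delta>0$, let Assumptions 2–4 hold with $0<s\le1$, $1/2\le r\le1$ and $2r+s\ge2$. Then $f_\rho$ has a version in $\mathcal H_K$; write $f_\rho$ also for its version of minimal $\|\cdot\|_K$-norm. There is a constant $\bar C>0$, independent of $m$, of the sizes $|D_j|$ and $|D|$, of the samples and of $(\alpha_\ell)$, such that for all data satisfying Assumption 1 and $\lambda=|D|^{-1/(2r+s)}$ the norms $\|\overline f_{D,\lambda}-f_\rho\|_\rho$ and $\|\overline f_{D,\lambda}-f_\rho\|_K$ are integrable and $$\begin{aligned} &\max\Big\{E\big[\|\overline f_{D,\lambda}-f_\rho\|_\rho\big],\ |D|^{-\frac1{4r+2s}}E\big[\|\overline f_{D,\lambda}-f_\rho\|_K\big]\Big\}\\ &\le \bar C|D|^{\frac1{2r+s}}\sum_{j=1}^m\frac{|D_j|}{|D|}|D_j|^{-\frac12}\Big(1+\sum_{\ell=1}^{|D_j|}\sqrt{\alpha_\ell}\Big)\Big(|D_j|^{-\frac12}|D|^{\frac{s}{4r+2s}}+|D|^{\frac{2s+\delta+1}{(2r+s)(2\delta+4)}}\sum_{\ell=1}^{|D_j|}\alpha_\ell^{\frac{\delta}{4+2\delta}}\Big)\\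 &\quad+\bar C\Big(|D|^{-\frac{r}{2r+s}}+|D|^{\frac{2s+\delta+1}{(2r+s)(2\delta+4)}}\sum_{\ell=1}^{|D|}\alpha_\ell^{\frac{\delta}{4+2\delta}}\Big). \end{aligned}$$ -/

import Mathlib

open MeasureTheory ProbabilityTheory Filter Topology
open scoped ENNReal InnerProductSpace

noncomputable section

namespace DKRR

/-! ### Dependence of finite samples -/

section Mixing

variable {Ω E : Type*} [MeasurableSpace Ω] [MeasurableSpace E]

/-- A finite random sequence `Z 0, …, Z (n-1)` is stationary if any two of its blocks of
consecutive terms of the same length have the same joint law. -/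
def IsStationary (P : Measure Ω) {n : ℕ} (Z : Fin n → Ω → E) : Prop :=
  ∀ (t i j : ℕ) (h : t + j + i < n),
    P.map (fun ω (l : Fin (i + 1)) => Z ⟨t + l, by omega⟩ ω) =
      P.map (fun ω (l : Fin (i + 1)) => Z ⟨t + j + l, by omega⟩ ω)

/-- The coefficient `α(𝒥, 𝒦) = sup {|P(A ∩ B) - P(A) P(B)| : A ∈ 𝒥, B ∈ 𝒦}` of two `σ`-fields. -/
def alphaCoeff (P : Measure Ω) (J K : MeasurableSpace Ω) : ℝ :=
  sSup {a : ℝ | ∃ A B : Set Ω, MeasurableSet[J] A ∧ MeasurableSet[K] B ∧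
    a = |P.real (A ∩ B) - P.real A * P.real B|}

/-- The `σ`-field generated by the terms `Z i` with `i ∈ I`. -/
@[reducible]
def sigmaField {n : ℕ} (Z : Fin n → Ω → E) (I : Set (Fin n)) : MeasurableSpace Ω :=
  ⨆ i ∈ I, MeasurableSpace.comap (Z i) inferInstance

/-- The strong mixing coefficient at lag `l` of a finite random sequence `z_1, …, z_n`
(with `z_{i+1} = Z i`): the supremum over `k ≥ 1` of the coefficient of the `σ`-fields generated by
`z_1, …, z_k` and by `z_{k+l}, z_{k+l+1}, …`. -/
def mixingCoeff (P : Measure Ω) {n : ℕ} (Z : Fin n → Ω → E) (l : ℕ) : ℝ :=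
  sSup {a : ℝ | ∃ k : ℕ, 1 ≤ k ∧
    a = alphaCoeff P (sigmaField Z {i | (i : ℕ) + 1 ≤ k}) (sigmaField Z {i | k + l ≤ (i : ℕ) + 1})}

end Mixing

/-! ### Operators on Hilbert spaces -/

section Operators

variable {E : Type*} [NormedAddCommGroup E] [InnerProductSpace ℝ E] [CompleteSpace E]

/-- The trace `∑ i, ⟪e i, T (e i)⟫` of a positive operator over a Hilbert basis `e`
(its value does not depend on the basis; it is `∞` if `T` is not of trace class). -/
def posTrace (T : E →L[ℝ] E) : ℝ≥0∞ :=
  let b := (exists_hilbertBasis ℝ E).choose_spec.choose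
  ∑' i, ENNReal.ofReal ⟪b i, T (b i)⟫_ℝ

/-- The power `T ^ r`, `r > 0`, of a compact positive self-adjoint operator:
`T ^ r x = ∑ μ, μ ^ r • P_μ x`, with `P_μ` the orthogonal projection onto the eigenspace
`ker (T - μ)`, which is trivial unless `μ` is an eigenvalue. -/
def opPow (T : E →L[ℝ] E) (r : ℝ) (x : E) : E :=
  ∑' μ : ℝ, μ ^ r •
    (LinearMap.ker ((T - μ • (1 : E →L[ℝ] E) : E →L[ℝ] E) : E →ₗ[ℝ] E)).starProjection x

end Operators

/-! ### Kernels and integral operators -/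

/-- A Mercer kernel: continuous, symmetric and positive semidefinite. -/
structure IsMercerKernel {X : Type*} [TopologicalSpace X] (K : X → X → ℝ) : Prop where
  continuous : Continuous fun p : X × X => K p.1 p.2
  symm : ∀ x y, K x y = K y x
  nonneg : ∀ (n : ℕ) (x : Fin n → X) (c : Fin n → ℝ),
    0 ≤ ∑ i, ∑ j, c i * c j * K (x i) (x j)

section Kernel

variable {X : Type*} [MetricSpace X]
variable (H : Type*) [NormedAddCommGroup H] [InnerProductSpace ℝ H] [CompleteSpace H]
variable [RKHS ℝ H X ℝ]

/-- The reproducing kernel Hilbert space `H` of real functions on `X` has the kernel `K`. -/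
def HasKernel (K : X → X → ℝ) : Prop := ∀ x y, RKHS.kernel H x y 1 = K x y

/-- The kernel section `K_x = K(x, ·)` as an element of `H`. -/
def kerSection (x : X) : H := RKHS.kerFun H x 1

variable {H}

lemma inner_kerSection (x : X) (f : H) : ⟪kerSection H x, f⟫_ℝ = f x := by
  simp [kerSection]

lemma continuous_kerSection {K : X → X → ℝ} (hK : IsMercerKernel K) (hH : HasKernel H K) :
    Continuous (kerSection H : X → H) := by
  have hin : ∀ x y, ⟪kerSection H x, kerSection H y⟫_ℝ = K x y := fun x y => by
    rw [inner_kerSection, kerSection, RKHS.kerFun_apply, hH]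
  have hc := hK.continuous
  rw [continuous_iff_continuousAt]
  intro x
  rw [ContinuousAt, tendsto_iff_norm_sub_tendsto_zero]
  have h1 : ∀ y, ‖kerSection H y - kerSection H x‖ = √(K y y - 2 * K y x + K x x) := fun y => by
    rw [← Real.sqrt_sq (norm_nonneg (kerSection H y - kerSection H x)), norm_sub_sq_real,
      ← real_inner_self_eq_norm_sq, ← real_inner_self_eq_norm_sq, hin, hin, hin]
  simp_rw [h1]
  have h2 : Continuous fun y => √(K y y - 2 * K y x + K x x) := by
    have a : Continuous fun y => K y y := hc.comp (by fun_prop : Continuous fun y : X => (y, y))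
    have b : Continuous fun y => K y x := hc.comp (by fun_prop : Continuous fun y : X => (y, x))
    fun_prop
  have h3 := h2.tendsto x
  have h4 : K x x - 2 * K x x + K x x = 0 := by ring
  simpa [h4] using h3

lemma continuous_coe {K : X → X → ℝ} (hK : IsMercerKernel K) (hH : HasKernel H K) (f : H) :
    Continuous (f : X → ℝ) := by
  have h := (continuous_kerSection hK hH).inner (continuous_const (y := f)) (𝕜 := ℝ)
  simpa only [inner_kerSection] using h

variable [CompactSpace X]

lemma exists_kerSection_bound {K : X → X → ℝ} (hK : IsMercerKernel K) (hH : HasKernel H K) :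
    ∃ C : ℝ, 0 ≤ C ∧ ∀ x, ‖kerSection H x‖ ≤ C := by
  obtain ⟨C, hC⟩ := isCompact_univ.exists_bound_of_continuousOn
    (continuous_kerSection hK hH).continuousOn
  exact ⟨max C 0, le_max_right _ _, fun x => (hC x trivial).trans (le_max_left _ _)⟩

variable [MeasurableSpace X] [BorelSpace X] (μ : Measure X) [IsProbabilityMeasure μ]

lemma memLp_coe {K : X → X → ℝ} (hK : IsMercerKernel K) (hH : HasKernel H K) (f : H) :
    MemLp (f : X → ℝ) 2 μ := by
  obtain ⟨C, -, hC⟩ := exists_kerSection_bound hK hH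
  refine MemLp.of_bound (continuous_coe hK hH f).aestronglyMeasurable (C * ‖f‖)
    (Eventually.of_forall fun x => ?_)
  rw [← inner_kerSection]
  exact (norm_inner_le_norm _ _).trans (by gcongr; exact hC x)

lemma integrable_smul_section {K : X → X → ℝ} (hK : IsMercerKernel K) (hH : HasKernel H K)
    (f : Lp ℝ 2 μ) : Integrable (fun x => f x • kerSection H x) μ := by
  obtain ⟨C, -, hC⟩ := exists_kerSection_bound hK hH
  have hf : Integrable f μ := (Lp.memLp f).integrable (by norm_num)
  exact hf.smul_bdd C (continuous_kerSection hK hH).aestronglyMeasurable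
    (Eventually.of_forall hC)

/-- The inclusion of the reproducing kernel Hilbert space into `L²(μ)`. -/
def inclL2 {K : X → X → ℝ} (hK : IsMercerKernel K) (hH : HasKernel H K) : H →L[ℝ] Lp ℝ 2 μ :=
  LinearMap.mkContinuousOfExistsBound
    { toFun := fun f => (memLp_coe μ hK hH f).toLp f
      map_add' := fun f g => by
        rw [← MemLp.toLp_add]
        exact MemLp.toLp_congr _ _ (by rw [RKHS.coe_add])
      map_smul' := fun c f => by
        rw [RingHom.id_apply, ← MemLp.toLp_const_smul]
        exact MemLp.toLp_congr _ _ (by rw [RKHS.coe_smul]) }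
    (by
      obtain ⟨C, hC0, hC⟩ := exists_kerSection_bound hK hH
      refine ⟨C, fun f => ?_⟩
      refine (Lp.norm_le_of_ae_bound (C := C * ‖f‖) (by positivity) ?_).trans
        (by simp [measureUnivNNReal])
      filter_upwards [(memLp_coe μ hK hH f).coeFn_toLp] with x hx
      change ‖(memLp_coe μ hK hH f).toLp f x‖ ≤ _
      rw [hx, ← inner_kerSection]
      exact (norm_inner_le_norm _ _).trans (by gcongr; exact hC x))

/-- The integral operator `f ↦ ∫ K_x f(x) dμ(x)` from `L²(μ)` to `H`. -/
def integralOp {K : X → X → ℝ} (hK : IsMercerKernel K) (hH : HasKernel H K) :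
    Lp ℝ 2 μ →L[ℝ] H :=
  LinearMap.mkContinuousOfExistsBound
    { toFun := fun f => ∫ x, f x • kerSection H x ∂μ
      map_add' := fun f g => by
        rw [← integral_add (integrable_smul_section μ hK hH f) (integrable_smul_section μ hK hH g)]
        refine integral_congr_ae ?_
        filter_upwards [Lp.coeFn_add f g] with x hx
        rw [hx, Pi.add_apply, add_smul]
      map_smul' := fun c f => by
        rw [RingHom.id_apply, ← integral_smul]
        refine integral_congr_ae ?_
        filter_upwards [Lp.coeFn_smul c f] with x hx
        rw [hx, Pi.smul_apply, smul_assoc] }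
    (by
      obtain ⟨C, hC0, hC⟩ := exists_kerSection_bound hK hH
      refine ⟨C, fun f => ?_⟩
      have hf : Integrable f μ := (Lp.memLp f).integrable (by norm_num)
      have h1 : ∫ x, ‖f x‖ ∂μ ≤ ‖f‖ := by
        rw [integral_norm_eq_lintegral_enorm hf.aestronglyMeasurable, Lp.norm_def,
          ← eLpNorm_one_eq_lintegral_enorm]
        exact ENNReal.toReal_mono (Lp.eLpNorm_ne_top f)
          (eLpNorm_le_eLpNorm_of_exponent_le (by norm_num) hf.aestronglyMeasurable)
      calc ‖∫ x, f x • kerSection H x ∂μ‖ ≤ ∫ x, ‖f x • kerSection H x‖ ∂μ :=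
            norm_integral_le_integral_norm _
        _ ≤ ∫ x, C * ‖f x‖ ∂μ := by
            refine integral_mono (integrable_smul_section μ hK hH f).norm (hf.norm.const_mul C)
              fun x => ?_
            change ‖f x • kerSection H x‖ ≤ C * ‖f x‖
            rw [norm_smul, mul_comm]
            gcongr
            exact hC x
        _ = C * ∫ x, ‖f x‖ ∂μ := integral_const_mul _ _
        _ ≤ C * ‖f‖ := by gcongr)

/-- The integral operator `L_K` acting on the reproducing kernel Hilbert space `H`. -/
def LK_H {K : X → X → ℝ} (hK : IsMercerKernel K) (hH : HasKernel H K) : H →L[ℝ] H :=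
  integralOp μ hK hH ∘L inclL2 μ hK hH

/-- The integral operator `L_K` acting on `L²(μ)`. -/
def LK_L2 {K : X → X → ℝ} (hK : IsMercerKernel K) (hH : HasKernel H K) :
    Lp ℝ 2 μ →L[ℝ] Lp ℝ 2 μ :=
  inclL2 μ hK hH ∘L integralOp μ hK hH

/-- The effective dimension `𝒩(lam) = Tr ((lam I + L_K)⁻¹ L_K)`. -/
def effectiveDim {K : X → X → ℝ} (hK : IsMercerKernel K) (hH : HasKernel H K) (lam : ℝ) : ℝ≥0∞ :=
  posTrace (Ring.inverse (lam • (1 : H →L[ℝ] H) + LK_H μ hK hH) * LK_H μ hK hH)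

end Kernel

/-! ### Regression and distributed kernel ridge regression -/

section Regression

variable {X : Type*} [MetricSpace X]

/-- The regression function `f_ρ(x) = ∫ y dρ(y | x)`. -/
def regressionFun [MeasurableSpace X] (ρ : Measure (X × ℝ)) [IsProbabilityMeasure ρ] (x : X) : ℝ :=
  ∫ y, y ∂(ρ.condKernel x)

variable {H : Type*} [NormedAddCommGroup H] [InnerProductSpace ℝ H] [CompleteSpace H]
variable [RKHS ℝ H X ℝ]

/-- The regularized empirical risk of `f` on the data `d = ((x_1, y_1), …, (x_n, y_n))`. -/
def krrObjective (lam : ℝ) {n : ℕ} (d : Fin n → X × ℝ) (f : H) : ℝ :=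
  (1 / (n : ℝ)) * ∑ i, (f (d i).1 - (d i).2) ^ 2 + lam * ‖f‖ ^ 2

variable (H)

/-- The kernel ridge regression estimator: the (for `lam > 0` unique) minimizer over `H` of the
regularized empirical risk. -/
def krr (lam : ℝ) {n : ℕ} (d : Fin n → X × ℝ) : H :=
  Classical.epsilon fun f : H => ∀ g : H, krrObjective lam d f ≤ krrObjective lam d g

/-- The distributed kernel ridge regression estimator: the average of the local estimators,
weighted by the shares of the local data sets in the whole data. -/
def dkrr (lam : ℝ) {m : ℕ} {n : Fin m → ℕ} (d : (j : Fin m) → Fin (n j) → X × ℝ) : H :=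
  ∑ j, ((n j : ℝ) / ((∑ k, n k : ℕ) : ℝ)) • krr H lam (d j)

end Regression

end DKRR

end

/-! Write `T` for `L_K` on `H`, `T_j` for the empirical operator of `D_j` (`empOp`) and `ξ_j` for
the mean of `(y - fρ(x)) K_x` over `D_j` (`noiseVec`). The normal equations give `f_j - fρ = (lam +
T)⁻¹ (ξ_j - lam fρ + (T - T_j)(f_j - fρ))` for the local estimators `f_j` (`krr_sub_eq_resolv`). The
first two terms are affine in `ξ_j`: averaging with the weights `|D_j| / |D|` turns the noise into
that of the pooled sample and leaves the bias alone. Only the last term feels the local sample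
sizes, and it is a product: the Hilbert–Schmidt norm of `(lam + T)^(-1/2) (T - T_j)` times `‖f_j -
fρ‖_K`, the latter estimated crudely through `‖(lam + T_j)⁻¹‖ ≤ lam⁻¹`. Cauchy–Schwarz separates the
expectations (`lintegral_seminorm_dkrr_sub_le`).

What remains are mean square deviations of empirical means in Hilbert spaces. Coordinates in an
eigenbasis of `T` turn them into sums of covariances, for which strong mixing must give a bound free
of the dimension: `24 α` for two vectors in the unit ball (`abs_sum_covariance_le`). For scalars
this follows on replacing the variables by signs; the passage to vectors is Grothendieck's
inequality, obtained from Rademacher averages and truncation, where the truncation errors form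
families of the same kind, scaled down, so that the estimate can be iterated. Each covariance is
then interpolated between the second moment `V` and the mixing bound, with weight `θ` on the latter:
`θ = 1` in the norm of `H`, and `θ = δ / (2 + δ)` in the norm weighted by `(lam + T)^(-1/2)`, where
`V` comes from the effective dimension and the pointwise bound is of order `1 / lam`.

The source condition bounds the bias by `lam ^ (r - 1/2)` in `H` and by `lam ^ r` in the form of
`lam + T` (`exists_source_version`). Both error norms are instances of one estimate, for a seminorm
`p` with `p(g)² ≤ ⟪(lam + T) g, g⟫`: the `L²` norm, and `√lam` times the norm of `H`. The choice of
`lam` makes the pooled noise `|D|^(-1/2) lam^(-s/2)` equal to the bias `lam ^ r`. -/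

namespace DKRR

/-! ### A covariance inequality for strongly mixing vectors -/

section Covariance

variable {Ω : Type*} {m0 : MeasurableSpace Ω} {P : Measure Ω}

/-- The function equal to `1` on `A` and to `-1` off `A`. -/
noncomputable def signOn (A : Set Ω) (ω : Ω) : ℝ := A.indicator (fun _ => 2) ω - 1

lemma abs_signOn (A : Set Ω) (ω : Ω) : |signOn A ω| = 1 := by
  by_cases h : ω ∈ A <;> (simp [signOn, h]; try norm_num)

lemma measurable_signOn {J : MeasurableSpace Ω} {A : Set Ω} (hA : MeasurableSet[J] A) :
    Measurable[J] (signOn A) :=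
  (measurable_const.indicator hA).sub measurable_const

lemma integrable_of_abs_le [IsFiniteMeasure P] {f : Ω → ℝ} (hf : Measurable f) {c : ℝ}
    (h : ∀ ω, |f ω| ≤ c) : Integrable f P :=
  Integrable.of_bound hf.aestronglyMeasurable c (Eventually.of_forall h)

lemma integral_signOn [IsProbabilityMeasure P] {A : Set Ω} (hA : MeasurableSet A) :
    ∫ ω, signOn A ω ∂P = 2 * P.real A - 1 := by
  unfold signOn
  rw [integral_sub ((integrable_const _).indicator hA) (integrable_const _),
    integral_indicator_const _ hA]
  simp [mul_comm]

lemma integral_signOn_mul_signOn [IsProbabilityMeasure P] {A B : Set Ω} (hA : MeasurableSet A)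
    (hB : MeasurableSet B) :
    ∫ ω, signOn A ω * signOn B ω ∂P =
      4 * P.real (A ∩ B) - 2 * P.real A - 2 * P.real B + 1 := by
  have h : ∀ ω, signOn A ω * signOn B ω = (A ∩ B).indicator (fun _ => (4 : ℝ)) ω -
      A.indicator (fun _ => 2) ω - B.indicator (fun _ => 2) ω + 1 := fun ω => by
    by_cases h1 : ω ∈ A <;> by_cases h2 : ω ∈ B <;> simp [signOn, h1, h2] <;> norm_num
  have i1 : Integrable ((A ∩ B).indicator (fun _ => (4 : ℝ))) P :=
    (integrable_const _).indicator (hA.inter hB)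
  have i2 : Integrable (A.indicator (fun _ => (2 : ℝ))) P := (integrable_const _).indicator hA
  have i3 : Integrable (B.indicator (fun _ => (2 : ℝ))) P := (integrable_const _).indicator hB
  simp_rw [h]
  have e1 := integral_add ((i1.sub i2).sub i3) (integrable_const (1 : ℝ))
  have e2 := integral_sub (i1.sub i2) i3
  simp only [Pi.sub_apply] at e1 e2
  rw [e1, e2, integral_sub i1 i2, integral_indicator_const _ (hA.inter hB),
    integral_indicator_const _ hA,
    integral_indicator_const _ hB]
  simp [mul_comm]

/-- Conditioning on `J` replaces `h` by `P[h|J]` under the integral, and among `J`-measurable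
functions bounded by 1 the sign of `P[h|J]` has the largest pairing with it. -/
lemma exists_abs_integral_mul_le_signOn [IsProbabilityMeasure P] {J : MeasurableSpace Ω}
    (hJ : J ≤ m0) {f h : Ω → ℝ} (hf : Measurable[J] f) (hf1 : ∀ ω, |f ω| ≤ 1)
    (hh : Integrable h P) :
    ∃ A, MeasurableSet[J] A ∧ |∫ ω, f ω * h ω ∂P| ≤ ∫ ω, signOn A ω * h ω ∂P := by
  have key : ∀ g : Ω → ℝ, Measurable[J] g → (∀ ω, |g ω| ≤ 1) →
      ∫ ω, g ω * h ω ∂P = ∫ ω, g ω * (P[h|J]) ω ∂P := by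
    intro g hg hg1
    have hint : Integrable (g * h) P :=
      hh.bdd_mul (hg.mono hJ le_rfl).aestronglyMeasurable (Eventually.of_forall hg1)
    have h1 := condExp_mul_of_stronglyMeasurable_left (μ := P) hg.stronglyMeasurable hint hh
    have h2 := integral_condExp (μ := P) (f := g * h) hJ
    rw [integral_congr_ae h1] at h2
    exact h2.symm
  have hm : Measurable[J] (P[h|J]) := stronglyMeasurable_condExp.measurable
  refine ⟨{ω | 0 ≤ (P[h|J]) ω}, measurableSet_le measurable_const hm, ?_⟩
  have hA : MeasurableSet[J] {ω | 0 ≤ (P[h|J]) ω} := measurableSet_le measurable_const hm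
  rw [key f hf hf1, key _ (measurable_signOn hA) fun ω => (abs_signOn _ ω).le]
  have hi : ∀ g : Ω → ℝ, Measurable[J] g → (∀ ω, |g ω| ≤ 1) →
      Integrable (fun ω => g ω * (P[h|J]) ω) P := fun g hg hg1 =>
    integrable_condExp.bdd_mul (hg.mono hJ le_rfl).aestronglyMeasurable (Eventually.of_forall hg1)
  refine abs_integral_le_integral_abs.trans (integral_mono (hi f hf hf1).abs
    (hi _ (measurable_signOn hA) fun ω => (abs_signOn _ ω).le) fun ω => ?_)
  simp only [abs_mul]
  have h3 : signOn {ω | 0 ≤ (P[h|J]) ω} ω * (P[h|J]) ω = |(P[h|J]) ω| := by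
    by_cases h4 : 0 ≤ (P[h|J]) ω
    · simp only [signOn, Set.mem_ofPred_eq, h4, Set.indicator_of_mem, abs_of_nonneg]; ring
    · simp only [signOn, Set.mem_ofPred_eq, h4, not_false_eq_true, Set.indicator_of_notMem,
        abs_of_neg (not_le.1 h4)]; ring
  rw [h3]
  exact mul_le_of_le_one_left (abs_nonneg _) (hf1 ω)

/-- The covariance of two bounded random variables in terms of the strong mixing coefficient. -/
lemma abs_cov_le [IsProbabilityMeasure P] {J K : MeasurableSpace Ω} (hJ : J ≤ m0) (hK : K ≤ m0)
    {α : ℝ} (hα : ∀ A B, MeasurableSet[J] A → MeasurableSet[K] B →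
      |P.real (A ∩ B) - P.real A * P.real B| ≤ α)
    {f g : Ω → ℝ} (hf : Measurable[J] f) (hg : Measurable[K] g) (hf1 : ∀ ω, |f ω| ≤ 1)
    (hg1 : ∀ ω, |g ω| ≤ 1) :
    |∫ ω, f ω * g ω ∂P - (∫ ω, f ω ∂P) * ∫ ω, g ω ∂P| ≤ 4 * α := by
  have center : ∀ u v : Ω → ℝ, Measurable[m0] u → Measurable[m0] v → (∀ ω, |u ω| ≤ 1) →
    (∀ ω, |v ω| ≤ 1) →
      ∫ ω, u ω * (v ω - ∫ ω, v ω ∂P) ∂P = ∫ ω, u ω * v ω ∂P - (∫ ω, u ω ∂P) * ∫ ω, v ω ∂P := by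
    intro u v hu hv hu1 hv1
    have iu : Integrable u P := integrable_of_abs_le hu hu1
    have iuv : Integrable (fun ω => u ω * v ω) P := integrable_of_abs_le (hu.mul hv) (c := 1)
      fun ω => by rw [abs_mul]; exact mul_le_one₀ (hu1 ω) (abs_nonneg _) (hv1 ω)
    simp_rw [mul_sub]
    rw [integral_sub iuv (iu.mul_const _), integral_mul_const]
  have hf' := hf.mono hJ le_rfl
  have hg' := hg.mono hK le_rfl
  -- The factors become signs in turn: first `f`, tested against the centred `g`, then `g`, tested
  -- against the centred sign of `A`. The covariance of two signs is `4 (P(A ∩ B) - P(A) P(B))`.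
  obtain ⟨A, hA, h1⟩ := exists_abs_integral_mul_le_signOn (P := P) hJ hf hf1
    (h := fun ω => g ω - ∫ ω, g ω ∂P)
    ((integrable_of_abs_le hg' hg1).sub (integrable_const _))
  have hA' := (measurable_signOn hA).mono hJ le_rfl
  have bA := fun ω => (abs_signOn A ω).le
  rw [center f g hf' hg' hf1 hg1, center _ g hA' hg' bA hg1] at h1
  obtain ⟨B, hB, h2⟩ := exists_abs_integral_mul_le_signOn (P := P) hK hg hg1
    (h := fun ω => signOn A ω - ∫ ω, signOn A ω ∂P)
    ((integrable_of_abs_le hA' bA).sub (integrable_const _))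
  have hB' := (measurable_signOn hB).mono hK le_rfl
  have bB := fun ω => (abs_signOn B ω).le
  rw [center g _ hg' hA' hg1 bA, center _ _ hB' hA' bB bA,
    integral_signOn_mul_signOn (hK _ hB) (hJ _ hA), integral_signOn (hK _ hB),
    integral_signOn (hJ _ hA), Set.inter_comm] at h2
  have h3 := (abs_le.1 (hα A B hA hB)).2
  refine h1.trans ?_
  rw [integral_signOn (hJ _ hA), mul_comm (2 * P.real A - 1)]
  simp_rw [mul_comm (signOn A _)]
  refine (le_abs_self _).trans (h2.trans ?_)
  linarith

/-! Rademacher averages. -/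

/-- The value `±1` of a sign. -/
noncomputable def sgn (b : Bool) : ℝ := if b then 1 else -1

lemma sum_fin_succ_bool (n : ℕ) (F : (Fin (n + 1) → Bool) → ℝ) :
    ∑ ε, F ε = ∑ ε : Fin n → Bool, (F (Fin.cons true ε) + F (Fin.cons false ε)) := by
  rw [← (Fin.consEquiv fun _ => Bool).sum_comp, Fintype.sum_prod_type_right]
  simp [Fin.consEquiv]

/-- Orthogonality of the signs: the cross terms of the sign split off cancel between its two values.
-/
lemma rademacher_cross (n : ℕ) (a b : Fin n → ℝ) :
    ∑ ε : Fin n → Bool, (∑ i, sgn (ε i) * a i) * (∑ i, sgn (ε i) * b i) =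
      2 ^ n * ∑ i, a i * b i := by
  induction n with
  | zero => simp
  | succ n ih =>
    rw [sum_fin_succ_bool]
    simp only [Fin.sum_univ_succ, Fin.cons_zero, Fin.cons_succ]
    have h : ∀ ε : Fin n → Bool,
        (sgn true * a 0 + ∑ i : Fin n, sgn (ε i) * a i.succ) *
            (sgn true * b 0 + ∑ i : Fin n, sgn (ε i) * b i.succ) +
          (sgn false * a 0 + ∑ i : Fin n, sgn (ε i) * a i.succ) *
            (sgn false * b 0 + ∑ i : Fin n, sgn (ε i) * b i.succ) =
        2 * (a 0 * b 0) + 2 * ((∑ i : Fin n, sgn (ε i) * a i.succ) *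
          ∑ i : Fin n, sgn (ε i) * b i.succ) := fun ε => by simp [sgn]; ring
    rw [Finset.sum_congr rfl fun ε _ => h ε, Finset.sum_add_distrib, Finset.sum_const,
      ← Finset.mul_sum, ih (fun i => a i.succ) (fun i => b i.succ)]
    simp
    ring

/-- Khinchine's inequality for the fourth moment. Odd powers of the sign split off cancel, and
`rademacher_cross` evaluates the quadratic term that is left. -/
lemma rademacher_fourth (n : ℕ) (a : Fin n → ℝ) :
    ∑ ε : Fin n → Bool, (∑ i, sgn (ε i) * a i) ^ 4 ≤ 2 ^ n * (3 * (∑ i, a i ^ 2) ^ 2) := by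
  induction n with
  | zero => simp
  | succ n ih =>
    rw [sum_fin_succ_bool]
    simp only [Fin.sum_univ_succ, Fin.cons_zero, Fin.cons_succ]
    have h : ∀ ε : Fin n → Bool,
        (sgn true * a 0 + ∑ i : Fin n, sgn (ε i) * a i.succ) ^ 4 +
          (sgn false * a 0 + ∑ i : Fin n, sgn (ε i) * a i.succ) ^ 4 =
        2 * a 0 ^ 4 + 12 * a 0 ^ 2 * ((∑ i : Fin n, sgn (ε i) * a i.succ) *
          (∑ i : Fin n, sgn (ε i) * a i.succ)) + 2 * (∑ i : Fin n, sgn (ε i) * a i.succ) ^ 4 :=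
      fun ε => by simp [sgn]; ring
    rw [Finset.sum_congr rfl fun ε _ => h ε, Finset.sum_add_distrib, Finset.sum_add_distrib,
      Finset.sum_const, ← Finset.mul_sum, ← Finset.mul_sum, rademacher_cross n (fun i => a i.succ)]
    have h1 := ih fun i => a i.succ
    simp only [← sq, Finset.card_univ, Fintype.card_pi, Fintype.card_bool,
      Finset.prod_const, Fintype.card_fin, nsmul_eq_mul, Nat.cast_pow, Nat.cast_ofNat]
    have h2 : (0 : ℝ) ≤ 2 ^ n * a 0 ^ 4 := by positivity
    rw [pow_succ (2 : ℝ) n]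
    linear_combination 2 * h1 + 4 * h2

/-- Truncation of a real number to `[-t, t]`. -/
noncomputable def clamp (t x : ℝ) : ℝ := max (-t) (min t x)

lemma abs_clamp_le {t : ℝ} (ht : 0 ≤ t) (x : ℝ) : |clamp t x| ≤ t := by
  unfold clamp; grind

lemma abs_clamp_le_abs {t : ℝ} (ht : 0 ≤ t) (x : ℝ) : |clamp t x| ≤ |x| := by
  unfold clamp; grind

lemma measurable_clamp (t : ℝ) : Measurable (clamp t) := by
  unfold clamp; fun_prop

/-- Since `(|x| - 2 t)² ≥ 0`, the excess of `|x|` over the level `t` is at most `x² / (4 t)`. Fourth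
moments thus control truncation errors in mean square. -/
lemma sub_clamp_sq_le {t : ℝ} (ht : 0 ≤ t) (x : ℝ) :
    16 * t ^ 2 * (x - clamp t x) ^ 2 ≤ x ^ 4 := by
  have h1 : 4 * t * |x - clamp t x| ≤ x ^ 2 := by
    unfold clamp
    rcases le_total t x with h | h
    · rw [min_eq_left h, max_eq_right (by linarith), abs_of_nonneg (by linarith)]
      nlinarith [sq_nonneg (x - 2 * t)]
    · rw [min_eq_right h]
      rcases le_total (-t) x with h' | h'
      · rw [max_eq_right h']; simp; positivity
      · rw [max_eq_left h', abs_of_nonpos (by linarith)]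
        nlinarith [sq_nonneg (x + 2 * t)]
  calc 16 * t ^ 2 * (x - clamp t x) ^ 2 = (4 * t * |x - clamp t x|) ^ 2 := by
        rw [mul_pow, sq_abs]; ring
    _ ≤ (x ^ 2) ^ 2 := by gcongr
    _ = x ^ 4 := by ring

/-! ### Covariances of random vectors in the unit ball -/

lemma memLp_two_of_abs_le [IsFiniteMeasure P] {f : Ω → ℝ} (hf : Measurable f) {c : ℝ}
    (h : ∀ ω, |f ω| ≤ c) : MemLp f 2 P :=
  MemLp.of_bound hf.aestronglyMeasurable c (Eventually.of_forall h)

lemma abs_le_one_of_sum_sq_le {ι : Type*} [Fintype ι] {a : ι → ℝ} (h : ∑ i, a i ^ 2 ≤ 1) (i : ι) :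
    |a i| ≤ 1 := by
  rw [← sq_le_one_iff_abs_le_one]
  exact (Finset.single_le_sum (f := fun i => a i ^ 2) (fun j _ => sq_nonneg _)
    (Finset.mem_univ i)).trans h

lemma abs_sum_mul_le_one {ι : Type*} [Fintype ι] {a b : ι → ℝ} (ha : ∑ i, a i ^ 2 ≤ 1)
    (hb : ∑ i, b i ^ 2 ≤ 1) : |∑ i, a i * b i| ≤ 1 := by
  rw [← sq_le_one_iff_abs_le_one]
  exact (Finset.sum_mul_sq_le_sq_mul_sq _ _ _).trans
    (mul_le_one₀ ha (Finset.sum_nonneg fun i _ => sq_nonneg _) hb)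

lemma sum_sq_integral_le [IsProbabilityMeasure P] {ι : Type*} [Fintype ι] {f : ι → Ω → ℝ}
    (hf : ∀ i, Measurable (f i)) (h : ∀ ω, ∑ i, f i ω ^ 2 ≤ 1) :
    ∑ i, (∫ ω, f i ω ∂P) ^ 2 ≤ 1 := by
  have hb : ∀ i ω, |f i ω| ≤ 1 := fun i ω => abs_le_one_of_sum_sq_le (h ω) i
  have hi : ∀ i, Integrable (fun ω => f i ω ^ 2) P := fun i =>
    integrable_of_abs_le ((hf i).pow_const 2) (c := 1) fun ω => by
      rw [abs_pow]; exact pow_le_one₀ (abs_nonneg _) (hb i ω)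
  have h1 : ∀ i, (∫ ω, f i ω ∂P) ^ 2 ≤ ∫ ω, f i ω ^ 2 ∂P := fun i => by
    have := variance_nonneg (f i) P
    rw [variance_eq_sub (memLp_two_of_abs_le (hf i) (hb i))] at this
    simpa using this
  calc ∑ i, (∫ ω, f i ω ∂P) ^ 2 ≤ ∑ i, ∫ ω, f i ω ^ 2 ∂P := Finset.sum_le_sum fun i _ => h1 i
    _ = ∫ ω, ∑ i, f i ω ^ 2 ∂P := (integral_finsetSum _ fun i _ => hi i).symm
    _ ≤ ∫ ω, (1 : ℝ) ∂P := integral_mono (integrable_finsetSum _ fun i _ => hi i)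
        (integrable_const _) h
    _ = 1 := by simp

/-- Cauchy–Schwarz, pointwise and for the vectors of means. This crude bound starts the iteration in
`abs_sum_covariance_le_add`. -/
lemma abs_sum_covariance_le_two [IsProbabilityMeasure P] {ι : Type*} [Fintype ι]
    {f g : ι → Ω → ℝ} (hf : ∀ i, Measurable (f i)) (hg : ∀ i, Measurable (g i))
    (hf1 : ∀ ω, ∑ i, f i ω ^ 2 ≤ 1) (hg1 : ∀ ω, ∑ i, g i ω ^ 2 ≤ 1) :
    |∑ i, cov[f i, g i; P]| ≤ 2 := by
  have bf : ∀ i ω, |f i ω| ≤ 1 := fun i ω => abs_le_one_of_sum_sq_le (hf1 ω) i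
  have bg : ∀ i ω, |g i ω| ≤ 1 := fun i ω => abs_le_one_of_sum_sq_le (hg1 ω) i
  have hi : ∀ i, Integrable (fun ω => f i ω * g i ω) P := fun i =>
    integrable_of_abs_le ((hf i).mul (hg i)) (c := 1) fun ω => by
      rw [abs_mul]; exact mul_le_one₀ (bf i ω) (abs_nonneg _) (bg i ω)
  have h0 : ∀ i, cov[f i, g i; P] = ∫ ω, f i ω * g i ω ∂P - (∫ ω, f i ω ∂P) * ∫ ω, g i ω ∂P :=
    fun i => covariance_eq_sub (memLp_two_of_abs_le (hf i) (bf i))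
      (memLp_two_of_abs_le (hg i) (bg i))
  simp_rw [h0]
  rw [Finset.sum_sub_distrib, ← integral_finsetSum _ fun i _ => hi i]
  have h1 : |∫ ω, ∑ i, f i ω * g i ω ∂P| ≤ 1 := by
    have := norm_integral_le_of_norm_le_const (μ := P) (C := 1) (f := fun ω => ∑ i, f i ω * g i ω)
      (Eventually.of_forall fun ω => abs_sum_mul_le_one (hf1 ω) (hg1 ω))
    simpa using this
  have h2 := abs_sum_mul_le_one (sum_sq_integral_le (P := P) hf hf1)
    (sum_sq_integral_le (P := P) hg hg1)
  linarith [abs_sub (∫ ω, ∑ i, f i ω * g i ω ∂P) (∑ i, (∫ ω, f i ω ∂P) * ∫ ω, g i ω ∂P)]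

/-- Averaging over signs kills the off-diagonal covariances, so a sum over coordinates becomes a
mean of covariances of scalar variables. -/
lemma sum_covariance_eq_rademacher [IsProbabilityMeasure P] {N : ℕ} {f g : Fin N → Ω → ℝ}
    (hf : ∀ i, MemLp (f i) 2 P) (hg : ∀ i, MemLp (g i) 2 P) :
    ∑ ε : Fin N → Bool, cov[fun ω => ∑ i, sgn (ε i) * f i ω, fun ω => ∑ i, sgn (ε i) * g i ω; P] =
      2 ^ N * ∑ i, cov[f i, g i; P] := by
  have h1 : ∀ ε : Fin N → Bool,
      cov[fun ω => ∑ i, sgn (ε i) * f i ω, fun ω => ∑ i, sgn (ε i) * g i ω; P] =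
      ∑ i, ∑ j, sgn (ε i) * sgn (ε j) * cov[f i, g j; P] := fun ε => by
    have := covariance_fun_sum_fun_sum (μ := P) (X := fun i ω => sgn (ε i) * f i ω)
      (Y := fun i ω => sgn (ε i) * g i ω) (fun i => (hf i).const_mul _)
      (fun i => (hg i).const_mul _)
    rw [this]
    refine Finset.sum_congr rfl fun i _ => Finset.sum_congr rfl fun j _ => ?_
    rw [covariance_const_mul_left, covariance_const_mul_right]
    ring
  have h2 : ∀ i j : Fin N, ∑ ε : Fin N → Bool, sgn (ε i) * sgn (ε j) =
      2 ^ N * if i = j then 1 else 0 := fun i j => by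
    have := rademacher_cross N (fun l => if l = i then 1 else 0) (fun l => if l = j then 1 else 0)
    simpa [Finset.sum_ite_eq, eq_comm] using this
  simp_rw [h1]
  rw [Finset.sum_comm, Finset.mul_sum]
  refine Finset.sum_congr rfl fun i _ => ?_
  rw [Finset.sum_comm]
  simp_rw [← Finset.sum_mul, h2]
  simp

/-- Grothendieck's inequality for the covariance form of two `σ`-fields, up to an error that
decreases geometrically. -/
lemma abs_sum_covariance_le_add [IsProbabilityMeasure P] {J K : MeasurableSpace Ω} (hJ : J ≤ m0)
    (hK : K ≤ m0) {α : ℝ} (hα : ∀ A B, MeasurableSet[J] A → MeasurableSet[K] B →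
      |P.real (A ∩ B) - P.real A * P.real B| ≤ α) (k : ℕ) :
    ∀ {ι : Type} [Fintype ι] (f g : ι → Ω → ℝ), (∀ i, Measurable[J] (f i)) →
      (∀ i, Measurable[K] (g i)) → (∀ ω, ∑ i, f i ω ^ 2 ≤ 1) → (∀ ω, ∑ i, g i ω ^ 2 ≤ 1) →
      |∑ i, cov[f i, g i; P]| ≤ 24 * α + 2 * (1 / 2) ^ k := by
  have hα0 : 0 ≤ α := (abs_nonneg _).trans (hα ∅ ∅ (@MeasurableSet.empty _ J)
    (@MeasurableSet.empty _ K))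
  -- The claim ranges over all finite index types because the inductive step passes from the
  -- coordinates to the sign vectors `Fin N → Bool`.
  induction k with
  | zero =>
    intro ι _ f g hf hg hf1 hg1
    have := abs_sum_covariance_le_two (P := P) (fun i => (hf i).mono hJ le_rfl)
      (fun i => (hg i).mono hK le_rfl) hf1 hg1
    simp; linarith
  | succ k ih =>
    suffices H : ∀ N (f g : Fin N → Ω → ℝ), (∀ i, Measurable[J] (f i)) →
        (∀ i, Measurable[K] (g i)) → (∀ ω, ∑ i, f i ω ^ 2 ≤ 1) → (∀ ω, ∑ i, g i ω ^ 2 ≤ 1) →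
        |∑ i, cov[f i, g i; P]| ≤ 24 * α + 2 * (1 / 2) ^ (k + 1) by
      intro ι _ f g hf hg hf1 hg1
      have e := (Fintype.equivFin ι).symm
      rw [← e.sum_comp]
      exact H _ (fun i => f (e i)) (fun i => g (e i)) (fun i => hf _) (fun i => hg _)
        (fun ω => by rw [e.sum_comp fun i => f i ω ^ 2]; exact hf1 ω)
        (fun ω => by rw [e.sum_comp fun i => g i ω ^ 2]; exact hg1 ω)
    intro N f g hf hg hf1 hg1
    -- At level `√3` the truncated variables contribute `4 t² α = 12 α`, and the truncation errors
    -- have mean square at most `3 / (16 t²) = 1 / 16` over the signs. Each of the two remainder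
    -- terms is then a quarter of the previous bound, and `12 α + (24 α + 2 / 2 ^ k) / 2 = 24 α + 2
    -- / 2 ^ (k + 1)`.
    set t : ℝ := √3 with ht
    have ht0 : 0 ≤ t := Real.sqrt_nonneg _
    have ht2 : t ^ 2 = 3 := Real.sq_sqrt (by norm_num)
    have hN : (0 : ℝ) < 2 ^ N := by positivity
    set X : (Fin N → Bool) → Ω → ℝ := fun ε ω => ∑ i, sgn (ε i) * f i ω with hX
    set Y : (Fin N → Bool) → Ω → ℝ := fun ε ω => ∑ i, sgn (ε i) * g i ω with hY
    have mX : ∀ ε, Measurable[J] (X ε) := fun ε =>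
      Finset.measurable_fun_sum _ fun i _ => (hf i).const_mul _
    have mY : ∀ ε, Measurable[K] (Y ε) := fun ε =>
      Finset.measurable_fun_sum _ fun i _ => (hg i).const_mul _
    have mXt : ∀ ε, Measurable[J] fun ω => clamp t (X ε ω) := fun ε =>
      (measurable_clamp t).comp (mX ε)
    have mYt : ∀ ε, Measurable[K] fun ω => clamp t (Y ε ω) := fun ε =>
      (measurable_clamp t).comp (mY ε)
    have sqX : ∀ (a : Fin N → ℝ), ∑ i, a i ^ 2 ≤ 1 →
        ∑ ε : Fin N → Bool, (∑ i, sgn (ε i) * a i) ^ 2 ≤ 2 ^ N := fun a ha => by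
      have := rademacher_cross N a a
      simp only [← sq] at this
      rw [this]
      exact mul_le_of_le_one_right hN.le ha
    have sqR : ∀ (a : Fin N → ℝ), ∑ i, a i ^ 2 ≤ 1 →
        16 * ∑ ε : Fin N → Bool, (∑ i, sgn (ε i) * a i - clamp t (∑ i, sgn (ε i) * a i)) ^ 2 ≤
          2 ^ N := fun a ha => by
      have h1 := rademacher_fourth N a
      have h2 : ∑ ε : Fin N → Bool, 48 * (∑ i, sgn (ε i) * a i -
          clamp t (∑ i, sgn (ε i) * a i)) ^ 2 ≤ ∑ ε : Fin N → Bool, (∑ i, sgn (ε i) * a i) ^ 4 :=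
        Finset.sum_le_sum fun ε _ => by
          have := sub_clamp_sq_le ht0 (∑ i, sgn (ε i) * a i)
          rw [ht2] at this
          linarith
      rw [← Finset.mul_sum] at h2
      have h3 : (∑ i, a i ^ 2) ^ 2 ≤ 1 :=
        pow_le_one₀ (Finset.sum_nonneg fun i _ => sq_nonneg _) ha
      have h4 : (2 : ℝ) ^ N * (3 * (∑ i, a i ^ 2) ^ 2) ≤ 2 ^ N * (3 * 1) := by gcongr
      linarith
    -- the induction hypothesis, scaled
    have scaled : ∀ (F G : (Fin N → Bool) → Ω → ℝ), (∀ ε, Measurable[J] (F ε)) →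
        (∀ ε, Measurable[K] (G ε)) → ∀ (c d : ℝ), 0 < c → 0 < d → c * d = 4 →
        (∀ ω, c ^ 2 * ∑ ε, F ε ω ^ 2 ≤ 2 ^ N) → (∀ ω, d ^ 2 * ∑ ε, G ε ω ^ 2 ≤ 2 ^ N) →
        |∑ ε, cov[F ε, G ε; P]| ≤ 2 ^ N * ((24 * α + 2 * (1 / 2) ^ k) / 4) := by
      intro F G hF hG c d hc hd hcd hF1 hG1
      set q : ℝ := √(2 ^ N) with hq
      have hq0 : 0 < q := Real.sqrt_pos.2 hN
      have hq2 : q ^ 2 = 2 ^ N := Real.sq_sqrt hN.le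
      have h := ih (fun ε ω => c / q * F ε ω) (fun ε ω => d / q * G ε ω)
        (fun ε => (hF ε).const_mul _) (fun ε => (hG ε).const_mul _)
        (fun ω => by
          simp only [mul_pow, ← Finset.mul_sum, div_pow, hq2]
          rw [div_mul_eq_mul_div]
          exact div_le_one_of_le₀ (hF1 ω) hN.le)
        (fun ω => by
          simp only [mul_pow, ← Finset.mul_sum, div_pow, hq2]
          rw [div_mul_eq_mul_div]
          exact div_le_one_of_le₀ (hG1 ω) hN.le)
      simp only [covariance_const_mul_left, covariance_const_mul_right] at h
      simp only [← Finset.mul_sum] at h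
      rw [← mul_assoc, div_mul_div_comm, mul_comm d c, hcd, ← sq, hq2, abs_mul,
        abs_of_pos (by positivity), div_mul_eq_mul_div, div_le_iff₀ hN] at h
      linarith
    have bf : ∀ i ω, |f i ω| ≤ 1 := fun i ω => abs_le_one_of_sum_sq_le (hf1 ω) i
    have bg : ∀ i ω, |g i ω| ≤ 1 := fun i ω => abs_le_one_of_sum_sq_le (hg1 ω) i
    have memf : ∀ i, MemLp (f i) 2 P := fun i =>
      memLp_two_of_abs_le ((hf i).mono hJ le_rfl) (bf i)
    have memg : ∀ i, MemLp (g i) 2 P := fun i =>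
      memLp_two_of_abs_le ((hg i).mono hK le_rfl) (bg i)
    have memX : ∀ ε, MemLp (X ε) 2 P := fun ε => memLp_finsetSum _ fun i _ => (memf i).const_mul _
    have memY : ∀ ε, MemLp (Y ε) 2 P := fun ε => memLp_finsetSum _ fun i _ => (memg i).const_mul _
    have memXt : ∀ ε, MemLp (fun ω => clamp t (X ε ω)) 2 P := fun ε =>
      memLp_two_of_abs_le ((mXt ε).mono hJ le_rfl) fun ω => abs_clamp_le ht0 _
    have memYt : ∀ ε, MemLp (fun ω => clamp t (Y ε ω)) 2 P := fun ε =>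
      memLp_two_of_abs_le ((mYt ε).mono hK le_rfl) fun ω => abs_clamp_le ht0 _
    have split : ∀ ε, cov[X ε, Y ε; P] =
        cov[fun ω => clamp t (X ε ω), fun ω => clamp t (Y ε ω); P] +
        cov[fun ω => X ε ω - clamp t (X ε ω), fun ω => clamp t (Y ε ω); P] +
        cov[X ε, fun ω => Y ε ω - clamp t (Y ε ω); P] := fun ε => by
      rw [covariance_fun_sub_left (memX ε) (memXt ε) (memYt ε),
        covariance_fun_sub_right (memX ε) (memY ε) (memYt ε)]
      ring
    have main : ∀ ε, |cov[fun ω => clamp t (X ε ω), fun ω => clamp t (Y ε ω); P]| ≤ 12 * α := by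
      intro ε
      have ht1 : 0 < t := Real.sqrt_pos.2 (by norm_num)
      have h := abs_cov_le (P := P) hJ hK hα (f := fun ω => t⁻¹ * clamp t (X ε ω))
        (g := fun ω => t⁻¹ * clamp t (Y ε ω)) ((mXt ε).const_mul _) ((mYt ε).const_mul _)
        (fun ω => by
          rw [abs_mul, abs_of_pos (inv_pos.2 ht1), inv_mul_le_iff₀ ht1, mul_one]
          exact abs_clamp_le ht0 _)
        (fun ω => by
          rw [abs_mul, abs_of_pos (inv_pos.2 ht1), inv_mul_le_iff₀ ht1, mul_one]
          exact abs_clamp_le ht0 _)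
      have h2 := covariance_eq_sub (μ := P) ((memXt ε).const_mul t⁻¹) ((memYt ε).const_mul t⁻¹)
      simp only [Pi.mul_apply] at h2
      rw [← h2, covariance_const_mul_left, covariance_const_mul_right, ← mul_assoc, ← mul_inv,
        ← sq, ht2, abs_mul, abs_of_pos (by norm_num : (0 : ℝ) < 3⁻¹)] at h
      linarith
    have h1 : |∑ ε, cov[fun ω => clamp t (X ε ω), fun ω => clamp t (Y ε ω); P]| ≤
        2 ^ N * (12 * α) := by
      refine (Finset.abs_sum_le_sum_abs _ _).trans ((Finset.sum_le_sum fun ε _ => main ε).trans ?_)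
      simp
    have clampsq : ∀ x, clamp t x ^ 2 ≤ x ^ 2 := fun x => sq_le_sq.2 (abs_clamp_le_abs ht0 x)
    -- For every `ω` the truncation errors, multiplied by 4 and divided by `√(2 ^ N)`, lie in the
    -- unit ball; the other factor needs no gain, hence the scalings 4 and 1.
    have h2 := scaled (fun ε ω => X ε ω - clamp t (X ε ω)) (fun ε ω => clamp t (Y ε ω))
      (fun ε => (mX ε).sub (mXt ε)) mYt 4 1 (by norm_num) one_pos (by norm_num)
      (fun ω => by norm_num; exact sqR _ (hf1 ω))
      (fun ω => by
        rw [one_pow, one_mul]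
        exact (Finset.sum_le_sum fun ε _ => clampsq _).trans (sqX _ (hg1 ω)))
    have h3 := scaled X (fun ε ω => Y ε ω - clamp t (Y ε ω))
      mX (fun ε => (mY ε).sub (mYt ε)) 1 4 one_pos (by norm_num) (by norm_num)
      (fun ω => by rw [one_pow, one_mul]; exact sqX _ (hf1 ω))
      (fun ω => by norm_num; exact sqR _ (hg1 ω))
    have h4 := sum_covariance_eq_rademacher memf memg
    change ∑ ε, cov[X ε, Y ε; P] = _ at h4
    simp_rw [split] at h4
    rw [Finset.sum_add_distrib, Finset.sum_add_distrib] at h4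
    have h5 : 2 ^ N * |∑ i, cov[f i, g i; P]| ≤ 2 ^ N * (24 * α + 2 * (1 / 2) ^ (k + 1)) := by
      rw [← abs_of_pos hN, ← abs_mul, ← h4, abs_of_pos hN, pow_succ]
      refine (abs_add_three _ _ _).trans ?_
      linarith
    exact le_of_mul_le_mul_left h5 hN

/-- The covariance inequality for vectors: for a strong mixing coefficient `α`, the covariances of
the coordinates of two vectors in the Euclidean unit ball sum up to at most `24 α`. -/
lemma abs_sum_covariance_le [IsProbabilityMeasure P] {J K : MeasurableSpace Ω} (hJ : J ≤ m0)
    (hK : K ≤ m0) {α : ℝ} (hα : ∀ A B, MeasurableSet[J] A → MeasurableSet[K] B →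
      |P.real (A ∩ B) - P.real A * P.real B| ≤ α) {ι : Type} [Fintype ι] (f g : ι → Ω → ℝ)
    (hf : ∀ i, Measurable[J] (f i)) (hg : ∀ i, Measurable[K] (g i))
    (hf1 : ∀ ω, ∑ i, f i ω ^ 2 ≤ 1) (hg1 : ∀ ω, ∑ i, g i ω ^ 2 ≤ 1) :
    |∑ i, cov[f i, g i; P]| ≤ 24 * α := by
  have h : Tendsto (fun k : ℕ => 24 * α + 2 * (1 / 2 : ℝ) ^ k) atTop (𝓝 (24 * α + 2 * 0)) :=
    ((tendsto_pow_atTop_nhds_zero_of_lt_one (by norm_num) (by norm_num)).const_mul 2).const_add _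
  rw [mul_zero, add_zero] at h
  exact ge_of_tendsto' h fun k => abs_sum_covariance_le_add hJ hK hα k f g hf hg hf1 hg1

end Covariance

/-! ### Mean square deviations of empirical averages over mixing samples -/

section Deviation

/-- Supplies the upper bound without which the real `sSup` in `alphaCoeff` and `mixingCoeff` would
take its default value 0. -/
lemma abs_measureReal_inter_sub_le_one {Ω : Type*} {m0 : MeasurableSpace Ω} {P : Measure Ω}
    [IsProbabilityMeasure P] (A B : Set Ω) :
    |P.real (A ∩ B) - P.real A * P.real B| ≤ 1 := by
  have h1 : P.real (A ∩ B) ≤ 1 := measureReal_le_one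
  have h2 : P.real A * P.real B ≤ 1 :=
    mul_le_one₀ measureReal_le_one measureReal_nonneg measureReal_le_one
  have h3 : 0 ≤ P.real A * P.real B := mul_nonneg measureReal_nonneg measureReal_nonneg
  have h4 : 0 ≤ P.real (A ∩ B) := measureReal_nonneg
  rw [abs_le]; constructor <;> linarith

lemma le_alphaCoeff {Ω : Type*} {J K m0 : MeasurableSpace Ω} {P : Measure Ω}
    [IsProbabilityMeasure P]
    {A B : Set Ω}
    (hA : MeasurableSet[J] A) (hB : MeasurableSet[K] B) :
    |P.real (A ∩ B) - P.real A * P.real B| ≤ alphaCoeff P J K := by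
  refine le_csSup ⟨1, ?_⟩ ⟨A, B, hA, hB, rfl⟩
  rintro _ ⟨A, B, -, -, rfl⟩
  exact abs_measureReal_inter_sub_le_one A B

lemma alphaCoeff_le_one {Ω : Type*} (J K : MeasurableSpace Ω) {m0 : MeasurableSpace Ω}
    {P : Measure Ω}
    [IsProbabilityMeasure P] :
    alphaCoeff P J K ≤ 1 := by
  refine Real.sSup_le ?_ zero_le_one
  rintro _ ⟨A, B, -, -, rfl⟩
  exact abs_measureReal_inter_sub_le_one A B

variable {Ω E : Type*} [MeasurableSpace Ω] [MeasurableSpace E] {P : Measure Ω}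

lemma alphaCoeff_le_mixingCoeff [IsProbabilityMeasure P] {n : ℕ} (Z : Fin n → Ω → E) (l : ℕ) {k : ℕ}
    (hk : 1 ≤ k) :
    alphaCoeff P (sigmaField Z {i | (i : ℕ) + 1 ≤ k}) (sigmaField Z {i | k + l ≤ (i : ℕ) + 1}) ≤
      mixingCoeff P Z l := by
  refine le_csSup ⟨1, ?_⟩ ⟨k, hk, rfl⟩
  rintro _ ⟨k, -, rfl⟩
  exact alphaCoeff_le_one _ _

lemma mixingCoeff_nonneg [IsProbabilityMeasure P] {n : ℕ} (Z : Fin n → Ω → E) (l : ℕ) :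
    0 ≤ mixingCoeff P Z l := by
  refine le_trans ?_ (alphaCoeff_le_mixingCoeff (P := P) Z l (k := 1) le_rfl)
  exact (abs_nonneg _).trans (le_alphaCoeff (MeasurableSpace.measurableSet_empty _)
    (MeasurableSpace.measurableSet_empty _))

lemma abs_measureReal_inter_sub_le_mixingCoeff [IsProbabilityMeasure P] {n : ℕ} (Z : Fin n → Ω → E)
    {i j : Fin n} (hij : i < j) {A B : Set Ω}
    (hA : MeasurableSet[MeasurableSpace.comap (Z i) inferInstance] A)
    (hB : MeasurableSet[MeasurableSpace.comap (Z j) inferInstance] B) :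
    |P.real (A ∩ B) - P.real A * P.real B| ≤ mixingCoeff P Z (j - i : ℕ) := by
  -- `Z i` is term number `i + 1`: the past is cut at `k = i + 1`, and lag `j - i` lets the future
  -- start at term number `j + 1`.
  refine le_trans (le_alphaCoeff (J := sigmaField Z {i' | (i' : ℕ) + 1 ≤ i + 1})
    (K := sigmaField Z {i' | i + 1 + (j - i) ≤ (i' : ℕ) + 1}) ?_ ?_)
    (alphaCoeff_le_mixingCoeff (P := P) Z (j - i : ℕ) (k := i + 1) (by omega))
  · exact le_iSup₂ (f := fun i' (_ : i' ∈ {i' : Fin n | (i' : ℕ) + 1 ≤ i + 1}) =>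
      MeasurableSpace.comap (Z i') inferInstance) i (by simp) A hA
  · have : (i : ℕ) < j := hij
    exact le_iSup₂ (f := fun i' (_ : i' ∈ {i' : Fin n | i + 1 + (j - i) ≤ (i' : ℕ) + 1}) =>
      MeasurableSpace.comap (Z i') inferInstance) j (by simp; omega) B hB

/-- The variances of `f + g` and of `f - g` are nonnegative. -/
lemma abs_covariance_le_half [IsProbabilityMeasure P] {f g : Ω → ℝ} (hf : MemLp f 2 P)
    (hg : MemLp g 2 P) : |cov[f, g; P]| ≤ (∫ ω, f ω ^ 2 ∂P + ∫ ω, g ω ^ 2 ∂P) / 2 := by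
  have h1 := variance_nonneg (f + g) P
  have h2 := variance_nonneg (f - g) P
  rw [variance_add hf hg] at h1
  rw [variance_sub hf hg] at h2
  have h3 : Var[f; P] ≤ ∫ ω, f ω ^ 2 ∂P := variance_le_expectation_sq hf.aestronglyMeasurable
  have h4 : Var[g; P] ≤ ∫ ω, g ω ^ 2 ∂P := variance_le_expectation_sq hg.aestronglyMeasurable
  rw [abs_le]; constructor <;> linarith

/-- Serves to interpolate a covariance between its second-moment bound and its mixing bound. -/
lemma le_rpow_mul_rpow {x a b θ : ℝ} (hx : 0 ≤ x) (ha : x ≤ a) (hb : x ≤ b) (h0 : 0 ≤ θ)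
    (h1 : θ ≤ 1) : x ≤ a ^ (1 - θ) * b ^ θ := by
  calc x = x ^ ((1 - θ) + θ) := by simp
    _ = x ^ (1 - θ) * x ^ θ := Real.rpow_add_of_nonneg hx (by linarith) h0
    _ ≤ a ^ (1 - θ) * b ^ θ := by
        have := Real.rpow_nonneg (hx.trans ha) (1 - θ)
        gcongr

/-- In each row, every lag occurs at most once on either side of the diagonal. -/
lemma sum_lag_le {n : ℕ} (β : ℕ → ℝ) (hβ : ∀ l, 1 ≤ l → 0 ≤ β l) (B : Fin n → Fin n → ℝ) (V : ℝ)
    (hd : ∀ i, B i i ≤ V) (hlt : ∀ i j : Fin n, i < j → B i j ≤ β (j - i : ℕ))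
    (hgt : ∀ i j : Fin n, i < j → B j i ≤ β (j - i : ℕ)) :
    ∑ i, ∑ j, B i j ≤ n * (V + 2 * ∑ l ∈ Finset.Icc 1 n, β l) := by
  have key : ∀ i, ∑ j, B i j ≤ V + 2 * ∑ l ∈ Finset.Icc 1 n, β l := by
    intro i
    have h0 : ∀ l ∈ Finset.Icc 1 n, 0 ≤ β l := fun l hl => hβ l (Finset.mem_Icc.1 hl).1
    have h1 : ∀ j, B i j ≤ (if j = i then V else 0) +
        ((if j < i then β (i - j : ℕ) else 0) + if i < j then β (j - i : ℕ) else 0) := by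
      intro j
      rcases lt_trichotomy j i with h | h | h
      · simpa [h, h.ne, h.not_gt] using hgt j i h
      · subst h; simpa using hd j
      · simpa [h, h.ne', h.not_gt] using hlt i j h
    refine (Finset.sum_le_sum fun j _ => h1 j).trans ?_
    rw [Finset.sum_add_distrib, Finset.sum_add_distrib, Finset.sum_ite_eq',
      if_pos (Finset.mem_univ _),
      two_mul, ← Finset.sum_filter, ← Finset.sum_filter]
    gcongr ?_ + (?_ + ?_)
    · exact le_rfl
    · rw [← Finset.sum_image (f := β) (g := fun j : Fin n => (i - j : ℕ))]
      · refine Finset.sum_le_sum_of_subset_of_nonneg ?_ fun l hl _ => h0 l hl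
        intro l hl
        simp only [Finset.mem_image, Finset.mem_filter, Finset.mem_univ, true_and] at hl
        obtain ⟨j, hj, rfl⟩ := hl
        have : (j : ℕ) < i := hj
        simp only [Finset.mem_Icc]; omega
      · intro j hj k hk h
        simp only [Finset.coe_filter, Finset.mem_univ, true_and] at hj hk
        have h1 : (j : ℕ) < i := hj
        have h2 : (k : ℕ) < i := hk
        simp only at h
        exact Fin.ext (by omega)
    · rw [← Finset.sum_image (f := β) (g := fun j : Fin n => (j - i : ℕ))]
      · refine Finset.sum_le_sum_of_subset_of_nonneg ?_ fun l hl _ => h0 l hl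
        intro l hl
        simp only [Finset.mem_image, Finset.mem_filter, Finset.mem_univ, true_and] at hl
        obtain ⟨j, hj, rfl⟩ := hl
        have : (i : ℕ) < j := hj
        simp only [Finset.mem_Icc]; omega
      · intro j hj k hk h
        simp only [Finset.coe_filter, Finset.mem_univ, true_and] at hj hk
        have h1 : (i : ℕ) < j := hj
        have h2 : (i : ℕ) < k := hk
        simp only at h
        exact Fin.ext (by omega)
  refine (Finset.sum_le_sum fun i _ => key i).trans_eq ?_
  simp [mul_add]

variable {ρ : Measure E}

/-- A finite sample of law `ρ` whose strong mixing coefficients are bounded by the sequence `α`. -/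
structure IsMixingSample (P : Measure Ω) (ρ : Measure E) (α : ℕ → ℝ) {n : ℕ}
    (Z : Fin n → Ω → E) : Prop where
  measurable : ∀ i, Measurable (Z i)
  map_eq : ∀ i, P.map (Z i) = ρ
  mixing : ∀ l, 1 ≤ l → mixingCoeff P Z l ≤ α l

lemma IsMixingSample.alpha_nonneg [IsProbabilityMeasure P] {α : ℕ → ℝ} {n : ℕ} {Z : Fin n → Ω → E}
    (hZ : IsMixingSample P ρ α Z) {l : ℕ} (hl : 1 ≤ l) : 0 ≤ α l :=
  (mixingCoeff_nonneg Z l).trans (hZ.mixing l hl)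

/-- The vector inequality after rescaling by `a⁻¹`; the coordinates are renumbered by `Fin` because
that inequality is stated for index types in `Type`. -/
lemma IsMixingSample.abs_sum_covariance_le [IsProbabilityMeasure P] {α : ℕ → ℝ} {n : ℕ}
    {Z : Fin n → Ω → E} (hZ : IsMixingSample P ρ α Z) {ι : Type*} (F : Finset ι)
    {φ : ι → E → ℝ} (hφ : ∀ k, Measurable (φ k)) {a : ℝ} (ha : 0 < a)
    (hb : ∀ e, ∑ k ∈ F, φ k e ^ 2 ≤ a ^ 2) {i j : Fin n} (hij : i < j) :
    |∑ k ∈ F, cov[fun ω => φ k (Z i ω), fun ω => φ k (Z j ω); P]| ≤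
      24 * a ^ 2 * α (j - i : ℕ) := by
  let c := F.equivFin.symm
  have hsum : ∀ G : ι → ℝ, ∑ k ∈ F, G k = ∑ q, G (c q) := fun G => by
    rw [← Finset.sum_coe_sort F G, ← c.sum_comp]
  have hij' : 1 ≤ (j - i : ℕ) := by have : (i : ℕ) < j := hij; omega
  have hb' : ∀ e, ∑ q, (a⁻¹ * φ (c q) e) ^ 2 ≤ 1 := fun e => by
    simp_rw [mul_pow, ← Finset.mul_sum]
    rw [← hsum fun k => φ k e ^ 2, inv_pow, inv_mul_le_iff₀ (by positivity), mul_one]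
    exact hb e
  have h := DKRR.abs_sum_covariance_le (P := P) (hZ.measurable i).comap_le
    (hZ.measurable j).comap_le
    (α := α (j - i : ℕ)) (fun A B hA hB =>
      (abs_measureReal_inter_sub_le_mixingCoeff Z hij hA hB).trans (hZ.mixing _ hij'))
    (fun q ω => a⁻¹ * φ (c q) (Z i ω)) (fun q ω => a⁻¹ * φ (c q) (Z j ω))
    (fun q => ((hφ _).comp (comap_measurable (Z i))).const_mul _)
    (fun q => ((hφ _).comp (comap_measurable (Z j))).const_mul _)
    (fun ω => hb' _) (fun ω => hb' _)
  simp only [covariance_const_mul_left, covariance_const_mul_right, ← Finset.mul_sum] at h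
  rw [← hsum fun k => cov[fun ω => φ k (Z i ω), fun ω => φ k (Z j ω); P], ← mul_assoc, ← mul_inv,
    ← sq, abs_mul, abs_of_pos (by positivity), inv_mul_le_iff₀ (by positivity)] at h
  linarith

/-- Each variance is `n⁻²` times a double sum of covariances over the sample. Summing over the
coordinates before the pairs of sample points keeps the number of coordinates out of the bound. -/
lemma IsMixingSample.sum_integral_sq_le [IsProbabilityMeasure P] {α : ℕ → ℝ} {n : ℕ} (hn : 0 < n)
    {Z : Fin n → Ω → E} (hZ : IsMixingSample P ρ α Z) {ι : Type*} (F : Finset ι)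
    {φ : ι → E → ℝ} (hφ : ∀ k, Measurable (φ k)) {a V θ : ℝ} (ha : 0 < a)
    (hb : ∀ e, ∑ k ∈ F, φ k e ^ 2 ≤ a ^ 2) (hV : ∑ k ∈ F, ∫ e, φ k e ^ 2 ∂ρ ≤ V) (h0 : 0 ≤ θ)
    (h1 : θ ≤ 1) :
    ∑ k ∈ F, ∫ ω, ((1 / (n : ℝ)) * ∑ i, φ k (Z i ω) - ∫ e, φ k e ∂ρ) ^ 2 ∂P ≤
      (1 / n) * (V + 2 * ∑ l ∈ Finset.Icc 1 n, V ^ (1 - θ) * (24 * a ^ 2 * α l) ^ θ) := by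
  have hV0 : 0 ≤ V := (Finset.sum_nonneg fun k _ => integral_nonneg fun e => sq_nonneg _).trans hV
  have bd : ∀ k ∈ F, ∀ e, |φ k e| ≤ a := fun k hk e => abs_le_of_sq_le_sq
    ((Finset.single_le_sum (f := fun k => φ k e ^ 2) (fun _ _ => sq_nonneg _) hk).trans
      (hb e)) ha.le
  have mem : ∀ k ∈ F, ∀ i, MemLp (fun ω => φ k (Z i ω)) 2 P := fun k hk i =>
    memLp_two_of_abs_le ((hφ k).comp (hZ.measurable i)) fun ω => bd k hk _
  have law : ∀ (g : E → ℝ), Measurable g → ∀ i, ∫ ω, g (Z i ω) ∂P = ∫ e, g e ∂ρ := fun g hg i => by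
    rw [← hZ.map_eq i, integral_map (hZ.measurable i).aemeasurable hg.aestronglyMeasurable]
  have hn' : (0 : ℝ) < n := by exact_mod_cast hn
  have var : ∀ k ∈ F, ∫ ω, ((1 / (n : ℝ)) * ∑ i, φ k (Z i ω) - ∫ e, φ k e ∂ρ) ^ 2 ∂P =
      (1 / (n : ℝ)) ^ 2 * ∑ i, ∑ j, cov[fun ω => φ k (Z i ω), fun ω => φ k (Z j ω); P] := by
    intro k hk
    have hm : MemLp (fun ω => (1 / (n : ℝ)) * ∑ i, φ k (Z i ω)) 2 P :=
      (memLp_finsetSum _ fun i _ => mem k hk i).const_mul _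
    have hmean : ∫ ω, (1 / (n : ℝ)) * ∑ i, φ k (Z i ω) ∂P = ∫ e, φ k e ∂ρ := by
      rw [integral_const_mul, integral_finsetSum _ fun i _ => (mem k hk i).integrable (by norm_num)]
      simp_rw [law _ (hφ k)]
      simp
      field_simp
    have e1 := variance_eq_integral hm.aestronglyMeasurable.aemeasurable
    rw [hmean] at e1
    rw [← e1, variance_const_mul, ← covariance_self
      (memLp_finsetSum _ fun i _ => mem k hk i).aestronglyMeasurable.aemeasurable,
      covariance_fun_sum_fun_sum (mem k hk) (mem k hk)]
  rw [Finset.sum_congr rfl var, ← Finset.mul_sum, Finset.sum_comm]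
  simp_rw [Finset.sum_comm (s := F)]
  have triv : ∀ i j, |∑ k ∈ F, cov[fun ω => φ k (Z i ω), fun ω => φ k (Z j ω); P]| ≤ V := by
    intro i j
    refine (Finset.abs_sum_le_sum_abs _ _).trans (le_trans (Finset.sum_le_sum fun k hk => ?_) hV)
    refine (abs_covariance_le_half (mem k hk i) (mem k hk j)).trans_eq ?_
    rw [law (fun e => φ k e ^ 2) ((hφ k).pow_const 2),
      law (fun e => φ k e ^ 2) ((hφ k).pow_const 2)]
    ring
  have lag : ∀ i j : Fin n, i < j → |∑ k ∈ F, cov[fun ω => φ k (Z i ω), fun ω => φ k (Z j ω); P]| ≤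
      V ^ (1 - θ) * (24 * a ^ 2 * α (j - i : ℕ)) ^ θ := fun i j hij =>
    le_rpow_mul_rpow (abs_nonneg _) (triv i j) (hZ.abs_sum_covariance_le F hφ ha hb hij) h0 h1
  have h2 := sum_lag_le (fun l => V ^ (1 - θ) * (24 * a ^ 2 * α l) ^ θ)
    (fun l hl => by have := hZ.alpha_nonneg hl; positivity)
    (fun i j => ∑ k ∈ F, cov[fun ω => φ k (Z i ω), fun ω => φ k (Z j ω); P]) V
    (fun i => (le_abs_self _).trans (triv i i))
    (fun i j hij => (le_abs_self _).trans (lag i j hij))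
    (fun i j hij => by
      simp_rw [covariance_comm (fun ω => φ _ (Z j ω))]
      exact (le_abs_self _).trans (lag i j hij))
  refine (mul_le_mul_of_nonneg_left h2 (by positivity)).trans_eq ?_
  field_simp

/-- The squared Euclidean distance of the empirical mean and the mean of the family `φ`. -/
noncomputable def devSq {ι : Type*} (ρ : Measure E) (φ : ι → E → ℝ) {n : ℕ} (d : Fin n → E) :
    ℝ≥0∞ :=
  ∑' k, ENNReal.ofReal (((1 / (n : ℝ)) * ∑ i, φ k (d i) - ∫ e, φ k e ∂ρ) ^ 2)

lemma measurable_devSq {ι : Type*} [Countable ι] {φ : ι → E → ℝ} (hφ : ∀ k, Measurable (φ k))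
    {n : ℕ} {Z : Fin n → Ω → E} (hZ : ∀ i, Measurable (Z i)) :
    Measurable fun ω => devSq ρ φ fun i => Z i ω := by
  unfold devSq
  refine Measurable.tsum fun k => ENNReal.measurable_ofReal.comp ?_
  exact (((Finset.measurable_fun_sum _ fun i _ => (hφ k).comp (hZ i)).const_mul _).sub_const
    _).pow_const 2

/-- The bound for finite families is uniform in `F`, so it passes to the supremum of the partial
sums. -/
lemma IsMixingSample.lintegral_devSq_le [IsProbabilityMeasure P] {α : ℕ → ℝ} {n : ℕ} (hn : 0 < n)
    {Z : Fin n → Ω → E} (hZ : IsMixingSample P ρ α Z) {ι : Type*} [Countable ι]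
    {φ : ι → E → ℝ} (hφ : ∀ k, Measurable (φ k)) {a V θ : ℝ} (ha : 0 < a)
    (hb : ∀ (F : Finset ι) e, ∑ k ∈ F, φ k e ^ 2 ≤ a ^ 2)
    (hV : ∀ F : Finset ι, ∑ k ∈ F, ∫ e, φ k e ^ 2 ∂ρ ≤ V) (h0 : 0 ≤ θ) (h1 : θ ≤ 1) :
    ∫⁻ ω, devSq ρ φ (fun i => Z i ω) ∂P ≤ ENNReal.ofReal
      ((1 / n) * (V + 2 * ∑ l ∈ Finset.Icc 1 n, V ^ (1 - θ) * (24 * a ^ 2 * α l) ^ θ)) := by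
  have hm : ∀ k, Measurable fun ω => ((1 / (n : ℝ)) * ∑ i, φ k (Z i ω) - ∫ e, φ k e ∂ρ) ^ 2 :=
    fun k => (((Finset.measurable_fun_sum _ fun i _ =>
      (hφ k).comp (hZ.measurable i)).const_mul _).sub_const _).pow_const 2
  unfold devSq
  rw [lintegral_tsum fun k => (hm k).ennreal_ofReal.aemeasurable, ENNReal.tsum_eq_iSup_sum]
  refine iSup_le fun F => ?_
  have hint : ∀ k, Integrable (fun ω =>
      ((1 / (n : ℝ)) * ∑ i, φ k (Z i ω) - ∫ e, φ k e ∂ρ) ^ 2) P := fun k => by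
    have bd : ∀ e, |φ k e| ≤ a := fun e => abs_le_of_sq_le_sq (by simpa using hb {k} e) ha.le
    have hm : MemLp (fun ω => (1 / (n : ℝ)) * ∑ i, φ k (Z i ω) - ∫ e, φ k e ∂ρ) 2 P :=
      MemLp.sub ((memLp_finsetSum _ fun i _ => memLp_two_of_abs_le
        ((hφ k).comp (hZ.measurable i)) fun ω => bd _).const_mul _) (memLp_const _)
    exact hm.integrable_sq
  calc ∑ k ∈ F, ∫⁻ ω, ENNReal.ofReal
        (((1 / (n : ℝ)) * ∑ i, φ k (Z i ω) - ∫ e, φ k e ∂ρ) ^ 2) ∂P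
      = ∑ k ∈ F, ENNReal.ofReal
          (∫ ω, ((1 / (n : ℝ)) * ∑ i, φ k (Z i ω) - ∫ e, φ k e ∂ρ) ^ 2 ∂P) :=
        Finset.sum_congr rfl fun k _ => (ofReal_integral_eq_lintegral_ofReal (hint k)
          (Eventually.of_forall fun ω => sq_nonneg _)).symm
    _ = ENNReal.ofReal (∑ k ∈ F,
          ∫ ω, ((1 / (n : ℝ)) * ∑ i, φ k (Z i ω) - ∫ e, φ k e ∂ρ) ^ 2 ∂P) :=
        (ENNReal.ofReal_sum_of_nonneg fun k _ => integral_nonneg fun ω => sq_nonneg _).symm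
    _ ≤ _ := ENNReal.ofReal_le_ofReal
        (hZ.sum_integral_sq_le hn F hφ ha (hb F) (hV F) h0 h1)

end Deviation

/-! ### Eigenbases and resolvents of positive compact operators -/

section Spectral

universe u

variable {E : Type u} [NormedAddCommGroup E] [InnerProductSpace ℝ E]

/-- Distinct basis vectors are at distance `√2`, so the balls of radius `1 / 2` around them are
disjoint open sets in a separable space. -/
lemma countable_of_hilbertBasis [TopologicalSpace.SeparableSpace E] {ι : Type*}
    (b : HilbertBasis ι ℝ E) : Countable ι := by
  refine Pairwise.countable_of_isOpen_disjoint (s := fun i => Metric.ball (b i) (1 / 2)) ?_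
    (fun i => Metric.isOpen_ball) (fun i => ⟨b i, Metric.mem_ball_self (by norm_num)⟩)
  intro i j hij
  refine Metric.ball_disjoint_ball ?_
  have h1 : ‖b i - b j‖ ^ 2 = 2 := by
    rw [norm_sub_sq_real, b.orthonormal.1 i, b.orthonormal.1 j, b.orthonormal.2 hij]
    norm_num
  rw [dist_eq_norm]
  nlinarith [norm_nonneg (b i - b j)]

lemma hasSum_inner_sq {ι : Type*} (b : HilbertBasis ι ℝ E) (x : E) :
    HasSum (fun i => ⟪x, b i⟫_ℝ ^ 2) (‖x‖ ^ 2) := by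
  have h := b.hasSum_inner_mul_inner x x
  have e : ∀ i, ⟪x, b i⟫_ℝ * ⟪b i, x⟫_ℝ = ⟪x, b i⟫_ℝ ^ 2 := fun i => by
    rw [real_inner_comm x, sq]
  simp_rw [e] at h
  rwa [real_inner_self_eq_norm_sq] at h

variable [CompleteSpace E]

/-- Hilbert bases of all eigenspaces are put together; by the spectral theorem nothing is orthogonal
to every eigenspace. -/
lemma exists_hilbertBasis_eigenvectors {T : E →L[ℝ] E} (hT : IsCompactOperator T)
    (hs : (T : E →ₗ[ℝ] E).IsSymmetric) :
    ∃ (ι : Type u) (b : HilbertBasis ι ℝ E) (τ : ι → ℝ), ∀ k, T (b k) = τ k • b k := by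
  let V : ℝ → Submodule ℝ E := fun μ => Module.End.eigenspace (T : Module.End ℝ E) μ
  have hV : OrthogonalFamily ℝ (fun μ => V μ) fun μ => (V μ).subtypeₗᵢ :=
    hs.orthogonalFamily_eigenspaces
  have hclosed : ∀ μ, IsClosed (V μ : Set E) := fun μ => by
    have : (V μ : Set E) = {x | T x = μ • x} := by
      ext x; simp [V]
    rw [this]
    exact isClosed_eq T.continuous (continuous_const_smul μ)
  have : ∀ μ, CompleteSpace (V μ) := fun μ => (hclosed μ).completeSpace_coe
  choose w c hc using fun μ => exists_hilbertBasis ℝ (V μ)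
  have hv := hV.orthonormal_sigma_orthonormal (v_family := fun μ i => c μ i)
    fun μ => (c μ).orthonormal
  have hbot : (Submodule.span ℝ (Set.range fun a : Σ μ, w μ => (V a.1).subtypeₗᵢ (c a.1 a.2)))ᗮ =
      ⊥ := by
    rw [eq_bot_iff, ← ContinuousLinearMap.orthogonalComplement_iSup_eigenspaces_eq_bot hT hs]
    intro x hx
    rw [← Submodule.iInf_orthogonal, Submodule.mem_iInf]
    intro μ
    rw [Submodule.mem_orthogonal]
    intro u hu
    have h1 := (c μ).hasSum_inner_mul_inner ⟨u, hu⟩ ((V μ).orthogonalProjectionOnto x)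
    have h2 : ∀ i, ⟪c μ i, (V μ).orthogonalProjectionOnto x⟫_ℝ = 0 := fun i => by
      rw [Submodule.inner_orthogonalProjectionOnto_eq_of_mem_left]
      exact (Submodule.mem_orthogonal _ _).1 hx _ (Submodule.subset_span ⟨⟨μ, i⟩, rfl⟩)
    simp only [h2, mul_zero] at h1
    have h3 := h1.unique hasSum_zero
    rwa [Submodule.inner_orthogonalProjectionOnto_eq_of_mem_left] at h3
  refine ⟨Σ μ, w μ, HilbertBasis.mkOfOrthogonalEqBot hv hbot, fun a => a.1, fun a => ?_⟩
  rw [HilbertBasis.coe_mkOfOrthogonalEqBot]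
  exact Module.End.mem_eigenspace_iff.1 (c a.1 a.2).2

lemma isUnit_smul_one_add {T : E →L[ℝ] E} (hpos : ∀ x, 0 ≤ ⟪T x, x⟫_ℝ) {lam : ℝ} (hl : 0 < lam) :
    IsUnit (lam • (1 : E →L[ℝ] E) + T) := by
  refine ContinuousLinearMap.isUnit_of_forall_le_norm_inner_map _ (c := lam.toNNReal) (by simpa)
    fun x => ?_
  have h := hpos x
  have : ⟪(lam • (1 : E →L[ℝ] E) + T) x, x⟫_ℝ = lam * ‖x‖ ^ 2 + ⟪T x, x⟫_ℝ := by
    simp [inner_add_left, inner_smul_left]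
  rw [this, Real.norm_eq_abs, abs_of_nonneg (by positivity), Real.coe_toNNReal _ hl.le]
  linarith

/-- The resolvent `(lam + T)⁻¹`. -/
noncomputable def resolv (T : E →L[ℝ] E) (lam : ℝ) : E →L[ℝ] E :=
  Ring.inverse (lam • (1 : E →L[ℝ] E) + T)

lemma add_resolv {T : E →L[ℝ] E} (hpos : ∀ x, 0 ≤ ⟪T x, x⟫_ℝ) {lam : ℝ} (hl : 0 < lam) (x : E) :
    lam • resolv T lam x + T (resolv T lam x) = x := by
  have := DFunLike.congr_fun (Ring.mul_inverse_cancel _ (isUnit_smul_one_add hpos hl)) x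
  simpa [resolv] using this

lemma resolv_add {T : E →L[ℝ] E} (hpos : ∀ x, 0 ≤ ⟪T x, x⟫_ℝ) {lam : ℝ} (hl : 0 < lam) (x : E) :
    resolv T lam (lam • x + T x) = x := by
  have := DFunLike.congr_fun (Ring.inverse_mul_cancel _ (isUnit_smul_one_add hpos hl)) x
  simpa [resolv] using this

lemma norm_resolv_le {T : E →L[ℝ] E} (hpos : ∀ x, 0 ≤ ⟪T x, x⟫_ℝ) {lam : ℝ} (hl : 0 < lam) (x : E) :
    ‖resolv T lam x‖ ≤ lam⁻¹ * ‖x‖ := by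
  set y := resolv T lam x with hy
  have h1 : lam * ‖y‖ ^ 2 ≤ ‖x‖ * ‖y‖ := by
    calc lam * ‖y‖ ^ 2 ≤ lam * ‖y‖ ^ 2 + ⟪T y, y⟫_ℝ := le_add_of_nonneg_right (hpos y)
      _ = ⟪lam • y + T y, y⟫_ℝ := by simp [inner_add_left, inner_smul_left]
      _ = ⟪x, y⟫_ℝ := by rw [hy, add_resolv hpos hl]
      _ ≤ ‖x‖ * ‖y‖ := real_inner_le_norm _ _
  rw [← div_eq_inv_mul, le_div_iff₀ hl]
  rcases (norm_nonneg y).eq_or_lt with h | h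
  · rw [← h]; simp
  · nlinarith

lemma resolv_eigenvector {T : E →L[ℝ] E} (hpos : ∀ x, 0 ≤ ⟪T x, x⟫_ℝ) {lam : ℝ} (hl : 0 < lam)
    {x : E} {μ : ℝ} (hμ : 0 ≤ μ) (hx : T x = μ • x) : resolv T lam x = (lam + μ)⁻¹ • x := by
  have h := resolv_add hpos hl ((lam + μ)⁻¹ • x)
  rwa [map_smul, hx, smul_comm lam, ← smul_add, ← add_smul, inv_smul_smul₀ (by positivity)] at h

/-- The second resolvent identity. It trades the empirical resolvent for the deterministic one on
the bias. -/
lemma resolv_sub_resolv {T T' : E →L[ℝ] E} (hpos : ∀ x, 0 ≤ ⟪T x, x⟫_ℝ)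
    (hpos' : ∀ x, 0 ≤ ⟪T' x, x⟫_ℝ) {lam : ℝ} (hl : 0 < lam) (x : E) :
    resolv T' lam x = resolv T lam x + resolv T' lam ((T - T') (resolv T lam x)) := by
  have h1 := resolv_add hpos' hl (resolv T lam x)
  have h2 := add_resolv hpos hl x
  have h3 : (T - T') (resolv T lam x) = x - (lam • resolv T lam x + T' (resolv T lam x)) := by
    rw [sub_apply, eq_sub_iff_add_eq]
    refine Eq.trans ?_ h2
    abel
  rw [h3, map_sub, h1]
  abel

lemma resolv_symm {T : E →L[ℝ] E} (hpos : ∀ x, 0 ≤ ⟪T x, x⟫_ℝ)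
    (hs : (T : E →ₗ[ℝ] E).IsSymmetric) {lam : ℝ} (hl : 0 < lam) (x y : E) :
    ⟪resolv T lam x, y⟫_ℝ = ⟪x, resolv T lam y⟫_ℝ := by
  have h := hs (resolv T lam x) (resolv T lam y)
  simp only [ContinuousLinearMap.coe_coe] at h
  nth_rw 1 [← add_resolv hpos hl y]
  nth_rw 2 [← add_resolv hpos hl x]
  rw [inner_add_left, inner_add_right, h, inner_smul_left, inner_smul_right]
  simp

/-- The value of the trace on an eigenbasis. -/
lemma posTrace_eq_tsum {A : E →L[ℝ] E} {ι : Type*} (b : HilbertBasis ι ℝ E) {ν : ι → ℝ}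
    (hν : ∀ k, 0 ≤ ν k) (hA : ∀ k, A (b k) = ν k • b k) (hs : (A : E →ₗ[ℝ] E).IsSymmetric) :
    posTrace A = ∑' k, ENNReal.ofReal (ν k) := by
  unfold posTrace
  set c := (exists_hilbertBasis ℝ E).choose_spec.choose
  have h1 : ∀ i, ENNReal.ofReal ⟪c i, A (c i)⟫_ℝ =
      ∑' k, ENNReal.ofReal (ν k) * ENNReal.ofReal (⟪b k, c i⟫_ℝ ^ 2) := fun i => by
    have h := b.hasSum_inner_mul_inner (c i) (A (c i))
    have e : ∀ k, ⟪c i, b k⟫_ℝ * ⟪b k, A (c i)⟫_ℝ = ν k * ⟪b k, c i⟫_ℝ ^ 2 := fun k => by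
      have := hs (b k) (c i)
      simp only [ContinuousLinearMap.coe_coe] at this
      rw [← this, hA, inner_smul_left, real_inner_comm (b k)]
      simp; ring
    simp_rw [e] at h
    rw [← h.tsum_eq, ENNReal.ofReal_tsum_of_nonneg
      (fun k => mul_nonneg (hν k) (sq_nonneg _)) h.summable]
    exact tsum_congr fun k => ENNReal.ofReal_mul (hν k)
  have h2 : ∀ k, ∑' i, ENNReal.ofReal (⟪b k, c i⟫_ℝ ^ 2) = 1 := fun k => by
    have h := hasSum_inner_sq c (b k)
    rw [← ENNReal.ofReal_tsum_of_nonneg (fun i => sq_nonneg _) h.summable, h.tsum_eq,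
      b.orthonormal.1 k]
    simp
  change ∑' i, ENNReal.ofReal ⟪c i, A (c i)⟫_ℝ = _
  simp_rw [h1]
  -- Tonelli in `ℝ≥0∞`, valid whether or not the trace is finite; Parseval in the basis `c` then
  -- gives every `b k` total weight 1.
  rw [ENNReal.tsum_comm]
  refine tsum_congr fun k => ?_
  rw [ENNReal.tsum_mul_left, h2, mul_one]

end Spectral

/-! ### The integral operators -/

section IntegralOperator

universe v

variable {X : Type*} {H : Type v} [MetricSpace X]
variable [NormedAddCommGroup H] [InnerProductSpace ℝ H] [CompleteSpace H] [RKHS ℝ H X ℝ]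
variable {K : X → X → ℝ} (hK : IsMercerKernel K) (hH : HasKernel H K)

/-- The operator `f ↦ f(x) K_x`. -/
noncomputable def pointOp (H : Type*) [NormedAddCommGroup H] [InnerProductSpace ℝ H]
    [CompleteSpace H] [RKHS ℝ H X ℝ] (x : X) : H →L[ℝ] H :=
  ContinuousLinearMap.smulRightL ℝ H H (innerSL ℝ (kerSection H x)) (kerSection H x)

lemma pointOp_apply (x : X) (f : H) : pointOp H x f = f x • kerSection H x := by
  simp [pointOp, inner_kerSection]

include hK hH in
lemma continuous_pointOp : Continuous (pointOp H : X → H →L[ℝ] H) := by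
  have h := continuous_kerSection hK hH
  unfold pointOp
  fun_prop

/-- The operator has rank at most one, as it factors through `ℝ`. -/
lemma isCompactOperator_pointOp {X : Type*} [RKHS ℝ H X ℝ] (x : X) :
    IsCompactOperator (pointOp H x) := by
  have h1 : IsCompactOperator (innerSL ℝ (kerSection H x)) :=
    isCompactOperator_of_locallyCompactSpace_dom (σ₁₂ := RingHom.id ℝ)
      (innerSL ℝ (kerSection H x))
  have h2 := h1.clm_comp (ContinuousLinearMap.toSpanSingleton ℝ (kerSection H x))
  refine cast (congrArg IsCompactOperator (funext fun f => ?_)) h2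
  simp [pointOp]

variable [CompactSpace X]

-- The kernel sections are a continuous image of a compact metric space, and a function orthogonal
-- to all of them vanishes at every point, so their span is dense.
include hK hH in
lemma separableSpace_rkhs : TopologicalSpace.SeparableSpace H := by
  have h1 : (Submodule.span ℝ (Set.range (kerSection H : X → H))).topologicalClosure = ⊤ := by
    rw [Submodule.topologicalClosure_eq_top_iff, eq_bot_iff]
    intro f hf
    rw [Submodule.mem_bot]
    refine RKHS.ext fun x => ?_
    rw [← inner_kerSection]
    simpa using (Submodule.mem_orthogonal _ _).1 hf _ (Submodule.subset_span ⟨x, rfl⟩)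
  have h2 : TopologicalSpace.IsSeparable (Set.range (kerSection H : X → H)) :=
    TopologicalSpace.isSeparable_range (continuous_kerSection hK hH)
  have h3 := (h2.span (R := ℝ)).closure
  have h4 : closure (Submodule.span ℝ (Set.range (kerSection H : X → H)) : Set H) = Set.univ := by
    rw [← Submodule.topologicalClosure_coe, h1]; rfl
  rw [h4] at h3
  exact TopologicalSpace.isSeparable_univ_iff.1 h3

variable [MeasurableSpace X] [BorelSpace X] (μ : Measure X) [IsProbabilityMeasure μ]

lemma coeFn_inclL2 (f : H) : (inclL2 μ hK hH f : X → ℝ) =ᵐ[μ] f :=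
  (memLp_coe μ hK hH f).coeFn_toLp

lemma integralOp_apply (g : Lp ℝ 2 μ) :
    integralOp μ hK hH g = ∫ x, g x • kerSection H x ∂μ := rfl

/-- The integral operator is the adjoint of the inclusion `S` into `L²`; hence `L_K` is `S* S` on
`H` and `S S*` on `L²`. -/
lemma inner_integralOp (g : Lp ℝ 2 μ) (f : H) :
    ⟪integralOp μ hK hH g, f⟫_ℝ = ⟪g, inclL2 μ hK hH f⟫_ℝ := by
  rw [integralOp_apply, real_inner_comm, ← integral_inner (integrable_smul_section μ hK hH g),
    L2.inner_def]
  refine integral_congr_ae ?_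
  filter_upwards [coeFn_inclL2 hK hH μ f] with x hx
  rw [hx, inner_smul_right, real_inner_comm, inner_kerSection]
  simp [mul_comm]

lemma LK_H_apply (f : H) : LK_H μ hK hH f = integralOp μ hK hH (inclL2 μ hK hH f) := rfl

lemma inner_LK_H (f g : H) :
    ⟪LK_H μ hK hH f, g⟫_ℝ = ⟪inclL2 μ hK hH f, inclL2 μ hK hH g⟫_ℝ := by
  rw [LK_H_apply, inner_integralOp]

lemma inner_LK_H_eq_integral (f g : H) : ⟪LK_H μ hK hH f, g⟫_ℝ = ∫ x, f x * g x ∂μ := by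
  rw [inner_LK_H, L2.inner_def]
  refine integral_congr_ae ?_
  filter_upwards [coeFn_inclL2 hK hH μ f, coeFn_inclL2 hK hH μ g] with x hx hy
  rw [hx, hy]
  simp [mul_comm]

lemma LK_H_nonneg (f : H) : 0 ≤ ⟪LK_H μ hK hH f, f⟫_ℝ := by
  rw [inner_LK_H]; exact real_inner_self_nonneg

lemma LK_H_isSymmetric : (LK_H μ hK hH : H →ₗ[ℝ] H).IsSymmetric := fun f g => by
  simp only [ContinuousLinearMap.coe_coe]
  rw [inner_LK_H, real_inner_comm, ← inner_LK_H, real_inner_comm]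

/-- `L_K` is the Bochner integral of the operators `pointOp H x`, and the compact operators form a
closed convex set. -/
lemma isCompactOperator_LK_H : IsCompactOperator (LK_H μ hK hH) := by
  have hint : Integrable (fun x => pointOp H x) μ :=
    (continuous_pointOp hK hH).integrable_of_hasCompactSupport
      (HasCompactSupport.of_compactSpace _)
  have h1 : LK_H μ hK hH = ∫ x, pointOp H x ∂μ := by
    ext1 f
    rw [ContinuousLinearMap.integral_apply hint, LK_H_apply, integralOp_apply]
    refine integral_congr_ae ?_
    filter_upwards [coeFn_inclL2 hK hH μ f] with x hx
    rw [hx, pointOp_apply]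
  rw [h1]
  refine Convex.integral_mem (s := {f : H →L[ℝ] H | IsCompactOperator f}) ?_
    isClosed_setOfPred_isCompactOperator (Eventually.of_forall isCompactOperator_pointOp) hint
  intro f hf g hg a b _ _ _
  exact (IsCompactOperator.smul hf a).add (IsCompactOperator.smul hg b)

/-- An orthonormal basis of eigenvectors of the integral operator. -/
lemma exists_eigenbasis_LK_H : ∃ (ι : Type v) (_ : Countable ι) (b : HilbertBasis ι ℝ H)
    (τ : ι → ℝ), (∀ k, 0 ≤ τ k) ∧ ∀ k, LK_H μ hK hH (b k) = τ k • b k := by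
  obtain ⟨ι, b, τ, h⟩ := exists_hilbertBasis_eigenvectors (isCompactOperator_LK_H hK hH μ)
    (LK_H_isSymmetric hK hH μ)
  have := separableSpace_rkhs hK hH
  refine ⟨ι, countable_of_hilbertBasis b, b, τ, fun k => ?_, h⟩
  have h1 := LK_H_nonneg hK hH μ (b k)
  rw [h, inner_smul_left, real_inner_self_eq_norm_sq, b.orthonormal.1 k] at h1
  simpa using h1

/-- An eigenbasis of `L_K` also diagonalizes `(lam + L_K)⁻¹ L_K`, which is symmetric because the
resolvent commutes with `L_K`. -/
lemma effectiveDim_eq_tsum {ι : Type*} {b : HilbertBasis ι ℝ H} {τ : ι → ℝ} (hτ : ∀ k, 0 ≤ τ k)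
    (hb : ∀ k, LK_H μ hK hH (b k) = τ k • b k) {lam : ℝ} (hl : 0 < lam) :
    effectiveDim μ hK hH lam = ∑' k, ENNReal.ofReal (τ k / (lam + τ k)) := by
  have hpos := LK_H_nonneg hK hH μ
  have hs := LK_H_isSymmetric hK hH μ
  refine posTrace_eq_tsum b (fun k => div_nonneg (hτ k) (by have := hτ k; positivity))
    (fun k => ?_) ?_
  · change resolv (LK_H μ hK hH) lam (LK_H μ hK hH (b k)) = _
    rw [hb, map_smul, resolv_eigenvector hpos hl (hτ k) (hb k), smul_smul, div_eq_mul_inv]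
  · have comm : ∀ f, resolv (LK_H μ hK hH) lam (LK_H μ hK hH f) =
        LK_H μ hK hH (resolv (LK_H μ hK hH) lam f) := fun f => by
      nth_rw 1 [← add_resolv hpos hl f]
      rw [map_add, map_smul, resolv_add hpos hl]
    intro f g
    change ⟪resolv (LK_H μ hK hH) lam (LK_H μ hK hH f), g⟫_ℝ =
      ⟪f, resolv (LK_H μ hK hH) lam (LK_H μ hK hH g)⟫_ℝ
    rw [resolv_symm hpos hs hl, comm]
    exact hs _ _

end IntegralOperator

/-! ### The source condition -/

section Source

variable {E : Type*} [NormedAddCommGroup E] [InnerProductSpace ℝ E]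

lemma inner_sum_smul_of_orthogonal {ι : Type*} {v : ι → E}
    (hv : ∀ i j, i ≠ j → ⟪v i, v j⟫_ℝ = 0) (F : Finset ι) (a b : ι → ℝ) :
    ⟪∑ i ∈ F, a i • v i, ∑ i ∈ F, b i • v i⟫_ℝ = ∑ i ∈ F, a i * b i * ‖v i‖ ^ 2 := by
  rw [sum_inner]
  refine Finset.sum_congr rfl fun i hi => ?_
  rw [inner_sum, Finset.sum_eq_single i]
  · rw [inner_smul_left, inner_smul_right, real_inner_self_eq_norm_sq]; simp; ring
  · intro j _ hj
    rw [inner_smul_left, inner_smul_right, hv i j hj.symm]; simp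
  · exact fun h => absurd hi h

/-- The component of `x` in the eigenspace of `T` for `μ`. -/
noncomputable def eigenProj [CompleteSpace E] (T : E →L[ℝ] E) (μ : ℝ) (x : E) : E :=
  (LinearMap.ker ((T - μ • (1 : E →L[ℝ] E) : E →L[ℝ] E) : E →ₗ[ℝ] E)).starProjection x

variable [CompleteSpace E]

lemma apply_eigenProj (T : E →L[ℝ] E) (μ : ℝ) (x : E) :
    T (eigenProj T μ x) = μ • eigenProj T μ x := by
  have h : eigenProj T μ x ∈
      LinearMap.ker ((T - μ • (1 : E →L[ℝ] E) : E →L[ℝ] E) : E →ₗ[ℝ] E) :=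
    Submodule.starProjection_apply_mem _ _
  rw [LinearMap.mem_ker] at h
  simpa [sub_eq_zero] using h

lemma inner_eigenProj_self (T : E →L[ℝ] E) (μ : ℝ) (x : E) :
    ⟪eigenProj T μ x, x⟫_ℝ = ‖eigenProj T μ x‖ ^ 2 := by
  rw [← real_inner_self_eq_norm_sq]
  unfold eigenProj
  rw [← Submodule.inner_starProjection_left_eq_right, Submodule.starProjection_eq_self_iff.2
    (Submodule.starProjection_apply_mem _ _)]

lemma inner_eigenProj_eigenProj {T : E →L[ℝ] E} (hs : (T : E →ₗ[ℝ] E).IsSymmetric) (x : E) {μ ν : ℝ}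
    (h : μ ≠ ν) : ⟪eigenProj T μ x, eigenProj T ν x⟫_ℝ = 0 := by
  have h1 := hs (eigenProj T μ x) (eigenProj T ν x)
  simp only [ContinuousLinearMap.coe_coe] at h1
  rw [apply_eigenProj, apply_eigenProj, inner_smul_left, inner_smul_right] at h1
  have h2 : (μ - ν) * ⟪eigenProj T μ x, eigenProj T ν x⟫_ℝ = 0 := by
    simp only [conj_trivial] at h1; linear_combination h1
  exact (mul_eq_zero.1 h2).resolve_left (sub_ne_zero.2 h)

/-- Bessel's inequality: the sum `y` of the components satisfies `‖y‖² = ⟪y, x⟫ ≤ ‖y‖ ‖x‖`. -/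
lemma sum_norm_eigenProj_sq_le {T : E →L[ℝ] E} (hs : (T : E →ₗ[ℝ] E).IsSymmetric) (x : E)
    (F : Finset ℝ) : ∑ μ ∈ F, ‖eigenProj T μ x‖ ^ 2 ≤ ‖x‖ ^ 2 := by
  have h1 := inner_sum_smul_of_orthogonal (v := fun μ => eigenProj T μ x)
    (fun _ _ h => inner_eigenProj_eigenProj hs x h) F 1 1
  simp only [Pi.one_apply, one_smul, one_mul, real_inner_self_eq_norm_sq] at h1
  have h2 : ⟪∑ μ ∈ F, eigenProj T μ x, x⟫_ℝ = ∑ μ ∈ F, ‖eigenProj T μ x‖ ^ 2 := by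
    rw [sum_inner]; exact Finset.sum_congr rfl fun μ _ => inner_eigenProj_self T μ x
  have h3 := real_inner_le_norm (∑ μ ∈ F, eigenProj T μ x) x
  rw [h2, ← h1] at h3
  rw [← h1]
  set a := ‖∑ μ ∈ F, eigenProj T μ x‖
  have ha : 0 ≤ a := norm_nonneg _
  have hx := norm_nonneg x
  nlinarith

/-- Equivalently `lam ^ p * μ ^ a / (lam + μ) ^ p ≤ lam ^ a`, the scalar estimate behind the decay
of the regularization error. -/
lemma rpow_interp_le {a lam μ : ℝ} (ha0 : 0 ≤ a) (hl : 0 < lam) (hμ : 0 < μ) (p : ℝ) (hp : a ≤ p) :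
    lam ^ (p - a) * μ ^ a ≤ (lam + μ) ^ p := by
  calc lam ^ (p - a) * μ ^ a ≤ (lam + μ) ^ (p - a) * (lam + μ) ^ a := by
        gcongr <;> linarith
    _ = (lam + μ) ^ p := by rw [← Real.rpow_add (by positivity)]; ring_nf

variable {X H : Type*} [MetricSpace X] [CompactSpace X] [MeasurableSpace X] [BorelSpace X]
variable [NormedAddCommGroup H] [InnerProductSpace ℝ H] [CompleteSpace H] [RKHS ℝ H X ℝ]
variable {K : X → X → ℝ} (hK : IsMercerKernel K) (hH : HasKernel H K)
variable (μ : Measure X) [IsProbabilityMeasure μ]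

/-- Under the source condition there is a version of the function in the reproducing kernel Hilbert
space, of minimal norm, whose regularization error decays polynomially. -/
lemma exists_source_version {r : ℝ} (hr1 : 1 / 2 ≤ r) (hr2 : r ≤ 1) (h : Lp ℝ 2 μ) :
    ∃ f : H, inclL2 μ hK hH f = opPow (LK_L2 (H := H) μ hK hH) r h ∧
      (∀ g : H, inclL2 μ hK hH g = inclL2 μ hK hH f → ‖f‖ ≤ ‖g‖) ∧
      ∀ lam : ℝ, 0 < lam →
        (lam * ‖resolv (LK_H μ hK hH) lam f‖) ^ 2 ≤ lam ^ (2 * r - 1) * ‖h‖ ^ 2 ∧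
        lam ^ 2 * ⟪resolv (LK_H μ hK hH) lam f, f⟫_ℝ ≤ lam ^ (2 * r) * ‖h‖ ^ 2 := by
  set S := inclL2 μ hK hH with hS
  set S' : Lp ℝ 2 μ →L[ℝ] H := integralOp μ hK hH with hS'
  set T := LK_H μ hK hH with hT
  set L := LK_L2 (H := H) μ hK hH with hL
  have adj : ∀ g f, ⟪S' g, f⟫_ℝ = ⟪g, S f⟫_ℝ := inner_integralOp hK hH μ
  have hLs : (L : Lp ℝ 2 μ →ₗ[ℝ] Lp ℝ 2 μ).IsSymmetric := fun f g => by
    change ⟪S (S' f), g⟫_ℝ = ⟪f, S (S' g)⟫_ℝ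
    rw [← adj, real_inner_comm, ← adj, real_inner_comm]
  set G : ℝ → Lp ℝ 2 μ := fun ν => eigenProj L ν h with hG
  have hSG : ∀ ν, S (S' (G ν)) = ν • G ν := fun ν => apply_eigenProj L ν h
  have inn : ∀ ν κ, ⟪S' (G ν), S' (G κ)⟫_ℝ = κ * ⟪G ν, G κ⟫_ℝ := fun ν κ => by
    rw [adj, hSG, inner_smul_right]
  have nsq : ∀ ν, ‖S' (G ν)‖ ^ 2 = ν * ‖G ν‖ ^ 2 := fun ν => by
    rw [← real_inner_self_eq_norm_sq, inn, real_inner_self_eq_norm_sq]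
  have zero_or : ∀ ν, S' (G ν) = 0 ∨ 0 < ν := fun ν => by
    rcases le_or_gt ν 0 with h0 | h0
    · left
      have h1 := nsq ν
      have h2 : ‖S' (G ν)‖ ^ 2 ≤ 0 := by
        rw [h1]; exact mul_nonpos_of_nonpos_of_nonneg h0 (sq_nonneg _)
      exact norm_eq_zero.1 (pow_eq_zero_iff two_ne_zero |>.1 (le_antisymm h2 (sq_nonneg _)))
    · exact Or.inr h0
  -- The candidate is `f = ∑ ν ^ (r - 1) • S' (P_ν h)`: applying `S` produces a factor `ν` and so
  -- restores `ν ^ r`. The eigenvalue 0 causes no trouble, as `S'` kills its eigenspace.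
  set v : ℝ → H := fun ν => ν ^ (r - 1) • S' (G ν) with hv
  have vT : ∀ ν, T (v ν) = ν • v ν := fun ν => by
    change S' (S (ν ^ (r - 1) • S' (G ν))) = _
    rw [map_smul, map_smul, hSG, map_smul, smul_comm]
  have vS : ∀ ν, S (v ν) = ν ^ r • G ν := fun ν => by
    simp only [hv, map_smul, hSG, smul_smul]
    rcases zero_or ν with h0 | h0
    · have h1 : ν • G ν = 0 := by rw [← hSG, h0, map_zero]
      rcases smul_eq_zero.1 h1 with h2 | h2
      · simp [h2, Real.zero_rpow (by linarith : r ≠ 0)]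
      · simp [h2]
    · nth_rw 2 [← Real.rpow_one ν]
      rw [← Real.rpow_add h0, sub_add_cancel]
  have vorth : ∀ ν κ, ν ≠ κ → ⟪v ν, v κ⟫_ℝ = 0 := fun ν κ hne => by
    have e : ⟪G ν, G κ⟫_ℝ = 0 := inner_eigenProj_eigenProj hLs h hne
    simp only [hv, inner_smul_left, inner_smul_right]
    rw [inn, e]
    simp
  have vnsq : ∀ ν, v ν = 0 ∨ (0 < ν ∧ ‖v ν‖ ^ 2 = ν ^ (2 * r - 1) * ‖G ν‖ ^ 2) := fun ν => by
    rcases zero_or ν with h0 | h0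
    · exact Or.inl (by simp [hv, h0])
    · refine Or.inr ⟨h0, ?_⟩
      simp only [hv]
      rw [norm_smul, mul_pow, nsq, Real.norm_eq_abs, sq_abs, ← mul_assoc, ← Real.rpow_natCast,
        ← Real.rpow_mul h0.le]
      nth_rw 2 [← Real.rpow_one ν]
      rw [← Real.rpow_add h0]
      congr 2
      push_cast; ring
  have bessel := fun F => sum_norm_eigenProj_sq_le hLs h F
  -- As `‖v ν‖²` carries the factor `ν ^ (2 r - 1)`, Bessel's inequality reduces every spectral sum
  -- below to a bound on a scalar function of `ν`.
  have hsum_le : ∀ (F : Finset ℝ) (c : ℝ → ℝ) (C : ℝ), 0 ≤ C →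
      (∀ ν, 0 < ν → c ν * ν ^ (2 * r - 1) ≤ C ∨ G ν = 0) →
      ∑ ν ∈ F, c ν * ‖v ν‖ ^ 2 ≤ C * ‖h‖ ^ 2 := by
    intro F c C hC hc
    refine le_trans ?_ (mul_le_mul_of_nonneg_left (bessel F) hC)
    rw [Finset.mul_sum]
    refine Finset.sum_le_sum fun ν _ => ?_
    rcases vnsq ν with h0 | ⟨h0, h1⟩
    · rw [h0]; simp; positivity
    · rcases hc ν h0 with h2 | h2
      · rw [h1, ← mul_assoc]; gcongr
      · rw [h1]; simp [h2]; positivity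
  have hsummable : Summable v := by
    have hfam := (LK_H_isSymmetric hK hH μ).orthogonalFamily_eigenspaces
    let w : ∀ ν : ℝ, Module.End.eigenspace (T : H →ₗ[ℝ] H) ν := fun ν =>
      ⟨v ν, Module.End.mem_eigenspace_iff.2 (vT ν)⟩
    refine (hfam.summable_iff_norm_sq_summable w).2 ?_
    refine summable_of_sum_le (c := (1 + ‖L‖) * ‖h‖ ^ 2) (fun ν => sq_nonneg _) fun F => ?_
    have := hsum_le F (fun _ => 1) (1 + ‖L‖) (by positivity) fun ν hν => by
      by_cases hGν : G ν = 0
      · exact Or.inr hGν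
      · left
        have h1 : ν ≤ ‖L‖ := by
          have h2 := L.le_opNorm (G ν)
          have h3 : L (G ν) = ν • G ν := hSG ν
          rw [h3, norm_smul, Real.norm_eq_abs, abs_of_pos hν] at h2
          exact le_of_mul_le_mul_right h2 (norm_pos_iff.2 hGν)
        -- With `0 ≤ 2 r - 1 ≤ 1`, the power `ν ^ (2 r - 1)` is at most `1 + ν`.
        have h2 := rpow_interp_le (a := 2 * r - 1) (by linarith) one_pos hν 1 (by linarith)
        rw [Real.one_rpow, Real.rpow_one] at h2
        linarith
    simpa [w] using this
  obtain ⟨f, hf⟩ := hsummable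
  have hSf : HasSum (fun ν => ν ^ r • G ν) (S f) := by
    have := hf.mapL S
    simp_rw [vS] at this
    exact this
  refine ⟨f, hSf.tsum_eq.symm, fun g hg => ?_, fun lam hl => ?_⟩
  -- `g - f` is in the kernel of `S`, hence orthogonal to the range of `S'` and to its limit `f`;
  -- Pythagoras concludes.
  · have h1 : HasSum (fun ν => ⟪g - f, v ν⟫_ℝ) ⟪g - f, f⟫_ℝ := hf.mapL (innerSL ℝ (g - f))
    have h2 : ∀ ν, ⟪g - f, v ν⟫_ℝ = 0 := fun ν => by
      simp only [hv]
      rw [inner_smul_right, real_inner_comm, adj, map_sub, hg, sub_self, inner_zero_right, mul_zero]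
    simp_rw [h2] at h1
    have h3 := h1.unique hasSum_zero
    have h4 := norm_add_sq_real (g - f) f
    rw [sub_add_cancel, h3] at h4
    exact abs_le_of_sq_le_sq' (by nlinarith [sq_nonneg ‖g - f‖]) (norm_nonneg _) |>.2
  · have hpos := LK_H_nonneg hK hH μ
    have hR : ∀ ν, resolv T lam (v ν) = (lam + ν)⁻¹ • v ν := fun ν => by
      rcases vnsq ν with h0 | ⟨h0, -⟩
      · simp [h0]
      · exact resolv_eigenvector hpos hl h0.le (vT ν)
    have hRF : ∀ F : Finset ℝ, resolv T lam (∑ ν ∈ F, v ν) = ∑ ν ∈ F, (lam + ν)⁻¹ • v ν :=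
      fun F => by rw [map_sum]; exact Finset.sum_congr rfl fun ν _ => hR ν
    -- The estimates are proved for partial sums, on which the resolvent acts diagonally, and pass
    -- to the limit.
    have lim : Tendsto (fun F : Finset ℝ => ∑ ν ∈ F, v ν) atTop (𝓝 f) := hf
    constructor
    · refine le_of_tendsto' (((((resolv T lam).continuous.tendsto f).comp lim).norm.const_mul
        lam).pow 2) fun F => ?_
      simp only [Function.comp_apply]
      rw [hRF, mul_pow, ← real_inner_self_eq_norm_sq, inner_sum_smul_of_orthogonal vorth,
        Finset.mul_sum]
      simp_rw [← mul_assoc]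
      refine hsum_le F (fun ν => lam ^ 2 * (lam + ν)⁻¹ * (lam + ν)⁻¹) _ (by positivity)
        fun ν hν => Or.inl ?_
      have h1 := rpow_interp_le (a := 2 * r - 1) (by linarith) hl hν 2 (by linarith)
      have h2 : lam ^ 2 = lam ^ (2 * r - 1) * lam ^ (2 - (2 * r - 1)) := by
        rw [← Real.rpow_add hl, ← Real.rpow_natCast]; congr 1; push_cast; ring
      have h3 : 0 < lam + ν := by positivity
      rw [h2]
      rw [Real.rpow_two] at h1
      calc lam ^ (2 * r - 1) * lam ^ (2 - (2 * r - 1)) * (lam + ν)⁻¹ * (lam + ν)⁻¹ * ν ^ (2 * r - 1)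
          = lam ^ (2 * r - 1) * ((lam ^ (2 - (2 * r - 1)) * ν ^ (2 * r - 1)) / (lam + ν) ^ 2) := by
            field_simp
        _ ≤ lam ^ (2 * r - 1) * 1 := by
            gcongr
            exact div_le_one_of_le₀ h1 (by positivity)
        _ = _ := mul_one _
    · have hc : Continuous fun g : H => lam ^ 2 * ⟪resolv T lam g, g⟫_ℝ := by fun_prop
      refine le_of_tendsto' ((hc.tendsto f).comp lim) fun F => ?_
      simp only [Function.comp_apply]
      have h0 := inner_sum_smul_of_orthogonal vorth F (fun ν => (lam + ν)⁻¹) 1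
      simp only [Pi.one_apply, one_smul, mul_one] at h0
      rw [hRF, h0, Finset.mul_sum]
      simp_rw [← mul_assoc]
      refine hsum_le F (fun ν => lam ^ 2 * (lam + ν)⁻¹) _ (by positivity) fun ν hν => Or.inl ?_
      have h1 := rpow_interp_le (a := 2 * r - 1) (by linarith) hl hν 1 (by linarith)
      have h2 : lam ^ 2 = lam ^ (2 * r) * lam ^ (1 - (2 * r - 1)) := by
        rw [← Real.rpow_add hl, ← Real.rpow_natCast]; congr 1; push_cast; ring
      have h3 : 0 < lam + ν := by positivity
      rw [h2]
      rw [Real.rpow_one] at h1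
      calc lam ^ (2 * r) * lam ^ (1 - (2 * r - 1)) * (lam + ν)⁻¹ * ν ^ (2 * r - 1)
          = lam ^ (2 * r) * ((lam ^ (1 - (2 * r - 1)) * ν ^ (2 * r - 1)) / (lam + ν)) := by
            field_simp
        _ ≤ lam ^ (2 * r) * 1 := by
            gcongr
            exact div_le_one_of_le₀ h1 (by positivity)
        _ = _ := mul_one _

end Source

/-! ### Kernel ridge regression -/

section Ridge

variable {X H : Type*} [MetricSpace X] [NormedAddCommGroup H] [InnerProductSpace ℝ H]
  [CompleteSpace H]
variable [RKHS ℝ H X ℝ]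

/-- The empirical covariance operator of the data `d`. -/
noncomputable def empOp (H : Type*) [NormedAddCommGroup H] [InnerProductSpace ℝ H]
    [CompleteSpace H] [RKHS ℝ H X ℝ] {n : ℕ} (d : Fin n → X × ℝ) : H →L[ℝ] H :=
  (1 / (n : ℝ)) • ∑ i, pointOp H (d i).1

/-- The empirical mean of `y K_x` over the data `d`. -/
noncomputable def empVec (H : Type*) [NormedAddCommGroup H] [InnerProductSpace ℝ H]
    [CompleteSpace H] [RKHS ℝ H X ℝ] {n : ℕ} (d : Fin n → X × ℝ) : H :=
  (1 / (n : ℝ)) • ∑ i, (d i).2 • kerSection H (d i).1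

/-- The empirical mean of `(y - f(x)) K_x` over the data `d`. -/
noncomputable def noiseVec (f : H) {n : ℕ} (d : Fin n → X × ℝ) : H := empVec H d - empOp H d f

lemma inner_empVec {n : ℕ} (d : Fin n → X × ℝ) (g : H) :
    ⟪empVec H d, g⟫_ℝ = (1 / (n : ℝ)) * ∑ i, (d i).2 * g (d i).1 := by
  simp [empVec, inner_smul_left, sum_inner, inner_kerSection]

lemma inner_empOp {n : ℕ} (d : Fin n → X × ℝ) (f g : H) :
    ⟪empOp H d f, g⟫_ℝ = (1 / (n : ℝ)) * ∑ i, f (d i).1 * g (d i).1 := by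
  simp [empOp, inner_smul_left, sum_inner, inner_kerSection, pointOp_apply]

lemma inner_noiseVec {n : ℕ} (d : Fin n → X × ℝ) (f g : H) :
    ⟪noiseVec f d, g⟫_ℝ = (1 / (n : ℝ)) * ∑ i, ((d i).2 - f (d i).1) * g (d i).1 := by
  rw [noiseVec, inner_sub_left, inner_empVec, inner_empOp, ← mul_sub, ← Finset.sum_sub_distrib]
  simp_rw [sub_mul]

lemma empOp_nonneg {n : ℕ} (d : Fin n → X × ℝ) (f : H) : 0 ≤ ⟪empOp H d f, f⟫_ℝ := by
  rw [inner_empOp]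
  exact mul_nonneg (by positivity) (Finset.sum_nonneg fun i _ => mul_self_nonneg _)

lemma empOp_symm {n : ℕ} (d : Fin n → X × ℝ) (f g : H) :
    ⟪empOp H d f, g⟫_ℝ = ⟪f, empOp H d g⟫_ℝ := by
  rw [real_inner_comm (empOp H d g), inner_empOp, inner_empOp]
  simp_rw [mul_comm (f _)]

lemma krrObjective_eq {lam : ℝ} {n : ℕ} (d : Fin n → X × ℝ) (f : H) :
    krrObjective lam d f = ⟪lam • f + empOp H d f, f⟫_ℝ - 2 * ⟪empVec H d, f⟫_ℝ +
      (1 / (n : ℝ)) * ∑ i, (d i).2 ^ 2 := by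
  rw [inner_add_left, inner_smul_left, real_inner_self_eq_norm_sq, inner_empOp, inner_empVec,
    krrObjective]
  have : ∑ i, (f (d i).1 - (d i).2) ^ 2 = ∑ i, f (d i).1 * f (d i).1 -
      2 * ∑ i, (d i).2 * f (d i).1 + ∑ i, (d i).2 ^ 2 := by
    rw [Finset.mul_sum, ← Finset.sum_sub_distrib, ← Finset.sum_add_distrib]
    exact Finset.sum_congr rfl fun i _ => by ring
  rw [this]
  simp
  ring

/-- The kernel ridge regression estimator solves the regularized normal equation. -/
lemma krr_eq {lam : ℝ} (hl : 0 < lam) {n : ℕ} (d : Fin n → X × ℝ) :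
    krr H lam d = resolv (empOp H d) lam (empVec H d) := by
  set f := resolv (empOp H d) lam (empVec H d) with hf
  have hpos := empOp_nonneg (H := H) d
  have h1 : lam • f + empOp H d f = empVec H d := add_resolv hpos hl _
  -- Completing the square. The quadratic part is coercive, so the minimizer is unique and
  -- `Classical.epsilon` can only choose `f`.
  have key : ∀ g : H, krrObjective lam d g = krrObjective lam d f +
      ⟪lam • (g - f) + empOp H d (g - f), g - f⟫_ℝ := fun g => by
    rw [krrObjective_eq, krrObjective_eq, ← h1]
    have h2 := empOp_symm d f g
    have h3 := real_inner_comm f g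
    have h4 := real_inner_comm f (empOp H d g)
    simp only [map_sub, smul_sub, inner_add_left, inner_sub_left, inner_sub_right, inner_smul_left,
      conj_trivial]
    rw [h2, h3, ← h4]
    ring
  have hnn : ∀ g : H, lam * ‖g‖ ^ 2 ≤ ⟪lam • g + empOp H d g, g⟫_ℝ := fun g => by
    rw [inner_add_left, inner_smul_left, real_inner_self_eq_norm_sq]
    simpa using hpos g
  have hmin : ∀ g : H, krrObjective lam d f ≤ krrObjective lam d g := fun g => by
    rw [key g]
    exact le_add_of_nonneg_right (le_trans (by positivity) (hnn _))
  have hspec : ∀ g : H, krrObjective lam d (krr H lam d) ≤ krrObjective lam d g :=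
    Classical.epsilon_spec (p := fun f : H => ∀ g : H, krrObjective lam d f ≤ krrObjective lam d g)
      ⟨f, hmin⟩
  have h5 := hspec f
  rw [key] at h5
  have h6 := hnn (krr H lam d - f)
  have h7 : ‖krr H lam d - f‖ ^ 2 ≤ 0 := by
    by_contra hc
    have : 0 < lam * ‖krr H lam d - f‖ ^ 2 := mul_pos hl (not_le.1 hc)
    linarith
  exact sub_eq_zero.1 (norm_eq_zero.1 (pow_eq_zero_iff two_ne_zero |>.1
    (le_antisymm h7 (sq_nonneg _))))

lemma krr_sub_eq {lam : ℝ} (hl : 0 < lam) {n : ℕ} (d : Fin n → X × ℝ) (f : H) :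
    krr H lam d - f = resolv (empOp H d) lam (noiseVec f d) - resolv (empOp H d) lam (lam • f) := by
  have h := resolv_add (empOp_nonneg (H := H) d) hl f
  rw [krr_eq hl, ← map_sub, noiseVec, sub_sub, map_sub, add_comm (empOp H d f), h]

variable {T : H →L[ℝ] H} (hpos : ∀ f, 0 ≤ ⟪T f, f⟫_ℝ)

-- The empirical resolvent costs a factor `lam⁻¹`. On the bias it is first replaced by the resolvent
-- of `T`, so that only the operator deviation pays this factor there.
include hpos in
lemma norm_krr_sub_le {lam : ℝ} (hl : 0 < lam) {n : ℕ} (d : Fin n → X × ℝ) (f : H) :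
    ‖krr H lam d - f‖ ≤ lam⁻¹ * ‖noiseVec f d‖ + ‖resolv T lam (lam • f)‖ +
      lam⁻¹ * ‖(T - empOp H d) (resolv T lam (lam • f))‖ := by
  have hd := empOp_nonneg (H := H) d
  rw [krr_sub_eq hl, resolv_sub_resolv hpos hd hl (lam • f), add_assoc]
  refine (norm_sub_le _ _).trans (add_le_add (norm_resolv_le hd hl _) ?_)
  exact (norm_add_le _ _).trans (add_le_add le_rfl (norm_resolv_le hd hl _))

-- The unknown error reappears on the right, but multiplied by the small `T - empOp H d`. The other
-- terms are affine in the noise, so they average exactly over the local samples.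
include hpos in
lemma krr_sub_eq_resolv {lam : ℝ} (hl : 0 < lam) {n : ℕ} (d : Fin n → X × ℝ) (f : H) :
    krr H lam d - f = resolv T lam (noiseVec f d) - resolv T lam (lam • f) +
      resolv T lam ((T - empOp H d) (krr H lam d - f)) := by
  have hd := empOp_nonneg (H := H) d
  set g := krr H lam d - f with hg
  have h1 : lam • g + empOp H d g = noiseVec f d - lam • f := by
    rw [hg, krr_sub_eq hl, ← map_sub, add_resolv hd hl]
  nth_rw 1 [← resolv_add hpos hl g]
  rw [← map_sub, ← h1, ← map_add]
  congr 1
  rw [sub_apply]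
  abel

/-- The weight of a local sample cancels its normalization `1 / n j`, so the noises average to that
of the pooled sample, in any arrangement. -/
lemma sum_smul_noiseVec {m : ℕ} {n : Fin m → ℕ} (hn : ∀ j, 0 < n j)
    (d : (j : Fin m) → Fin (n j) → X × ℝ) (e : Fin (∑ j, n j) ≃ (j : Fin m) × Fin (n j)) (f : H) :
    ∑ j, ((n j : ℝ) / ((∑ k, n k : ℕ) : ℝ)) • noiseVec f (d j) =
      noiseVec f fun t => d (e t).1 (e t).2 := by
  refine ext_inner_right ℝ fun g => ?_
  rw [sum_inner, inner_noiseVec,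
    e.sum_comp fun a => ((d a.1 a.2).2 - f (d a.1 a.2).1) * g (d a.1 a.2).1,
      Finset.univ_sigma_univ.symm,
    Finset.sum_sigma, Finset.mul_sum]
  refine Finset.sum_congr rfl fun j _ => ?_
  have : (n j : ℝ) ≠ 0 := by exact_mod_cast (hn j).ne'
  rw [inner_smul_left, inner_noiseVec]
  simp only [conj_trivial]
  field_simp

include hpos in
/-- The error of the distributed estimator in terms of the deviations of the local samples. -/
lemma seminorm_dkrr_sub_le (p : Seminorm ℝ H) {lam : ℝ} (hl : 0 < lam) {m : ℕ} (hm : 0 < m)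
    {n : Fin m → ℕ} (hn : ∀ j, 0 < n j) (d : (j : Fin m) → Fin (n j) → X × ℝ)
    (e : Fin (∑ j, n j) ≃ (j : Fin m) × Fin (n j)) (f : H) :
    p (dkrr H lam d - f) ≤ p (resolv T lam (noiseVec f fun t => d (e t).1 (e t).2)) +
      p (resolv T lam (lam • f)) + ∑ j, ((n j : ℝ) / ((∑ k, n k : ℕ) : ℝ)) *
        p (resolv T lam ((T - empOp H (d j)) (krr H lam (d j) - f))) := by
  have hN : ((∑ k, n k : ℕ) : ℝ) ≠ 0 := by
    have : 0 < ∑ k, n k := Finset.sum_pos (fun j _ => hn j) ⟨⟨0, hm⟩, Finset.mem_univ _⟩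
    exact_mod_cast this.ne'
  have hw : ∑ j, ((n j : ℝ) / ((∑ k, n k : ℕ) : ℝ)) = 1 := by
    rw [← Finset.sum_div, ← Nat.cast_sum, div_self hN]
  have h1 : dkrr H lam d - f = resolv T lam (noiseVec f fun t => d (e t).1 (e t).2) -
      resolv T lam (lam • f) + ∑ j, ((n j : ℝ) / ((∑ k, n k : ℕ) : ℝ)) •
        resolv T lam ((T - empOp H (d j)) (krr H lam (d j) - f)) := by
    have h2 : dkrr H lam d - f =
        ∑ j, ((n j : ℝ) / ((∑ k, n k : ℕ) : ℝ)) • (krr H lam (d j) - f) := by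
      simp_rw [smul_sub]
      rw [Finset.sum_sub_distrib, ← Finset.sum_smul, hw, one_smul]
      rfl
    rw [h2, ← sum_smul_noiseVec hn d e f, map_sum,
      Finset.sum_congr rfl fun j _ => congrArg _ (krr_sub_eq_resolv hpos hl (d j) f)]
    simp_rw [smul_add, smul_sub]
    rw [Finset.sum_add_distrib, Finset.sum_sub_distrib, ← Finset.sum_smul, hw, one_smul]
    simp_rw [map_smul]
  rw [h1]
  refine (map_add_le_add p _ _).trans (add_le_add (map_sub_le_add p _ _) ?_)
  refine (Finset.le_sum_of_subadditive _ (map_zero p).le (map_add_le_add p) _ _).trans_eq ?_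
  refine Finset.sum_congr rfl fun j _ => ?_
  rw [map_smul_eq_mul, Real.norm_eq_abs, abs_of_nonneg (by positivity)]

end Ridge

/-! ### Measurability of the estimators -/

section RidgeMeasurable

variable {X H : Type*} [MetricSpace X]
variable [NormedAddCommGroup H] [InnerProductSpace ℝ H] [CompleteSpace H] [RKHS ℝ H X ℝ]
variable {K : X → X → ℝ} (hK : IsMercerKernel K) (hH : HasKernel H K)

-- By `krr_eq`: the empirical operator and vector depend continuously on the data, and inversion is
-- continuous at units.
include hK hH in
lemma continuous_krr {lam : ℝ} (hl : 0 < lam) (n : ℕ) :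
    Continuous fun d : Fin n → X × ℝ => krr H lam d := by
  have hker := continuous_kerSection hK hH
  have h1 : Continuous fun d : Fin n → X × ℝ => empOp H d := by
    have := continuous_pointOp hK hH
    unfold empOp
    fun_prop
  have h2 : Continuous fun d : Fin n → X × ℝ => empVec H d := by
    unfold empVec
    fun_prop
  have h3 : Continuous fun d : Fin n → X × ℝ => resolv (empOp H d) lam := by
    rw [continuous_iff_continuousAt]
    intro d
    obtain ⟨u, hu⟩ := isUnit_smul_one_add (empOp_nonneg (H := H) d) hl
    have h4 : ContinuousAt Ring.inverse (lam • (1 : H →L[ℝ] H) + empOp H d) := by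
      rw [← hu]; exact NormedRing.inverse_continuousAt u
    exact ContinuousAt.comp (g := Ring.inverse) h4
      (continuous_const.add h1).continuousAt
  simp_rw [krr_eq hl]
  exact h3.clm_apply h2

variable [CompactSpace X] [MeasurableSpace X] [BorelSpace X]

include hK hH in
lemma stronglyMeasurable_dkrr {Ω : Type*} [MeasurableSpace Ω] {lam : ℝ} (hl : 0 < lam) {m : ℕ}
    {n : Fin m → ℕ} {z : (j : Fin m) → Fin (n j) → Ω → X × ℝ} (hz : ∀ j i, Measurable (z j i)) :
    StronglyMeasurable fun ω => dkrr H lam fun j i => z j i ω := by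
  unfold dkrr
  refine Finset.stronglyMeasurable_fun_sum _ fun j _ => StronglyMeasurable.const_smul ?_ _
  exact (continuous_krr hK hH hl (n j)).stronglyMeasurable.comp_measurable
    (measurable_pi_lambda _ fun i => hz j i)

end RidgeMeasurable

/-! ### Root mean square bounds -/

lemma sqrt_add_le_sqrt_add_sqrt {a b : ℝ} (ha : 0 ≤ a) (hb : 0 ≤ b) : √(a + b) ≤ √a + √b := by
  rw [Real.sqrt_le_left (by positivity)]
  nlinarith [Real.sq_sqrt ha, Real.sq_sqrt hb, mul_nonneg (Real.sqrt_nonneg a) (Real.sqrt_nonneg b)]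

lemma sqrt_sum_le_sum_sqrt {ι : Type*} (s : Finset ι) (β : ι → ℝ) (hβ : ∀ i ∈ s, 0 ≤ β i) :
    √(∑ i ∈ s, β i) ≤ ∑ i ∈ s, √(β i) := by
  classical
  induction s using Finset.induction_on with
  | empty => simp
  | insert i s hi ih =>
    rw [Finset.sum_insert hi, Finset.sum_insert hi]
    have h := fun j hj => hβ j (Finset.mem_insert_of_mem hj)
    exact (sqrt_add_le_sqrt_add_sqrt (hβ i (Finset.mem_insert_self _ _))
      (Finset.sum_nonneg h)).trans (add_le_add le_rfl (ih h))

lemma ofReal_rpow_half {x : ℝ} (hx : 0 ≤ x) :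
    ENNReal.ofReal x ^ (1 / 2 : ℝ) = ENNReal.ofReal √x := by
  rw [ENNReal.ofReal_rpow_of_nonneg hx (by norm_num), Real.sqrt_eq_rpow]

section Rms

variable {Ω E : Type*} [MeasurableSpace Ω] [MeasurableSpace E] {P : Measure Ω} {ρ : Measure E}

lemma IsMixingSample.rms_devSq_le [IsProbabilityMeasure P] {α : ℕ → ℝ} {n : ℕ} (hn : 0 < n)
    {Z : Fin n → Ω → E} (hZ : IsMixingSample P ρ α Z) {ι : Type*} [Countable ι]
    {φ : ι → E → ℝ} (hφ : ∀ k, Measurable (φ k)) {a c V θ : ℝ} (ha : 0 < a) (hc : 0 < c)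
    (hb : ∀ (F : Finset ι) e, ∑ k ∈ F, φ k e ^ 2 ≤ c ^ 2 * a ^ 2)
    (hV : ∀ F : Finset ι, ∑ k ∈ F, ∫ e, φ k e ^ 2 ∂ρ ≤ c ^ 2 * V) (h0 : 0 ≤ θ) (h1 : θ ≤ 1) :
    (∫⁻ ω, devSq ρ φ (fun i => Z i ω) ∂P) ^ (1 / 2 : ℝ) ≤ ENNReal.ofReal
      ((n : ℝ) ^ (-(1 / 2) : ℝ) * (10 * c) *
        (√V + ∑ l ∈ Finset.Icc 1 n, √(V ^ (1 - θ) * (a ^ 2 * α l) ^ θ))) := by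
  have hV0 : 0 ≤ V := by
    have := hV ∅
    simp only [Finset.sum_empty] at this
    exact nonneg_of_mul_nonneg_right this (by positivity)
  have hα : ∀ l ∈ Finset.Icc 1 n, 0 ≤ α l := fun l hl => hZ.alpha_nonneg (Finset.mem_Icc.1 hl).1
  set β : ℕ → ℝ := fun l => V ^ (1 - θ) * (a ^ 2 * α l) ^ θ with hβ
  have hβ0 : ∀ l ∈ Finset.Icc 1 n, 0 ≤ β l := fun l hl => by have := hα l hl; positivity
  have hn' : (0 : ℝ) < n := by exact_mod_cast hn
  have h2 := hZ.lintegral_devSq_le hn hφ (a := c * a) (V := c ^ 2 * V) (θ := θ) (by positivity)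
    (fun F e => by rw [mul_pow]; exact hb F e) hV h0 h1
  -- The factor `2 * 24 ^ θ` is at most 48, and 100 is a convenient square above it. The scale `c²`
  -- comes out whole because the exponents `1 - θ` and `θ` add up to 1.
  have h3 : (1 / (n : ℝ)) * (c ^ 2 * V + 2 * ∑ l ∈ Finset.Icc 1 n,
      (c ^ 2 * V) ^ (1 - θ) * (24 * (c * a) ^ 2 * α l) ^ θ) ≤
      (1 / (n : ℝ)) * (c ^ 2 * (100 * (V + ∑ l ∈ Finset.Icc 1 n, β l))) := by
    have h4 : ∀ l ∈ Finset.Icc 1 n, (c ^ 2 * V) ^ (1 - θ) * (24 * (c * a) ^ 2 * α l) ^ θ ≤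
        24 * c ^ 2 * β l := fun l hl => by
      have hl0 := hα l hl
      have e1 : 24 * (c * a) ^ 2 * α l = 24 * (c ^ 2 * (a ^ 2 * α l)) := by ring
      rw [e1, Real.mul_rpow (by positivity) hV0, Real.mul_rpow (by norm_num) (by positivity),
        Real.mul_rpow (by positivity) (by positivity)]
      have e2 : (c ^ 2 : ℝ) ^ (1 - θ) * (c ^ 2) ^ θ = c ^ 2 := by
        rw [← Real.rpow_add (by positivity)]; simp
      have e3 : (24 : ℝ) ^ θ ≤ 24 := by
        calc (24 : ℝ) ^ θ ≤ 24 ^ (1 : ℝ) := Real.rpow_le_rpow_of_exponent_le (by norm_num) h1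
          _ = 24 := Real.rpow_one _
      calc (c ^ 2) ^ (1 - θ) * V ^ (1 - θ) * (24 ^ θ * ((c ^ 2) ^ θ * (a ^ 2 * α l) ^ θ))
          = 24 ^ θ * ((c ^ 2) ^ (1 - θ) * (c ^ 2) ^ θ) * β l := by simp only [hβ]; ring
        _ = 24 ^ θ * c ^ 2 * β l := by rw [e2]
        _ ≤ 24 * c ^ 2 * β l := by have := hβ0 l hl; gcongr
    have h5 := Finset.sum_le_sum h4
    rw [← Finset.mul_sum _ _ (24 * c ^ 2)] at h5
    have h6 : 0 ≤ ∑ l ∈ Finset.Icc 1 n, β l := Finset.sum_nonneg hβ0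
    have h7 : 0 ≤ c ^ 2 * ∑ l ∈ Finset.Icc 1 n, β l := by positivity
    have h8 : 0 ≤ c ^ 2 * V := by positivity
    refine mul_le_mul_of_nonneg_left ?_ (by positivity)
    linarith
  have hS : 0 ≤ ∑ l ∈ Finset.Icc 1 n, β l := Finset.sum_nonneg hβ0
  refine (ENNReal.rpow_le_rpow (h2.trans (ENNReal.ofReal_le_ofReal h3)) (by norm_num)).trans ?_
  rw [ofReal_rpow_half (by positivity)]
  refine ENNReal.ofReal_le_ofReal ?_
  have e4 : (n : ℝ) ^ (-(1 / 2) : ℝ) = √(1 / (n : ℝ)) := by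
    rw [Real.rpow_neg hn'.le, ← Real.sqrt_eq_rpow, Real.sqrt_div zero_le_one, Real.sqrt_one,
      one_div]
  rw [Real.sqrt_mul (by positivity), ← e4, Real.sqrt_mul (by positivity), Real.sqrt_sq hc.le,
    Real.sqrt_mul (by norm_num), show (100 : ℝ) = 10 ^ 2 by norm_num, Real.sqrt_sq (by norm_num)]
  refine (le_of_eq (by ring : _ = (n : ℝ) ^ (-(1 / 2) : ℝ) *
    (10 * c) * √(V + ∑ l ∈ Finset.Icc 1 n, β l))).trans
    (mul_le_mul_of_nonneg_left ?_ (by positivity))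
  exact (sqrt_add_le_sqrt_add_sqrt hV0 hS).trans <| add_le_add le_rfl (sqrt_sum_le_sum_sqrt _ _ hβ0)

end Rms

/-! ### Coordinate families of the noise and of the covariance operator -/

section Families

variable {X H : Type*} [MetricSpace X]
variable [NormedAddCommGroup H] [InnerProductSpace ℝ H] [CompleteSpace H] [RKHS ℝ H X ℝ]

/-- The coordinates of `(y - f(x)) K_x` along the vectors `v k`, with `y` truncated at `M`. -/
noncomputable def noiseFam {ι : Type*} (f : H) (M : ℝ) (v : ι → H) (k : ι) (z : X × ℝ) : ℝ :=
  (clamp M z.2 - f z.1) * v k z.1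

/-- The matrix entries of the operator `g ↦ g(x) K_x` with respect to the vectors `v i`, `b j`. -/
noncomputable def opFam {ι κ : Type*} (v : ι → H) (b : κ → H) (q : ι × κ) (z : X × ℝ) : ℝ :=
  v q.1 z.1 * b q.2 z.1

lemma clamp_eq_self {M y : ℝ} (h : |y| ≤ M) : clamp M y = y := by
  unfold clamp; grind

-- Truncating `y` makes the bound hold at every point, as the deviation estimates require, and not
-- just almost surely.
omit [MetricSpace X] [CompleteSpace H] in
lemma noiseFam_sq_le {ι : Type*} {f : H} {M c : ℝ} (hM : 0 ≤ M) (hf : ∀ x, M + |f x| ≤ c)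
    (v : ι → H) (k : ι) (z : X × ℝ) : noiseFam f M v k z ^ 2 ≤ c ^ 2 * v k z.1 ^ 2 := by
  rw [noiseFam, mul_pow]
  have h : |clamp M z.2 - f z.1| ≤ c :=
    (abs_sub _ _).trans ((add_le_add (abs_clamp_le hM _) le_rfl).trans (hf z.1))
  have : (clamp M z.2 - f z.1) ^ 2 ≤ c ^ 2 := sq_le_sq.2 (h.trans (le_abs_self c))
  gcongr

-- Enlarging `F` to a rectangle makes the sum factor.
omit [MetricSpace X] [CompleteSpace H] in
lemma sum_opFam_sq_le {ι κ : Type*} {v : ι → H} {b : κ → H} {x : X} {A B : ℝ}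
    (hA : ∀ F : Finset ι, ∑ k ∈ F, v k x ^ 2 ≤ A) (hB : ∀ F : Finset κ, ∑ k ∈ F, b k x ^ 2 ≤ B)
    (F : Finset (ι × κ)) (y : ℝ) : ∑ q ∈ F, opFam v b q (x, y) ^ 2 ≤ B * A := by
  classical
  calc ∑ q ∈ F, opFam v b q (x, y) ^ 2
      ≤ ∑ q ∈ F.image Prod.fst ×ˢ F.image Prod.snd, opFam v b q (x, y) ^ 2 :=
        Finset.sum_le_sum_of_subset_of_nonneg Finset.subset_product fun _ _ _ => sq_nonneg _
    _ = (∑ k ∈ F.image Prod.fst, v k x ^ 2) * ∑ l ∈ F.image Prod.snd, b l x ^ 2 := by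
        rw [Finset.sum_product, Finset.sum_mul_sum]
        simp only [opFam, mul_pow]
    _ ≤ A * B := mul_le_mul (hA _) (hB _) (Finset.sum_nonneg fun _ _ => sq_nonneg _)
        ((Finset.sum_nonneg fun _ _ => sq_nonneg _).trans (hA (F.image Prod.fst)))
    _ = B * A := mul_comm _ _

variable {K : X → X → ℝ} (hK : IsMercerKernel K) (hH : HasKernel H K)
variable [CompactSpace X] [MeasurableSpace X] [BorelSpace X]

omit [CompactSpace X] in
include hK hH in
lemma measurable_coe_fst (g : H) : Measurable fun z : X × ℝ => g z.1 :=
  (continuous_coe hK hH g).measurable.comp measurable_fst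

omit [CompactSpace X] in
include hK hH in
lemma measurable_noiseFam {ι : Type*} (f : H) (M : ℝ) (v : ι → H) (k : ι) :
    Measurable (noiseFam f M v k) :=
  (((measurable_clamp M).comp measurable_snd).sub (measurable_coe_fst hK hH f)).mul
    (measurable_coe_fst hK hH (v k))

omit [CompactSpace X] in
include hK hH in
lemma measurable_opFam {ι κ : Type*} (v : ι → H) (b : κ → H) (q : ι × κ) :
    Measurable (opFam v b q) :=
  (measurable_coe_fst hK hH _).mul (measurable_coe_fst hK hH _)

variable (ρ : Measure (X × ℝ)) [IsProbabilityMeasure ρ]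

omit [CompactSpace X] [IsProbabilityMeasure ρ] in
lemma integral_comp_fst {g : X → ℝ} (hg : Continuous g) : ∫ z, g z.1 ∂ρ = ∫ x, g x ∂ρ.fst := by
  rw [Measure.fst, integral_map measurable_fst.aemeasurable hg.aestronglyMeasurable]

omit [MeasurableSpace X] [BorelSpace X] in
include hK hH in
lemma exists_abs_coe_le (f : H) : ∃ B : ℝ, 0 ≤ B ∧ ∀ x, |f x| ≤ B := by
  obtain ⟨C, hC0, hC⟩ := exists_kerSection_bound hK hH
  refine ⟨C * ‖f‖, by positivity, fun x => ?_⟩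
  rw [← inner_kerSection]
  exact (abs_real_inner_le_norm _ _).trans (by gcongr; exact hC x)

include hK hH in
lemma integrable_sq_coe (g : H) : Integrable (fun x => g x ^ 2) ρ.fst :=
  ((continuous_coe hK hH g).pow 2).integrable_of_hasCompactSupport
    (HasCompactSupport.of_compactSpace _)

include hK hH in
lemma sum_integral_noiseFam_sq_le {ι : Type*} {f : H} {M c V : ℝ} (hM : 0 ≤ M)
    (hf : ∀ x, M + |f x| ≤ c) {v : ι → H} (F : Finset ι)
    (hV : ∑ k ∈ F, ∫ x, v k x ^ 2 ∂ρ.fst ≤ V) :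
    ∑ k ∈ F, ∫ z, noiseFam f M v k z ^ 2 ∂ρ ≤ c ^ 2 * V := by
  refine le_trans ?_ (mul_le_mul_of_nonneg_left hV (sq_nonneg c))
  rw [Finset.mul_sum]
  refine Finset.sum_le_sum fun k _ => ?_
  rw [← integral_comp_fst ρ (g := fun x => v k x ^ 2) ((continuous_coe hK hH (v k)).pow 2),
    ← integral_const_mul]
  obtain ⟨B, hB0, hB⟩ := exists_abs_coe_le hK hH (v k)
  have h1 : ∀ z : X × ℝ, v k z.1 ^ 2 ≤ B ^ 2 := fun z =>
    sq_le_sq.2 ((hB z.1).trans (le_abs_self B))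
  refine integral_mono (integrable_of_abs_le ((measurable_noiseFam hK hH f M v k).pow_const 2)
    (c := c ^ 2 * B ^ 2) fun z => ?_) (integrable_of_abs_le
      (((measurable_coe_fst hK hH (v k)).pow_const 2).const_mul _) (c := c ^ 2 * B ^ 2) fun z => ?_)
    fun z => noiseFam_sq_le hM hf v k z
  · rw [abs_of_nonneg (sq_nonneg _)]
    exact (noiseFam_sq_le hM hf v k z).trans (mul_le_mul_of_nonneg_left (h1 z) (sq_nonneg c))
  · rw [abs_of_nonneg (by positivity)]
    exact mul_le_mul_of_nonneg_left (h1 z) (sq_nonneg c)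

-- The vectors `b` are bounded pointwise and only the vectors `v` are integrated, so the effective
-- dimension enters to the first power.
include hK hH in
lemma sum_integral_opFam_sq_le {ι κ : Type*} {B V : ℝ} {v : ι → H} {b : κ → H} (hB0 : 0 ≤ B)
    (hB : ∀ x (F : Finset κ), ∑ k ∈ F, b k x ^ 2 ≤ B)
    (hV : ∀ F : Finset ι, ∑ k ∈ F, ∫ x, v k x ^ 2 ∂ρ.fst ≤ V) (F : Finset (ι × κ)) :
    ∑ q ∈ F, ∫ z, opFam v b q z ^ 2 ∂ρ ≤ B * V := by
  classical
  have hint : ∀ k l, Integrable (fun x => v k x ^ 2 * b l x ^ 2) ρ.fst := fun k l =>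
    (((continuous_coe hK hH (v k)).pow 2).mul
      ((continuous_coe hK hH (b l)).pow 2)).integrable_of_hasCompactSupport
      (HasCompactSupport.of_compactSpace _)
  calc ∑ q ∈ F, ∫ z, opFam v b q z ^ 2 ∂ρ
      ≤ ∑ q ∈ F.image Prod.fst ×ˢ F.image Prod.snd, ∫ z, opFam v b q z ^ 2 ∂ρ :=
        Finset.sum_le_sum_of_subset_of_nonneg Finset.subset_product fun _ _ _ =>
          integral_nonneg fun _ => sq_nonneg _
    _ = ∑ k ∈ F.image Prod.fst, ∫ x, v k x ^ 2 * ∑ l ∈ F.image Prod.snd, b l x ^ 2 ∂ρ.fst := by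
        rw [Finset.sum_product]
        refine Finset.sum_congr rfl fun k _ => ?_
        simp_rw [Finset.mul_sum]
        rw [integral_finsetSum _ fun l _ => hint k l]
        refine Finset.sum_congr rfl fun l _ => ?_
        rw [← integral_comp_fst ρ (g := fun x => v k x ^ 2 * b l x ^ 2) (((continuous_coe hK hH
          (v k)).pow 2).mul
          ((continuous_coe hK hH (b l)).pow 2))]
        simp only [opFam, mul_pow]
    _ ≤ ∑ k ∈ F.image Prod.fst, ∫ x, v k x ^ 2 * B ∂ρ.fst := by
        refine Finset.sum_le_sum fun k _ => integral_mono ?_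
          ((integrable_sq_coe hK hH ρ (v k)).mul_const B) fun x => ?_
        · simp_rw [Finset.mul_sum]
          exact integrable_finsetSum _ fun l _ => hint k l
        · exact mul_le_mul_of_nonneg_left (hB x _) (sq_nonneg _)
    _ = B * ∑ k ∈ F.image Prod.fst, ∫ x, v k x ^ 2 ∂ρ.fst := by
        simp_rw [integral_mul_const]
        rw [← Finset.sum_mul, mul_comm]
    _ ≤ B * V := mul_le_mul_of_nonneg_left (hV _) hB0

-- Given `x`, the truncation is almost surely inactive and `y - f(x)` has mean zero, `f` being a
-- version of the regression function.
include hK hH in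
lemma integral_noiseFam {ι : Type*} {f : H} {M : ℝ} (hM : 0 ≤ M) (hy : ∀ᵐ z ∂ρ, |z.2| ≤ M)
    (hf : f =ᵐ[ρ.fst] regressionFun ρ) (v : ι → H) (k : ι) : ∫ z, noiseFam f M v k z ∂ρ = 0 := by
  obtain ⟨B, hB0, hB⟩ := exists_abs_coe_le hK hH (v k)
  obtain ⟨C, hC0, hC⟩ := exists_abs_coe_le hK hH f
  have hint : Integrable (noiseFam f M v k) ρ :=
    integrable_of_abs_le (measurable_noiseFam hK hH f M v k) (c := (M + C) * B) fun z => by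
      rw [noiseFam, abs_mul]
      exact mul_le_mul ((abs_sub _ _).trans (add_le_add (abs_clamp_le hM _) (hC _))) (hB _)
        (abs_nonneg _) (by positivity)
  have hc : ∀ᵐ x ∂ρ.fst, ∀ᵐ y ∂ρ.condKernel x, |y| ≤ M := by
    have h1 : ∀ᵐ z ∂(ρ.fst ⊗ₘ ρ.condKernel), |z.2| ≤ M := by
      rwa [Measure.disintegrate]
    exact Measure.ae_ae_of_ae_compProd h1
  rw [← Measure.integral_condKernel hint]
  refine integral_eq_zero_of_ae ?_
  filter_upwards [hc, hf] with x hx hfx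
  have h2 : ∫ y, noiseFam f M v k (x, y) ∂ρ.condKernel x =
      ∫ y, (y - f x) * v k x ∂ρ.condKernel x := by
    refine integral_congr_ae ?_
    filter_upwards [hx] with y hyM
    simp only [noiseFam, clamp_eq_self hyM]
  have hi : Integrable (fun y : ℝ => y) (ρ.condKernel x) :=
    Integrable.of_bound measurable_id.aestronglyMeasurable M hx
  rw [h2, integral_mul_const, integral_sub hi (integrable_const _)]
  simp only [integral_const, probReal_univ, one_smul, Pi.zero_apply]
  rw [hfx, regressionFun, sub_self, zero_mul]

include hK hH in
lemma devSq_noiseFam {ι : Type*} {f : H} {M : ℝ} (hM : 0 ≤ M) (hy : ∀ᵐ z ∂ρ, |z.2| ≤ M)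
    (hf : f =ᵐ[ρ.fst] regressionFun ρ) (v : ι → H) {n : ℕ} {d : Fin n → X × ℝ}
    (hd : ∀ i, |(d i).2| ≤ M) :
    devSq ρ (noiseFam f M v) d = ∑' k, ENNReal.ofReal (⟪noiseVec f d, v k⟫_ℝ ^ 2) := by
  refine tsum_congr fun k => ?_
  rw [integral_noiseFam hK hH ρ hM hy hf, sub_zero, inner_noiseVec]
  simp_rw [noiseFam, clamp_eq_self (hd _)]

/-- For an eigenbasis `b` and `v` its weighted version, the right side is the squared
Hilbert–Schmidt norm of `(lam + L_K)^(-1/2) (L_K - empOp H d)`; for `v = b` the weight disappears.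
-/
lemma devSq_opFam {ι κ : Type*} (v : ι → H) (b : κ → H) {n : ℕ} (d : Fin n → X × ℝ) :
    devSq ρ (opFam v b) d = ∑' q : ι × κ,
      ENNReal.ofReal (⟪(LK_H ρ.fst hK hH - empOp H d) (v q.1), b q.2⟫_ℝ ^ 2) := by
  refine tsum_congr fun q => ?_
  rw [sub_apply, inner_sub_left, inner_empOp, inner_LK_H_eq_integral,
    ← integral_comp_fst ρ (g := fun x => v q.1 x * b q.2 x) ((continuous_coe hK hH (v q.1)).mul
      (continuous_coe hK hH (b q.2))),
    ← neg_sq, neg_sub]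
  rfl

end Families

/-! ### Weighted eigenbases -/

section Frame

variable {E : Type*} [NormedAddCommGroup E] [InnerProductSpace ℝ E]

/-- The eigenbasis `b`, weighted by `(lam + τ k)^(-1/2)`. -/
noncomputable def weighted {ι : Type*} (b : ι → E) (τ : ι → ℝ) (lam : ℝ) (k : ι) : E :=
  (√(lam + τ k))⁻¹ • b k

lemma inner_weighted_sq {ι : Type*} (b : ι → E) {τ : ι → ℝ} {lam : ℝ} (hl : 0 < lam) {k : ι}
    (hτ : 0 ≤ τ k) (w : E) : ⟪w, weighted b τ lam k⟫_ℝ ^ 2 = ⟪w, b k⟫_ℝ ^ 2 / (lam + τ k) := by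
  rw [weighted, inner_smul_right, mul_pow, inv_pow, Real.sq_sqrt (by positivity), div_eq_inv_mul]

variable [CompleteSpace E]

/-- Parseval for `‖(lam + T)^(-1/2) w‖²`, without forming a square root of the operator. -/
lemma hasSum_inner_weighted_sq {T : E →L[ℝ] E} (hpos : ∀ x, 0 ≤ ⟪T x, x⟫_ℝ)
    (hs : (T : E →ₗ[ℝ] E).IsSymmetric) {ι : Type*} {b : HilbertBasis ι ℝ E} {τ : ι → ℝ}
    (hτ : ∀ k, 0 ≤ τ k) (hb : ∀ k, T (b k) = τ k • b k) {lam : ℝ} (hl : 0 < lam) (w : E) :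
    HasSum (fun k => ⟪w, weighted b τ lam k⟫_ℝ ^ 2) ⟪w, resolv T lam w⟫_ℝ := by
  have e : (fun k => ⟪w, weighted b τ lam k⟫_ℝ ^ 2) =
      fun k => ⟪w, b k⟫_ℝ * ⟪b k, resolv T lam w⟫_ℝ := funext fun k => by
    rw [inner_weighted_sq _ hl (hτ k), ← resolv_symm hpos hs hl,
      resolv_eigenvector hpos hl (hτ k) (hb k), inner_smul_left, real_inner_comm w]
    simp
    ring
  rw [e]
  exact b.hasSum_inner_mul_inner w (resolv T lam w)

/-- At `g = (lam + T)⁻¹ w` the form of `lam + T` equals `⟪w, (lam + T)⁻¹ w⟫`. Working with a general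
`p` treats both error norms at once. -/
lemma ofReal_seminorm_resolv_le {T : E →L[ℝ] E} (hpos : ∀ x, 0 ≤ ⟪T x, x⟫_ℝ)
    (hs : (T : E →ₗ[ℝ] E).IsSymmetric) {ι : Type*} {b : HilbertBasis ι ℝ E} {τ : ι → ℝ}
    (hτ : ∀ k, 0 ≤ τ k) (hb : ∀ k, T (b k) = τ k • b k) {lam : ℝ} (hl : 0 < lam) {p : Seminorm ℝ E}
    (hp : ∀ g, p g ^ 2 ≤ ⟪lam • g + T g, g⟫_ℝ) (w : E) :
    ENNReal.ofReal (p (resolv T lam w)) ≤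
      (∑' k, ENNReal.ofReal (⟪w, weighted b τ lam k⟫_ℝ ^ 2)) ^ (1 / 2 : ℝ) := by
  have h := hasSum_inner_weighted_sq hpos hs hτ hb hl w
  have h1 := hp (resolv T lam w)
  rw [add_resolv hpos hl] at h1
  rw [← ENNReal.ofReal_tsum_of_nonneg (fun k => sq_nonneg _) h.summable, h.tsum_eq,
    ofReal_rpow_half ((sq_nonneg _).trans h1)]
  exact ENNReal.ofReal_le_ofReal (Real.le_sqrt_of_sq_le h1)

omit [CompleteSpace E] in
lemma ofReal_norm_eq_tsum {ι : Type*} (b : HilbertBasis ι ℝ E) (w : E) :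
    ENNReal.ofReal ‖w‖ = (∑' k, ENNReal.ofReal (⟪w, b k⟫_ℝ ^ 2)) ^ (1 / 2 : ℝ) := by
  have h := hasSum_inner_sq b w
  rw [← ENNReal.ofReal_tsum_of_nonneg (fun k => sq_nonneg _) h.summable, h.tsum_eq,
    ofReal_rpow_half (sq_nonneg _), Real.sqrt_sq (norm_nonneg _)]

omit [CompleteSpace E] in
/-- The Hilbert–Schmidt bound for a symmetric operator. -/
lemma rpow_tsum_inner_apply_sq_le {D : E →L[ℝ] E} (hD : ∀ x y, ⟪D x, y⟫_ℝ = ⟪x, D y⟫_ℝ)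
    {ι κ : Type*}
    (v : ι → E) (b : HilbertBasis κ ℝ E) (w : E) :
    (∑' k, ENNReal.ofReal (⟪D w, v k⟫_ℝ ^ 2)) ^ (1 / 2 : ℝ) ≤
      (∑' q : ι × κ, ENNReal.ofReal (⟪D (v q.1), b q.2⟫_ℝ ^ 2)) ^ (1 / 2 : ℝ) *
        ENNReal.ofReal ‖w‖ := by
  have h1 : ∀ k, ENNReal.ofReal (⟪D w, v k⟫_ℝ ^ 2) ≤
      (∑' l, ENNReal.ofReal (⟪D (v k), b l⟫_ℝ ^ 2)) * ENNReal.ofReal (‖w‖ ^ 2) := fun k => by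
    have h := hasSum_inner_sq b (D (v k))
    rw [← ENNReal.ofReal_tsum_of_nonneg (fun k => sq_nonneg _) h.summable, h.tsum_eq,
      ← ENNReal.ofReal_mul (sq_nonneg _), ← mul_pow, hD]
    refine ENNReal.ofReal_le_ofReal (sq_le_sq.2 ?_)
    rw [abs_of_nonneg (by positivity : 0 ≤ ‖D (v k)‖ * ‖w‖), mul_comm]
    exact abs_real_inner_le_norm _ _
  have h2 := ENNReal.tsum_le_tsum h1
  rw [ENNReal.tsum_mul_right, ← ENNReal.tsum_prod
    (f := fun k l => ENNReal.ofReal (⟪D (v k), b l⟫_ℝ ^ 2))] at h2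
  refine (ENNReal.rpow_le_rpow h2 (by norm_num)).trans_eq ?_
  rw [ENNReal.mul_rpow_of_nonneg _ _ (by norm_num), ofReal_rpow_half (sq_nonneg _),
    Real.sqrt_sq (norm_nonneg _)]

end Frame

/-! ### Pointwise and integrated bounds for the eigenbases -/

section FrameRkhs

variable {X H : Type*} [MetricSpace X]
variable [NormedAddCommGroup H] [InnerProductSpace ℝ H] [CompleteSpace H] [RKHS ℝ H X ℝ]

lemma sum_basis_sq_le {κ : ℝ} (hκ : ∀ x, ‖kerSection H x‖ ≤ κ) {ι : Type*} (b : HilbertBasis ι ℝ H)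
    (x : X) (F : Finset ι) : ∑ k ∈ F, b k x ^ 2 ≤ κ ^ 2 := by
  have h := hasSum_inner_sq b (kerSection H x)
  simp_rw [inner_kerSection] at h
  exact (sum_le_hasSum F (fun k _ => sq_nonneg _) h).trans
    (pow_le_pow_left₀ (norm_nonneg _) (hκ x) 2)

lemma sum_weighted_sq_le {κ : ℝ} (hκ : ∀ x, ‖kerSection H x‖ ≤ κ) {ι : Type*}
    (b : HilbertBasis ι ℝ H) {τ : ι → ℝ} (hτ : ∀ k, 0 ≤ τ k) {lam : ℝ} (hl : 0 < lam) (x : X)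
    (F : Finset ι) : ∑ k ∈ F, weighted b τ lam k x ^ 2 ≤ κ ^ 2 / lam := by
  refine le_trans ?_ (div_le_div_of_nonneg_right (sum_basis_sq_le hκ b x F) hl.le)
  rw [Finset.sum_div]
  refine Finset.sum_le_sum fun k _ => ?_
  rw [← inner_kerSection, inner_weighted_sq _ hl (hτ k), inner_kerSection]
  have := hτ k
  gcongr
  linarith

variable [CompactSpace X] [MeasurableSpace X] [BorelSpace X]
variable {K : X → X → ℝ} (hK : IsMercerKernel K) (hH : HasKernel H K)
variable (μ : Measure X) [IsProbabilityMeasure μ]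

include hK hH in
lemma sum_integral_basis_sq_le {κ : ℝ} (hκ : ∀ x, ‖kerSection H x‖ ≤ κ) {ι : Type*}
    (b : HilbertBasis ι ℝ H) (F : Finset ι) : ∑ k ∈ F, ∫ x, b k x ^ 2 ∂μ ≤ κ ^ 2 := by
  have hi : ∀ k, Integrable (fun x => b k x ^ 2) μ := fun k =>
    ((continuous_coe hK hH (b k)).pow 2).integrable_of_hasCompactSupport
      (HasCompactSupport.of_compactSpace _)
  rw [← integral_finsetSum _ fun k _ => hi k]
  refine (integral_mono (integrable_finsetSum _ fun k _ => hi k) (integrable_const (κ ^ 2))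
    fun x => sum_basis_sq_le hκ b x F).trans_eq ?_
  simp

/-- The integrals are `τ k / (lam + τ k)` and sum up to the effective dimension: here the capacity
condition enters the deviations. -/
lemma sum_integral_weighted_sq_le {ι : Type*} {b : HilbertBasis ι ℝ H} {τ : ι → ℝ}
    (hτ : ∀ k, 0 ≤ τ k) (hb : ∀ k, LK_H μ hK hH (b k) = τ k • b k) {lam V : ℝ} (hl : 0 < lam)
    (hV : 0 ≤ V) (hN : effectiveDim μ hK hH lam ≤ ENNReal.ofReal V) (F : Finset ι) :
    ∑ k ∈ F, ∫ x, weighted b τ lam k x ^ 2 ∂μ ≤ V := by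
  have h1 : ∀ k, ∫ x, weighted b τ lam k x ^ 2 ∂μ = τ k / (lam + τ k) := fun k => by
    simp_rw [sq]
    have := hτ k
    rw [← inner_LK_H_eq_integral hK hH μ, weighted, map_smul, hb, inner_smul_left, inner_smul_right,
      inner_smul_left, real_inner_self_eq_norm_sq, b.orthonormal.1 k]
    simp only [conj_trivial, one_pow, mul_one]
    have h2 := Real.mul_self_sqrt (by positivity : 0 ≤ lam + τ k)
    rw [← mul_assoc, ← mul_inv, h2, inv_mul_eq_div]
  simp_rw [h1]
  rw [effectiveDim_eq_tsum hK hH μ hτ hb hl] at hN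
  rw [← ENNReal.ofReal_le_ofReal_iff hV, ENNReal.ofReal_sum_of_nonneg fun k _ =>
    div_nonneg (hτ k) (by have := hτ k; positivity)]
  exact (ENNReal.sum_le_tsum F).trans hN

end FrameRkhs

/-! ### Deviations of a mixing sample -/

section Deviations

variable {X H : Type*} [MetricSpace X] [CompactSpace X] [MeasurableSpace X] [BorelSpace X]
variable [NormedAddCommGroup H] [InnerProductSpace ℝ H] [CompleteSpace H] [RKHS ℝ H X ℝ]
variable {K : X → X → ℝ} (hK : IsMercerKernel K) (hH : HasKernel H K)
variable (ρ : Measure (X × ℝ)) [IsProbabilityMeasure ρ]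
variable {Ω : Type*} [MeasurableSpace Ω] {P : Measure Ω} [IsProbabilityMeasure P]

/-- The deviation rate in the norm of the reproducing kernel Hilbert space. -/
noncomputable def basicRate (α : ℕ → ℝ) (n : ℕ) : ℝ :=
  (n : ℝ) ^ (-(1 / 2) : ℝ) * (1 + ∑ l ∈ Finset.Icc 1 n, √(α l))

/-- The deviation rate in the norm weighted by `(lam + L_K)^(-1/2)`. -/
noncomputable def weightedRate (s δ lam : ℝ) (α : ℕ → ℝ) (n : ℕ) : ℝ :=
  (n : ℝ) ^ (-(1 / 2) : ℝ) * (lam ^ (-(s / 2)) + lam ^ (-((2 * s + δ + 1) / (2 * δ + 4))) *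
    ∑ l ∈ Finset.Icc 1 n, α l ^ (δ / (4 + 2 * δ)))

variable {κ : ℝ} (hκ1 : 1 ≤ κ) (hκ : ∀ x, ‖kerSection H x‖ ≤ κ)
variable {ι : Type*} [Countable ι] {b : HilbertBasis ι ℝ H}
variable {α : ℕ → ℝ} {n : ℕ} (hn : 0 < n) {Z : Fin n → Ω → X × ℝ} (hZ : IsMixingSample P ρ α Z)

lemma sqrt_interp_le {C₀ lam s δ κ a : ℝ} (hC₀ : 1 ≤ C₀) (hl : 0 < lam) (hl1 : lam ≤ 1)
    (hδ : 0 < δ) (hκ1 : 1 ≤ κ) (ha : 0 ≤ a) :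
    √((C₀ * lam ^ (-s)) ^ (1 - δ / (2 + δ)) * (√(κ ^ 2 / lam) ^ 2 * a) ^ (δ / (2 + δ))) ≤
      C₀ * κ * (lam ^ (-((2 * s + δ + 1) / (2 * δ + 4))) * a ^ (δ / (4 + 2 * δ))) := by
  have hθ0 : 0 ≤ δ / (2 + δ) := by positivity
  have hθ1 : δ / (2 + δ) ≤ 1 := div_le_one_of_le₀ (by linarith) (by positivity)
  set θ := δ / (2 + δ) with hθ
  have hC0 : 0 < C₀ := by linarith
  have hκ0 : 0 < κ := by linarith
  rw [Real.sq_sqrt (by positivity), Real.sqrt_eq_rpow, Real.mul_rpow (by positivity)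
    (by positivity),
    ← Real.rpow_mul (by positivity), ← Real.rpow_mul (by positivity),
    Real.mul_rpow (by positivity) (by positivity), Real.mul_rpow (by positivity) (by positivity),
    Real.div_rpow (by positivity) (by positivity), ← Real.rpow_mul hl.le, ← Real.rpow_natCast κ,
    ← Real.rpow_mul hκ0.le]
  have e1 : C₀ ^ ((1 - θ) * (1 / 2)) ≤ C₀ := by
    calc C₀ ^ ((1 - θ) * (1 / 2)) ≤ C₀ ^ (1 : ℝ) :=
          Real.rpow_le_rpow_of_exponent_le hC₀ (by linarith)
      _ = C₀ := Real.rpow_one _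
  have e2 : κ ^ (((2 : ℕ) : ℝ) * (θ * (1 / 2))) ≤ κ := by
    calc κ ^ (((2 : ℕ) : ℝ) * (θ * (1 / 2))) ≤ κ ^ (1 : ℝ) :=
          Real.rpow_le_rpow_of_exponent_le hκ1 (by push_cast; linarith)
      _ = κ := Real.rpow_one _
  -- The exponent on the left is `-(2 s + δ) / (2 δ + 4)`; as `lam ≤ 1`, lowering it by a further `1
  -- / (2 δ + 4)` only enlarges the bound.
  have e3 : lam ^ (-s * ((1 - θ) * (1 / 2))) / lam ^ (θ * (1 / 2)) ≤
      lam ^ (-((2 * s + δ + 1) / (2 * δ + 4))) := by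
    rw [← Real.rpow_sub hl]
    refine Real.rpow_le_rpow_of_exponent_ge hl hl1 ?_
    have : -s * ((1 - θ) * (1 / 2)) - θ * (1 / 2) = -((2 * s + δ) / (2 * δ + 4)) := by
      rw [hθ]; field_simp; ring
    rw [this]
    exact neg_le_neg (div_le_div_of_nonneg_right (by linarith) (by positivity))
  have e4 : θ * (1 / 2) = δ / (4 + 2 * δ) := by
    rw [hθ]; field_simp; ring
  calc C₀ ^ ((1 - θ) * (1 / 2)) * lam ^ (-s * ((1 - θ) * (1 / 2))) *
        (κ ^ (((2 : ℕ) : ℝ) * (θ * (1 / 2))) / lam ^ (θ * (1 / 2)) * a ^ (θ * (1 / 2)))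
      = C₀ ^ ((1 - θ) * (1 / 2)) * κ ^ (((2 : ℕ) : ℝ) * (θ * (1 / 2))) *
        ((lam ^ (-s * ((1 - θ) * (1 / 2))) / lam ^ (θ * (1 / 2))) * a ^ (θ * (1 / 2))) := by
        ring
    _ ≤ C₀ * κ * (lam ^ (-((2 * s + δ + 1) / (2 * δ + 4))) * a ^ (θ * (1 / 2))) := by gcongr
    _ = _ := by rw [e4]

omit [MetricSpace X] [CompactSpace X] [BorelSpace X] [IsProbabilityMeasure ρ] in
include hκ1 hn hZ in
/-- Root mean square deviation of a family that is dominated by an orthonormal basis. -/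
lemma rms_basic_le {q : Type*} [Countable q] {φ : q → X × ℝ → ℝ} (hφ : ∀ k, Measurable (φ k))
    {c : ℝ} (hc : 0 < c) (hb : ∀ (F : Finset q) e, ∑ k ∈ F, φ k e ^ 2 ≤ c ^ 2 * κ ^ 2)
    (hV : ∀ F : Finset q, ∑ k ∈ F, ∫ e, φ k e ^ 2 ∂ρ ≤ c ^ 2 * κ ^ 2) :
    (∫⁻ ω, devSq ρ φ (fun i => Z i ω) ∂P) ^ (1 / 2 : ℝ) ≤
      ENNReal.ofReal (10 * c * κ * basicRate α n) := by
  have hκ0 : 0 < κ := by linarith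
  -- With `θ = 1` the second moment drops out at positive lags, and each root is `κ * √(α l)`.
  refine (hZ.rms_devSq_le hn hφ hκ0 hc hb hV zero_le_one le_rfl).trans
    (ENNReal.ofReal_le_ofReal (le_of_eq ?_))
  have : ∀ l ∈ Finset.Icc 1 n, √((κ ^ 2) ^ (1 - 1 : ℝ) * (κ ^ 2 * α l) ^ (1 : ℝ)) = κ * √(α l) :=
    fun l _ => by
      rw [sub_self, Real.rpow_zero, Real.rpow_one, one_mul, Real.sqrt_mul (by positivity),
        Real.sqrt_sq hκ0.le]
  rw [Finset.sum_congr rfl this, ← Finset.mul_sum, Real.sqrt_sq hκ0.le, basicRate]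
  ring

omit [MetricSpace X] [CompactSpace X] [BorelSpace X] [IsProbabilityMeasure ρ] in
include hκ1 hn hZ in
/-- Root mean square deviation of a family that is dominated by a weighted eigenbasis. -/
lemma rms_weighted_le {q : Type*} [Countable q] {φ : q → X × ℝ → ℝ} (hφ : ∀ k, Measurable (φ k))
    {c C₀ lam s δ : ℝ} (hc : 0 < c) (hC₀ : 1 ≤ C₀) (hl : 0 < lam) (hl1 : lam ≤ 1) (hδ : 0 < δ)
    (hb : ∀ (F : Finset q) e, ∑ k ∈ F, φ k e ^ 2 ≤ c ^ 2 * (κ ^ 2 / lam))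
    (hV : ∀ F : Finset q, ∑ k ∈ F, ∫ e, φ k e ^ 2 ∂ρ ≤ c ^ 2 * (C₀ * lam ^ (-s))) :
    (∫⁻ ω, devSq ρ φ (fun i => Z i ω) ∂P) ^ (1 / 2 : ℝ) ≤
      ENNReal.ofReal (10 * c * C₀ * κ * weightedRate s δ lam α n) := by
  have hκ0 : 0 < κ := by linarith
  have hC0 : 0 < C₀ := by linarith
  have hθ1 : δ / (2 + δ) ≤ 1 := div_le_one_of_le₀ (by linarith) (by positivity)
  refine (hZ.rms_devSq_le hn hφ (a := √(κ ^ 2 / lam)) (θ := δ / (2 + δ)) (Real.sqrt_pos.2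
    (by positivity)) hc (fun F e => by rw [Real.sq_sqrt (by positivity)]; exact hb F e) hV
    (by positivity) hθ1).trans (ENNReal.ofReal_le_ofReal ?_)
  have h1 : √(C₀ * lam ^ (-s)) ≤ C₀ * κ * lam ^ (-(s / 2)) := by
    rw [Real.sqrt_mul hC0.le, Real.sqrt_eq_rpow (lam ^ (-s)), ← Real.rpow_mul hl.le,
      show -s * (1 / 2) = -(s / 2) by ring]
    gcongr
    calc √C₀ ≤ C₀ := by
          rw [Real.sqrt_le_left hC0.le]; nlinarith
      _ ≤ C₀ * κ := le_mul_of_one_le_right hC0.le hκ1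
  have h2 := Finset.sum_le_sum fun l (hlm : l ∈ Finset.Icc 1 n) =>
    sqrt_interp_le (s := s) hC₀ hl hl1 hδ hκ1 (hZ.alpha_nonneg (Finset.mem_Icc.1 hlm).1)
  rw [← Finset.mul_sum, ← Finset.mul_sum] at h2
  calc _ ≤ (n : ℝ) ^ (-(1 / 2) : ℝ) * (10 * c) * (C₀ * κ * lam ^ (-(s / 2)) + C₀ * κ *
        (lam ^ (-((2 * s + δ + 1) / (2 * δ + 4))) *
          ∑ l ∈ Finset.Icc 1 n, α l ^ (δ / (4 + 2 * δ)))) :=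
        mul_le_mul_of_nonneg_left (add_le_add h1 h2) (by positivity)
    _ = _ := by rw [weightedRate]; ring

end Deviations

/-! ### The expected error -/

section Expectation

variable {X H : Type*} [MetricSpace X] [CompactSpace X] [MeasurableSpace X] [BorelSpace X]
variable [NormedAddCommGroup H] [InnerProductSpace ℝ H] [CompleteSpace H] [RKHS ℝ H X ℝ]
variable {K : X → X → ℝ} (hK : IsMercerKernel K) (hH : HasKernel H K)
variable (ρ : Measure (X × ℝ)) [IsProbabilityMeasure ρ]
variable {Ω : Type*} [MeasurableSpace Ω] {P : Measure Ω} [IsProbabilityMeasure P]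

-- Cauchy–Schwarz in `ℝ≥0∞`, where no integrability has to be known beforehand.
omit [IsProbabilityMeasure P] in
lemma lintegral_rpow_half_mul_le {F G : Ω → ℝ≥0∞} (hF : Measurable F) (hG : Measurable G)
    {a b : ℝ} (ha : 0 ≤ a) (hFa : (∫⁻ ω, F ω ∂P) ^ (1 / 2 : ℝ) ≤ ENNReal.ofReal a)
    (hGb : (∫⁻ ω, G ω ∂P) ^ (1 / 2 : ℝ) ≤ ENNReal.ofReal b) :
    ∫⁻ ω, F ω ^ (1 / 2 : ℝ) * G ω ^ (1 / 2 : ℝ) ∂P ≤ ENNReal.ofReal (a * b) := by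
  rw [ENNReal.ofReal_mul ha]
  exact (ENNReal.lintegral_mul_norm_pow_le hF.aemeasurable hG.aemeasurable (by norm_num)
    (by norm_num) (by norm_num)).trans (mul_le_mul' hFa hGb)

lemma lintegral_rpow_half_le {F : Ω → ℝ≥0∞} (hF : Measurable F) {a : ℝ} (ha : 0 ≤ a)
    (hFa : (∫⁻ ω, F ω ∂P) ^ (1 / 2 : ℝ) ≤ ENNReal.ofReal a) :
    ∫⁻ ω, F ω ^ (1 / 2 : ℝ) ∂P ≤ ENNReal.ofReal a := by
  have := lintegral_rpow_half_mul_le (P := P) hF measurable_const (G := fun _ => 1) (b := 1) ha hFa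
    (by simp)
  simpa using this

/-- The expected error of the distributed estimator in terms of root mean square deviations. -/
lemma lintegral_seminorm_dkrr_sub_le {ι : Type*} [Countable ι] {b : HilbertBasis ι ℝ H} {τ : ι → ℝ}
    (hτ : ∀ k, 0 ≤ τ k) (hb : ∀ k, LK_H ρ.fst hK hH (b k) = τ k • b k) {lam : ℝ} (hl : 0 < lam)
    {p : Seminorm ℝ H} (hp : ∀ g, p g ^ 2 ≤ ⟪lam • g + LK_H ρ.fst hK hH g, g⟫_ℝ)
    {M : ℝ} (hM : 0 ≤ M) (hy : ∀ᵐ z ∂ρ, |z.2| ≤ M) {f : H} (hf : f =ᵐ[ρ.fst] regressionFun ρ)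
    {m : ℕ} (hm : 0 < m) {n : Fin m → ℕ} (hn : ∀ j, 0 < n j)
    {z : (j : Fin m) → Fin (n j) → Ω → X × ℝ} (hz : ∀ j i, Measurable (z j i))
    (hyz : ∀ᵐ ω ∂P, ∀ j i, |(z j i ω).2| ≤ M)
    (e : Fin (∑ j, n j) ≃ (j : Fin m) × Fin (n j)) {W₀ A G : ℝ} {W I : Fin m → ℝ} (hW₀ : 0 ≤ W₀)
    (hW : ∀ j, 0 ≤ W j) (hI : ∀ j, 0 ≤ I j)
    (h1 : (∫⁻ ω, devSq ρ (noiseFam f M (weighted b τ lam)) (fun t => z (e t).1 (e t).2 ω) ∂P) ^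
      (1 / 2 : ℝ) ≤ ENNReal.ofReal W₀)
    (h2 : ∀ j, (∫⁻ ω, devSq ρ (opFam (weighted b τ lam) b) (fun i => z j i ω) ∂P) ^
      (1 / 2 : ℝ) ≤ ENNReal.ofReal (W j))
    (h3 : ∀ j, (∫⁻ ω, devSq ρ (noiseFam f M b) (fun i => z j i ω) ∂P) ^
      (1 / 2 : ℝ) ≤ ENNReal.ofReal (I j))
    (h4 : ∀ j, (∫⁻ ω, devSq ρ (opFam b b) (fun i => z j i ω) ∂P) ^
      (1 / 2 : ℝ) ≤ ENNReal.ofReal (I j))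
    (hA : p (resolv (LK_H ρ.fst hK hH) lam (lam • f)) ≤ A)
    (hG : ‖resolv (LK_H ρ.fst hK hH) lam (lam • f)‖ ≤ G) :
    ∫⁻ ω, ENNReal.ofReal (p (dkrr H lam (fun j i => z j i ω) - f)) ∂P ≤
      ENNReal.ofReal (W₀ + A + ∑ j, ((n j : ℝ) / ((∑ k, n k : ℕ) : ℝ)) *
        (lam⁻¹ * (W j * I j) + G * W j + lam⁻¹ * G * (W j * I j))) := by
  set T := LK_H ρ.fst hK hH with hT
  have hpos := LK_H_nonneg hK hH ρ.fst
  have hs := LK_H_isSymmetric hK hH ρ.fst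
  set u := weighted b τ lam with hu
  have hA0 : 0 ≤ A := (apply_nonneg p _).trans hA
  have hG0 : 0 ≤ G := (norm_nonneg _).trans hG
  have hw0 : ∀ j, 0 ≤ (n j : ℝ) / ((∑ k, n k : ℕ) : ℝ) := fun j => by positivity
  have mn : ∀ v : ι → H, ∀ k, Measurable (noiseFam f M v k) := fun v k =>
    measurable_noiseFam hK hH f M v k
  have mo : ∀ v w : ι → H, ∀ q, Measurable (opFam v w q) :=
    fun v w q => measurable_opFam hK hH v w q
  have m0 := measurable_devSq (ρ := ρ) (mn u) fun t => hz (e t).1 (e t).2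
  have ma := fun j => measurable_devSq (ρ := ρ) (mo u b) (hz j)
  have mb := fun j => measurable_devSq (ρ := ρ) (mn b) (hz j)
  have mc := fun j => measurable_devSq (ρ := ρ) (mo b b) (hz j)
  set a0 : Ω → ℝ≥0∞ := fun ω => devSq ρ (noiseFam f M u) (fun t => z (e t).1 (e t).2 ω)
  set a : Fin m → Ω → ℝ≥0∞ := fun j ω => devSq ρ (opFam u b) (fun i => z j i ω)
  set b' : Fin m → Ω → ℝ≥0∞ := fun j ω => devSq ρ (noiseFam f M b) (fun i => z j i ω)
  set c : Fin m → Ω → ℝ≥0∞ := fun j ω => devSq ρ (opFam b b) (fun i => z j i ω)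
  -- `a0` measures the pooled noise; for the local samples, `a j` is the weighted operator
  -- deviation, which multiplies the crude bound of the local error made of the noise `b' j`, the
  -- bias `G` and the unweighted operator deviation `c j`.
  have point : ∀ᵐ ω ∂P, ENNReal.ofReal (p (dkrr H lam (fun j i => z j i ω) - f)) ≤
      a0 ω ^ (1 / 2 : ℝ) + ENNReal.ofReal A +
        ∑ j, ENNReal.ofReal ((n j : ℝ) / ((∑ k, n k : ℕ) : ℝ)) *
          (ENNReal.ofReal lam⁻¹ * (a j ω ^ (1 / 2 : ℝ) * b' j ω ^ (1 / 2 : ℝ)) +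
            ENNReal.ofReal G * a j ω ^ (1 / 2 : ℝ) +
            ENNReal.ofReal (lam⁻¹ * G) * (a j ω ^ (1 / 2 : ℝ) * c j ω ^ (1 / 2 : ℝ))) := by
    filter_upwards [hyz] with ω hω
    set d : (j : Fin m) → Fin (n j) → X × ℝ := fun j i => z j i ω with hd
    have key := seminorm_dkrr_sub_le hpos p hl hm hn d e f
    have hD : ∀ j, ∀ x y : H, ⟪(T - empOp H (d j)) x, y⟫_ℝ = ⟪x, (T - empOp H (d j)) y⟫_ℝ :=
      fun j x y => by
        rw [sub_apply, sub_apply, inner_sub_left, inner_sub_right, empOp_symm]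
        congr 1
        exact hs x y
    have t0 : ENNReal.ofReal (p (resolv T lam (noiseVec f fun t => d (e t).1 (e t).2))) ≤
        a0 ω ^ (1 / 2 : ℝ) := by
      refine (ofReal_seminorm_resolv_le hpos hs hτ hb hl hp _).trans_eq ?_
      congr 1
      exact (devSq_noiseFam hK hH ρ hM hy hf u fun t => hω _ _).symm
    have tj : ∀ j, ENNReal.ofReal (p (resolv T lam ((T - empOp H (d j)) (krr H lam (d j) - f)))) ≤
        ENNReal.ofReal lam⁻¹ * (a j ω ^ (1 / 2 : ℝ) * b' j ω ^ (1 / 2 : ℝ)) +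
            ENNReal.ofReal G * a j ω ^ (1 / 2 : ℝ) +
            ENNReal.ofReal (lam⁻¹ * G) * (a j ω ^ (1 / 2 : ℝ) * c j ω ^ (1 / 2 : ℝ)) := by
      intro j
      have ea : a j ω = ∑' q : ι × ι,
          ENNReal.ofReal (⟪(T - empOp H (d j)) (u q.1), b q.2⟫_ℝ ^ 2) :=
        devSq_opFam hK hH ρ u b (d j)
      have ec : c j ω = ∑' q : ι × ι,
          ENNReal.ofReal (⟪(T - empOp H (d j)) (b q.1), b q.2⟫_ℝ ^ 2) :=
        devSq_opFam hK hH ρ b b (d j)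
      have eb : ENNReal.ofReal ‖noiseVec f (d j)‖ = b' j ω ^ (1 / 2 : ℝ) := by
        rw [ofReal_norm_eq_tsum b]
        congr 1
        exact (devSq_noiseFam hK hH ρ hM hy hf b fun t => hω _ _).symm
      have s1 := (ofReal_seminorm_resolv_le hpos hs hτ hb hl hp
        ((T - empOp H (d j)) (krr H lam (d j) - f))).trans
        (rpow_tsum_inner_apply_sq_le (hD j) u b _)
      rw [← ea] at s1
      have s2 : ENNReal.ofReal ‖(T - empOp H (d j)) (resolv T lam (lam • f))‖ ≤
          c j ω ^ (1 / 2 : ℝ) * ENNReal.ofReal G := by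
        rw [ofReal_norm_eq_tsum b, ec]
        exact (rpow_tsum_inner_apply_sq_le (hD j) b b _).trans
          (mul_le_mul_right (ENNReal.ofReal_le_ofReal hG) _)
      have s3 : ENNReal.ofReal ‖krr H lam (d j) - f‖ ≤ ENNReal.ofReal lam⁻¹ * b' j ω ^ (1 / 2 : ℝ) +
          ENNReal.ofReal G + ENNReal.ofReal lam⁻¹ * (c j ω ^ (1 / 2 : ℝ) * ENNReal.ofReal G) := by
        refine (ENNReal.ofReal_le_ofReal (norm_krr_sub_le hpos hl (d j) f)).trans ?_
        rw [ENNReal.ofReal_add (by positivity) (by positivity),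
          ENNReal.ofReal_add (by positivity) (by positivity), ENNReal.ofReal_mul (by positivity),
          ENNReal.ofReal_mul (by positivity), eb]
        gcongr
      refine s1.trans ((mul_le_mul_right s3 _).trans_eq ?_)
      rw [ENNReal.ofReal_mul (by positivity)]
      ring
    refine (ENNReal.ofReal_le_ofReal key).trans ?_
    have q0 : ∀ g, 0 ≤ p g := fun g => apply_nonneg p g
    rw [ENNReal.ofReal_add (add_nonneg (q0 _) (q0 _))
      (Finset.sum_nonneg fun j _ => mul_nonneg (hw0 j) (q0 _)),
      ENNReal.ofReal_add (q0 _) (q0 _),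
      ENNReal.ofReal_sum_of_nonneg fun j _ => mul_nonneg (hw0 j) (q0 _)]
    refine add_le_add (add_le_add t0 (ENNReal.ofReal_le_ofReal hA))
      (Finset.sum_le_sum fun j _ => ?_)
    rw [ENNReal.ofReal_mul (hw0 j)]
    exact mul_le_mul_right (tj j) _
  refine (lintegral_mono_ae point).trans ?_
  have mab : ∀ j, Measurable fun ω => a j ω ^ (1 / 2 : ℝ) * b' j ω ^ (1 / 2 : ℝ) := fun j =>
    ((ma j).pow_const _).mul ((mb j).pow_const _)
  have mac : ∀ j, Measurable fun ω => a j ω ^ (1 / 2 : ℝ) * c j ω ^ (1 / 2 : ℝ) := fun j =>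
    ((ma j).pow_const _).mul ((mc j).pow_const _)
  have mah : ∀ j, Measurable fun ω => a j ω ^ (1 / 2 : ℝ) := fun j => (ma j).pow_const _
  have mterm : ∀ j, Measurable fun ω =>
      ENNReal.ofReal lam⁻¹ * (a j ω ^ (1 / 2 : ℝ) * b' j ω ^ (1 / 2 : ℝ)) +
            ENNReal.ofReal G * a j ω ^ (1 / 2 : ℝ) +
            ENNReal.ofReal (lam⁻¹ * G) * (a j ω ^ (1 / 2 : ℝ) * c j ω ^ (1 / 2 : ℝ)) := fun j =>
    (((mab j).const_mul _).add ((mah j).const_mul _)).add ((mac j).const_mul _)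
  have hterm : ∀ j, ∫⁻ ω, (ENNReal.ofReal lam⁻¹ * (a j ω ^ (1 / 2 : ℝ) * b' j ω ^ (1 / 2 : ℝ)) +
            ENNReal.ofReal G * a j ω ^ (1 / 2 : ℝ) +
            ENNReal.ofReal (lam⁻¹ * G) * (a j ω ^ (1 / 2 : ℝ) * c j ω ^ (1 / 2 : ℝ))) ∂P ≤
      ENNReal.ofReal (lam⁻¹ * (W j * I j) + G * W j + lam⁻¹ * G * (W j * I j)) := fun j => by
    have := hW j
    have := hI j
    rw [lintegral_add_right _ ((mac j).const_mul _), lintegral_add_right _ ((mah j).const_mul _),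
      lintegral_const_mul _ (mab j), lintegral_const_mul _ (mah j), lintegral_const_mul _ (mac j),
      ENNReal.ofReal_add (by positivity) (by positivity),
      ENNReal.ofReal_add (by positivity) (by positivity)]
    refine add_le_add (add_le_add ?_ ?_) ?_
    · rw [ENNReal.ofReal_mul (inv_nonneg.2 hl.le)]
      exact mul_le_mul_right (lintegral_rpow_half_mul_le (ma j) (mb j) (hW j) (h2 j) (h3 j)) _
    · rw [ENNReal.ofReal_mul hG0]
      exact mul_le_mul_right (lintegral_rpow_half_le (ma j) (hW j) (h2 j)) _
    · rw [ENNReal.ofReal_mul (p := lam⁻¹ * G) (q := W j * I j) (by positivity)]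
      exact mul_le_mul_right (lintegral_rpow_half_mul_le (ma j) (mc j) (hW j) (h2 j) (h4 j)) _
  rw [lintegral_add_right _ (Finset.measurable_fun_sum _ fun j _ => (mterm j).const_mul _),
    lintegral_add_right _ measurable_const,
    lintegral_finsetSum _ fun j _ => (mterm j).const_mul _, lintegral_const, measure_univ, mul_one]
  have hnn : ∀ j, 0 ≤ (n j : ℝ) / ((∑ k, n k : ℕ) : ℝ) *
      (lam⁻¹ * (W j * I j) + G * W j + lam⁻¹ * G * (W j * I j)) := fun j => by
    have := hW j
    have := hI j
    positivity
  rw [ENNReal.ofReal_add (by positivity) (Finset.sum_nonneg fun j _ => hnn j),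
    ENNReal.ofReal_add hW₀ hA0, ENNReal.ofReal_sum_of_nonneg fun j _ => hnn j]
  refine add_le_add (add_le_add (lintegral_rpow_half_le m0 hW₀ h1) le_rfl)
    (Finset.sum_le_sum fun j _ => ?_)
  rw [lintegral_const_mul _ (mterm j), ENNReal.ofReal_mul (hw0 j)]
  exact mul_le_mul_right (hterm j) _

end Expectation

/-! ### The rate -/

/-- Two of the three products are absorbed using `x ≤ 1` and `lam ^ (r - 1/2) ≤ 1`. The middle one
has a single deviation factor and is what makes the extra `lam ^ r` necessary. -/
lemma local_rate_le {A B lam r s x S₁ S₂ a : ℝ} (hA : 0 ≤ A) (hB : 0 ≤ B) (hl : 0 < lam)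
    (hl1 : lam ≤ 1) (hr1 : 1 / 2 ≤ r) (hs1 : s ≤ 1) (hx0 : 0 ≤ x) (hx1 : x ≤ 1)
    (hS₁ : 0 ≤ S₁) (hS₂ : 0 ≤ S₂) (ha : 0 ≤ a) :
    lam⁻¹ * (A * (x * (lam ^ (-(s / 2)) + a * S₂)) * (A * (x * (1 + S₁)))) +
      B * lam ^ (r - 1 / 2) * (A * (x * (lam ^ (-(s / 2)) + a * S₂))) +
      lam⁻¹ * (B * lam ^ (r - 1 / 2)) *
        (A * (x * (lam ^ (-(s / 2)) + a * S₂)) * (A * (x * (1 + S₁)))) ≤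
    (A ^ 2 * (1 + B) + 2 * A * B) *
      (lam⁻¹ * (x * (1 + S₁) * (x * lam ^ (-(s / 2)) + a * S₂))) + A * B * lam ^ r := by
  set g := lam ^ (-(s / 2)) with hg
  have hg0 : 0 < g := Real.rpow_pos_of_pos hl _
  set h := lam ^ (r - 1 / 2) with hh
  have hh0 : 0 < h := Real.rpow_pos_of_pos hl _
  have hh1 : h ≤ 1 := Real.rpow_le_one hl.le hl1 (by linarith)
  have hi : 1 ≤ lam⁻¹ := (one_le_inv₀ hl).2 hl1
  set t := lam⁻¹ * (x * (1 + S₁) * (x * g + a * S₂)) with ht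
  have ht0 : 0 ≤ t := by positivity
  have p1 : lam⁻¹ * (x * (g + a * S₂) * (x * (1 + S₁))) ≤ t := by
    have : x * (g + a * S₂) ≤ x * g + a * S₂ := by
      have : x * (a * S₂) ≤ a * S₂ := mul_le_of_le_one_left (by positivity) hx1
      linarith
    calc lam⁻¹ * (x * (g + a * S₂) * (x * (1 + S₁)))
        ≤ lam⁻¹ * ((x * g + a * S₂) * (x * (1 + S₁))) := by gcongr
      _ = t := by rw [ht]; ring
  -- If `lam ≤ x`, the factor `lam⁻¹ * x ≥ 1` can be inserted, which leads to `t`; otherwise `h * x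
  -- * g ≤ lam ^ (r + (1 - s) / 2) ≤ lam ^ r`, as `s ≤ 1`.
  have p2 : h * (x * g) ≤ t + lam ^ r := by
    have hr0 : 0 < lam ^ r := Real.rpow_pos_of_pos hl _
    rcases le_total lam x with hc | hc
    · have h1 : h * (x * g) ≤ t := by
        calc h * (x * g) ≤ 1 * (x * g) := by gcongr
          _ ≤ (lam⁻¹ * x * 1) * (x * g) := by
              gcongr
              rw [mul_one, ← div_eq_inv_mul]
              exact (one_le_div hl).2 hc
          _ ≤ (lam⁻¹ * x * (1 + S₁)) * (x * g + a * S₂) := by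
              gcongr
              · linarith
              · have : 0 ≤ a * S₂ := by positivity
                linarith
          _ = t := by rw [ht]; ring
      linarith
    · have h1 : h * (x * g) ≤ lam ^ r := by
        calc h * (x * g) ≤ h * (lam * g) := by gcongr
          _ = lam ^ (r + (1 / 2 - s / 2)) := by
              rw [hh, hg]
              nth_rw 2 [← Real.rpow_one lam]
              rw [← Real.rpow_add hl, ← Real.rpow_add hl]
              ring_nf
          _ ≤ lam ^ r := Real.rpow_le_rpow_of_exponent_ge hl hl1 (by linarith)
      linarith
  have p3 : h * (x * (a * S₂)) ≤ t := by
    calc h * (x * (a * S₂)) ≤ lam⁻¹ * (x * (a * S₂)) := by gcongr; linarith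
      _ ≤ lam⁻¹ * (x * 1 * (x * g + a * S₂)) := by
          have : 0 ≤ x * g := by positivity
          rw [mul_one]
          gcongr
          linarith
      _ ≤ t := by
          rw [ht]
          gcongr
          linarith
  have q1 : A ^ 2 * (lam⁻¹ * (x * (g + a * S₂) * (x * (1 + S₁)))) ≤ A ^ 2 * t := by gcongr
  have q2 : A * B * (h * (x * g)) ≤ A * B * (t + lam ^ r) := by gcongr
  have q3 : A * B * (h * (x * (a * S₂))) ≤ A * B * t := by gcongr
  have q4 : A ^ 2 * B * (h * (lam⁻¹ * (x * (g + a * S₂) * (x * (1 + S₁))))) ≤ A ^ 2 * B * t := by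
    gcongr
    calc h * (lam⁻¹ * (x * (g + a * S₂) * (x * (1 + S₁))))
        ≤ 1 * (lam⁻¹ * (x * (g + a * S₂) * (x * (1 + S₁)))) := by gcongr
      _ ≤ t := by rw [one_mul]; exact p1
  linear_combination q1 + q2 + q3 + q4

/-! ### The rate of distributed kernel ridge regression -/

section Rate

variable {X H : Type*} [MetricSpace X] [CompactSpace X] [MeasurableSpace X] [BorelSpace X]
variable [NormedAddCommGroup H] [InnerProductSpace ℝ H] [CompleteSpace H] [RKHS ℝ H X ℝ]
variable {K : X → X → ℝ} (hK : IsMercerKernel K) (hH : HasKernel H K)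
variable (ρ : Measure (X × ℝ)) [IsProbabilityMeasure ρ]
variable {Ω : Type*} [MeasurableSpace Ω] {P : Measure Ω} [IsProbabilityMeasure P]

lemma integrable_and_integral_le_of_lintegral_ofReal_le {P : Measure Ω} {F : Ω → ℝ}
    (h0 : ∀ ω, 0 ≤ F ω) (hm : AEStronglyMeasurable F P) {b : ℝ} (hb : 0 ≤ b)
    (h : ∫⁻ ω, ENNReal.ofReal (F ω) ∂P ≤ ENNReal.ofReal b) :
    Integrable F P ∧ ∫ ω, F ω ∂P ≤ b := by
  refine ⟨⟨hm, ?_⟩, ?_⟩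
  · rw [hasFiniteIntegral_iff_ofReal (Eventually.of_forall h0)]
    exact h.trans_lt ENNReal.ofReal_lt_top
  · rw [integral_eq_lintegral_of_nonneg_ae (Eventually.of_forall h0) hm]
    exact ENNReal.toReal_le_of_le_ofReal hb h

/-- The resolvent of `lam • f` in a seminorm dominated by the form of `lam + T`. -/
lemma seminorm_resolv_smul_le {T : H →L[ℝ] H} (hpos : ∀ f, 0 ≤ ⟪T f, f⟫_ℝ) {lam r B : ℝ}
    (hl : 0 < lam) (hB : 0 ≤ B) {p : Seminorm ℝ H} (hp : ∀ g, p g ^ 2 ≤ ⟪lam • g + T g, g⟫_ℝ)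
    {f : H} (hf : lam ^ 2 * ⟪resolv T lam f, f⟫_ℝ ≤ lam ^ (2 * r) * B ^ 2) :
    p (resolv T lam (lam • f)) ≤ B * lam ^ r := by
  refine le_of_sq_le_sq ?_ (by positivity)
  refine (hp _).trans ?_
  rw [add_resolv hpos hl, map_smul, inner_smul_left, inner_smul_right, real_inner_comm]
  refine le_trans (le_of_eq ?_) (hf.trans_eq ?_)
  · simp only [conj_trivial]
    ring
  · rw [mul_pow, ← Real.rpow_natCast (lam ^ r), ← Real.rpow_mul hl.le, mul_comm, mul_comm r]
    norm_num

omit [CompleteSpace H] in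
lemma norm_resolv_smul_le {T : H →L[ℝ] H} {lam r B : ℝ} (hl : 0 < lam) (hB : 0 ≤ B) {f : H}
    (hf : (lam * ‖resolv T lam f‖) ^ 2 ≤ lam ^ (2 * r - 1) * B ^ 2) :
    ‖resolv T lam (lam • f)‖ ≤ B * lam ^ (r - 1 / 2) := by
  refine le_of_sq_le_sq ?_ (by positivity)
  rw [map_smul, norm_smul, Real.norm_of_nonneg hl.le]
  refine hf.trans_eq ?_
  rw [mul_pow, ← Real.rpow_natCast (lam ^ (r - 1 / 2)), ← Real.rpow_mul hl.le, mul_comm]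
  congr 2
  push_cast
  ring

lemma basicRate_nonneg (α : ℕ → ℝ) (n : ℕ) : 0 ≤ basicRate α n := by
  have : 0 ≤ ∑ l ∈ Finset.Icc 1 n, √(α l) := Finset.sum_nonneg fun _ _ => Real.sqrt_nonneg _
  unfold basicRate
  positivity

lemma sum_rpow_nonneg {α : ℕ → ℝ} (hα : ∀ l, 1 ≤ l → 0 ≤ α l) (t : ℝ) (n : ℕ) :
    0 ≤ ∑ l ∈ Finset.Icc 1 n, α l ^ t :=
  Finset.sum_nonneg fun l hl => Real.rpow_nonneg (hα l (Finset.mem_Icc.1 hl).1) _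

lemma weightedRate_nonneg {s δ lam : ℝ} (hl : 0 < lam) {α : ℕ → ℝ} (hα : ∀ l, 1 ≤ l → 0 ≤ α l)
    (n : ℕ) : 0 ≤ weightedRate s δ lam α n := by
  have := sum_rpow_nonneg hα (δ / (4 + 2 * δ)) n
  unfold weightedRate
  positivity

/-- The expected error of the distributed estimator in terms of the deviation rates. -/
lemma lintegral_seminorm_dkrr_sub_le_rates {κ c C₀ M lam r s δ B : ℝ} (hκ1 : 1 ≤ κ)
    (hκ : ∀ x, ‖kerSection H x‖ ≤ κ) (hcκ : κ ≤ c) (hC₀ : 1 ≤ C₀) (hl : 0 < lam) (hl1 : lam ≤ 1)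
    (hδ : 0 < δ) (hN : effectiveDim ρ.fst hK hH lam ≤ ENNReal.ofReal (C₀ * lam ^ (-s)))
    {p : Seminorm ℝ H} (hp : ∀ g, p g ^ 2 ≤ ⟪lam • g + LK_H ρ.fst hK hH g, g⟫_ℝ)
    (hM : 0 ≤ M) (hy : ∀ᵐ z ∂ρ, |z.2| ≤ M) {f : H} (hf : f =ᵐ[ρ.fst] regressionFun ρ)
    (hcf : ∀ x, M + |f x| ≤ c) (hB : 0 ≤ B)
    (hf1 : (lam * ‖resolv (LK_H ρ.fst hK hH) lam f‖) ^ 2 ≤ lam ^ (2 * r - 1) * B ^ 2)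
    (hf2 : lam ^ 2 * ⟪resolv (LK_H ρ.fst hK hH) lam f, f⟫_ℝ ≤ lam ^ (2 * r) * B ^ 2)
    {m : ℕ} (hm : 0 < m) {n : Fin m → ℕ} (hn : ∀ j, 0 < n j)
    {z : (j : Fin m) → Fin (n j) → Ω → X × ℝ} {α : ℕ → ℝ}
    (e : Fin (∑ j, n j) ≃ (j : Fin m) × Fin (n j)) (hZ : ∀ j, IsMixingSample P ρ α (z j))
    (hZ₀ : IsMixingSample P ρ α fun t => z (e t).1 (e t).2) :
    ∫⁻ ω, ENNReal.ofReal (p (dkrr H lam (fun j i => z j i ω) - f)) ∂P ≤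
      ENNReal.ofReal (10 * c * C₀ * κ * weightedRate s δ lam α (∑ j, n j) + B * lam ^ r +
        ∑ j, ((n j : ℝ) / ((∑ k, n k : ℕ) : ℝ)) *
        (lam⁻¹ * (10 * c * C₀ * κ * weightedRate s δ lam α (n j) *
            (10 * c * C₀ * κ * basicRate α (n j))) +
          B * lam ^ (r - 1 / 2) * (10 * c * C₀ * κ * weightedRate s δ lam α (n j)) +
          lam⁻¹ * (B * lam ^ (r - 1 / 2)) * (10 * c * C₀ * κ * weightedRate s δ lam α (n j) *
            (10 * c * C₀ * κ * basicRate α (n j))))) := by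
  have hpos := LK_H_nonneg hK hH ρ.fst
  have hκ0 : 0 < κ := by linarith
  have hc : 0 < c := hκ0.trans_le hcκ
  have hC0 : 0 < C₀ := by linarith
  have hV : 0 ≤ C₀ * lam ^ (-s) := by positivity
  obtain ⟨ι, hι, b, τ, hτ, hb⟩ := exists_eigenbasis_LK_H hK hH ρ.fst
  have hα : ∀ l, 1 ≤ l → 0 ≤ α l := fun l h => hZ₀.alpha_nonneg h
  have hκc : κ ^ 2 ≤ c ^ 2 := by gcongr
  have hyz : ∀ᵐ ω ∂P, ∀ j i, |(z j i ω).2| ≤ M := by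
    rw [ae_all_iff]
    refine fun j => ae_all_iff.2 fun i => ?_
    have h := hy
    rw [← (hZ j).map_eq i] at h
    exact ae_of_ae_map ((hZ j).measurable i).aemeasurable h
  -- The factor `C₀ ≥ 1` is inserted so that all four deviations share one constant.
  have basic : ∀ j {q : Type _} [Countable q] {φ : q → X × ℝ → ℝ} (_ : ∀ k, Measurable (φ k))
      (_ : ∀ (F : Finset q) e, ∑ k ∈ F, φ k e ^ 2 ≤ c ^ 2 * κ ^ 2)
      (_ : ∀ F : Finset q, ∑ k ∈ F, ∫ e, φ k e ^ 2 ∂ρ ≤ c ^ 2 * κ ^ 2),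
      (∫⁻ ω, devSq ρ φ (fun i => z j i ω) ∂P) ^ (1 / 2 : ℝ) ≤
        ENNReal.ofReal (10 * c * C₀ * κ * basicRate α (n j)) := fun j _ _ _ hφ h1 h2 => by
    refine (rms_basic_le ρ hκ1 (hn j) (hZ j) hφ hc h1 h2).trans (ENNReal.ofReal_le_ofReal ?_)
    refine mul_le_mul_of_nonneg_right ?_ (basicRate_nonneg α (n j))
    exact mul_le_mul_of_nonneg_right (le_mul_of_one_le_right (by positivity) hC₀) hκ0.le
  have bas : ∀ x (F : Finset ι), ∑ k ∈ F, b k x ^ 2 ≤ κ ^ 2 := fun x F => sum_basis_sq_le hκ b x F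
  have wei : ∀ x (F : Finset ι), ∑ k ∈ F, weighted b τ lam k x ^ 2 ≤ κ ^ 2 / lam := fun x F =>
    sum_weighted_sq_le hκ b hτ hl x F
  have ibas : ∀ F : Finset ι, ∑ k ∈ F, ∫ x, b k x ^ 2 ∂ρ.fst ≤ κ ^ 2 := fun F =>
    sum_integral_basis_sq_le hK hH ρ.fst hκ b F
  have iwei : ∀ F : Finset ι, ∑ k ∈ F, ∫ x, weighted b τ lam k x ^ 2 ∂ρ.fst ≤ C₀ * lam ^ (-s) :=
    fun F => sum_integral_weighted_sq_le hK hH ρ.fst hτ hb hl hV hN F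
  have noise_le : ∀ {v : ι → H} {V : ℝ}, (∀ x (F : Finset ι), ∑ k ∈ F, v k x ^ 2 ≤ V) →
      ∀ (F : Finset ι) z, ∑ k ∈ F, noiseFam f M v k z ^ 2 ≤ c ^ 2 * V := fun {v V} h F z => by
    refine (Finset.sum_le_sum fun k _ => noiseFam_sq_le hM hcf v k z).trans ?_
    rw [← Finset.mul_sum]
    exact mul_le_mul_of_nonneg_left (h z.1 F) (sq_nonneg c)
  have hA0 : 0 ≤ 10 * c * C₀ * κ := by positivity
  refine lintegral_seminorm_dkrr_sub_le hK hH ρ hτ hb hl hp hM hy hf hm hn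
    (fun j => (hZ j).measurable) hyz e
    (mul_nonneg hA0 (weightedRate_nonneg hl hα _))
    (fun j => mul_nonneg hA0 (weightedRate_nonneg hl hα _))
    (fun j => mul_nonneg hA0 (basicRate_nonneg α _)) ?_ (fun j => ?_) (fun j => ?_) (fun j => ?_)
    (seminorm_resolv_smul_le hpos hl hB hp hf2) (norm_resolv_smul_le hl hB hf1)
  · exact rms_weighted_le ρ hκ1 (Finset.sum_pos (fun j _ => hn j) ⟨⟨0, hm⟩, Finset.mem_univ _⟩) hZ₀
      (measurable_noiseFam hK hH f M _) hc hC₀ hl hl1 hδ (noise_le wei)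
      fun F => sum_integral_noiseFam_sq_le hK hH ρ hM hcf F (iwei F)
  · refine rms_weighted_le ρ hκ1 (hn j) (hZ j) (measurable_opFam hK hH _ _) hc hC₀ hl hl1 hδ
      (fun F z => (sum_opFam_sq_le (wei z.1) (bas z.1) F z.2).trans ?_)
      (fun F => (sum_integral_opFam_sq_le hK hH ρ (sq_nonneg κ) bas iwei F).trans ?_)
    · exact mul_le_mul_of_nonneg_right hκc (by positivity)
    · exact mul_le_mul_of_nonneg_right hκc hV
  · exact basic j (measurable_noiseFam hK hH f M _) (noise_le bas)
      fun F => sum_integral_noiseFam_sq_le hK hH ρ hM hcf F (ibas F)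
  · refine basic j (measurable_opFam hK hH _ _)
      (fun F z => (sum_opFam_sq_le (bas z.1) (bas z.1) F z.2).trans ?_)
      (fun F => (sum_integral_opFam_sq_le hK hH ρ (sq_nonneg κ) bas ibas F).trans ?_)
    · exact mul_le_mul_of_nonneg_right hκc (by positivity)
    · exact mul_le_mul_of_nonneg_right hκc (by positivity)

/-- Collecting the deviation rates. -/
lemma sum_rates_le {A B lam r s δ : ℝ} (hA : 0 ≤ A) (hB : 0 ≤ B) (hl : 0 < lam)
    (hl1 : lam ≤ 1) (hr1 : 1 / 2 ≤ r) (hs1 : s ≤ 1) {α : ℕ → ℝ} (hα : ∀ l, 1 ≤ l → 0 ≤ α l)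
    {m : ℕ} {n : Fin m → ℕ} (hn : ∀ j, 0 < n j) (hN : 0 < ∑ j, n j)
    (hNl : ((∑ j, n j : ℕ) : ℝ) ^ (-(1 / 2) : ℝ) * lam ^ (-(s / 2)) = lam ^ r) :
    A * weightedRate s δ lam α (∑ j, n j) + B * lam ^ r +
      ∑ j, ((n j : ℝ) / ((∑ k, n k : ℕ) : ℝ)) *
        (lam⁻¹ * (A * weightedRate s δ lam α (n j) * (A * basicRate α (n j))) +
          B * lam ^ (r - 1 / 2) * (A * weightedRate s δ lam α (n j)) +
          lam⁻¹ * (B * lam ^ (r - 1 / 2)) *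
            (A * weightedRate s δ lam α (n j) * (A * basicRate α (n j)))) ≤
    (A ^ 2 * (1 + B) + 3 * A * B + A + B) * lam⁻¹ *
      ∑ j, (n j : ℝ) / ((∑ k, n k : ℕ) : ℝ) * (n j : ℝ) ^ (-(1 / 2) : ℝ) *
        (1 + ∑ l ∈ Finset.Icc 1 (n j), √(α l)) * ((n j : ℝ) ^ (-(1 / 2) : ℝ) * lam ^ (-(s / 2)) +
          lam ^ (-((2 * s + δ + 1) / (2 * δ + 4))) *
            ∑ l ∈ Finset.Icc 1 (n j), α l ^ (δ / (4 + 2 * δ))) +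
    (A ^ 2 * (1 + B) + 3 * A * B + A + B) * (lam ^ r + lam ^ (-((2 * s + δ + 1) / (2 * δ + 4))) *
      ∑ l ∈ Finset.Icc 1 (∑ j, n j), α l ^ (δ / (4 + 2 * δ))) := by
  set N : ℝ := ((∑ j, n j : ℕ) : ℝ) with hNdef
  have hN0 : 0 < N := Nat.cast_pos.2 hN
  set a := lam ^ (-((2 * s + δ + 1) / (2 * δ + 4))) with ha
  have ha0 : 0 < a := Real.rpow_pos_of_pos hl _
  have hlr : 0 < lam ^ r := Real.rpow_pos_of_pos hl _
  set S₂ : ℕ → ℝ := fun k => ∑ l ∈ Finset.Icc 1 k, α l ^ (δ / (4 + 2 * δ)) with hS₂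
  set S₁ : ℕ → ℝ := fun k => ∑ l ∈ Finset.Icc 1 k, √(α l) with hS₁
  have hS₂0 : ∀ k, 0 ≤ S₂ k := fun k => sum_rpow_nonneg hα _ k
  have hS₁0 : ∀ k, 0 ≤ S₁ k := fun k => Finset.sum_nonneg fun _ _ => Real.sqrt_nonneg _
  have hx1 : ∀ k : ℕ, 0 < k → (k : ℝ) ^ (-(1 / 2) : ℝ) ≤ 1 := fun k hk =>
    Real.rpow_le_one_of_one_le_of_nonpos (by exact_mod_cast hk) (by norm_num)
  set t : Fin m → ℝ := fun j => lam⁻¹ * ((n j : ℝ) ^ (-(1 / 2) : ℝ) * (1 + S₁ (n j)) *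
    ((n j : ℝ) ^ (-(1 / 2) : ℝ) * lam ^ (-(s / 2)) + a * S₂ (n j))) with ht
  have ht0 : ∀ j, 0 ≤ t j := fun j => by
    have := hS₁0 (n j)
    have := hS₂0 (n j)
    positivity
  have hw0 : ∀ j, 0 ≤ (n j : ℝ) / N := fun j => by positivity
  have hw1 : ∑ j, (n j : ℝ) / N = 1 := by
    rw [← Finset.sum_div, hNdef, Nat.cast_sum]
    refine div_self ?_
    rw [← Nat.cast_sum]
    exact hN0.ne'
  have h1 : A * weightedRate s δ lam α (∑ j, n j) ≤ A * (lam ^ r + a * S₂ (∑ j, n j)) := by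
    refine mul_le_mul_of_nonneg_left ?_ hA
    rw [weightedRate, mul_add, hNl]
    exact add_le_add le_rfl
      (mul_le_of_le_one_left (mul_nonneg ha0.le (hS₂0 (∑ j, n j))) (hx1 _ hN))
  have h2 := Finset.sum_le_sum fun j (_ : j ∈ Finset.univ) => mul_le_mul_of_nonneg_left
    (local_rate_le (r := r) (s := s) hA hB hl hl1 hr1 hs1
      (Real.rpow_nonneg (Nat.cast_nonneg (n j)) (-(1 / 2) : ℝ)) (hx1 _ (hn j)) (hS₁0 (n j))
      (hS₂0 (n j)) ha0.le) (hw0 j)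
  set D := A ^ 2 * (1 + B) + 2 * A * B with hD
  have h3 : ∑ j, (n j : ℝ) / N * (D * t j + A * B * lam ^ r) =
      D * ∑ j, (n j : ℝ) / N * t j + A * B * lam ^ r := by
    simp_rw [mul_add]
    rw [Finset.sum_add_distrib, ← Finset.sum_mul, hw1, one_mul, Finset.mul_sum]
    congr 1
    exact Finset.sum_congr rfl fun j _ => by ring
  have h4 : lam⁻¹ * ∑ j, (n j : ℝ) / N * (n j : ℝ) ^ (-(1 / 2) : ℝ) * (1 + S₁ (n j)) *
      ((n j : ℝ) ^ (-(1 / 2) : ℝ) * lam ^ (-(s / 2)) + a * S₂ (n j)) =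
      ∑ j, (n j : ℝ) / N * t j := by
    rw [Finset.mul_sum]
    exact Finset.sum_congr rfl fun j _ => by rw [ht]; ring
  have hsum0 : 0 ≤ ∑ j, (n j : ℝ) / N * t j :=
    Finset.sum_nonneg fun j _ => mul_nonneg (hw0 j) (ht0 j)
  rw [mul_assoc _ lam⁻¹, h4]
  have h5 := add_le_add (add_le_add h1 (le_refl (B * lam ^ r))) (h2.trans_eq h3)
  refine h5.trans ?_
  have hS := hS₂0 (∑ j, n j)
  -- One constant dominates the coefficients of the local sum, of `lam ^ r` and of the pooled mixing
  -- sum; these are the three surpluses.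
  have g1 : 0 ≤ (A * B + A + B) * ∑ j, (n j : ℝ) / N * t j := by positivity
  have g2 : 0 ≤ (A ^ 2 * (1 + B) + 2 * A * B) * lam ^ r := by positivity
  have g3 : 0 ≤ (A ^ 2 * (1 + B) + 3 * A * B + B) * (a * S₂ (∑ j, n j)) := by positivity
  linear_combination g1 + g2 + g3

/-- The expected error of the distributed estimator in a continuous seminorm that is dominated by
the form of `lam + L_K`. -/
lemma integrable_and_integral_seminorm_dkrr_sub_le {κ c C₀ M lam r s δ B : ℝ} (hκ1 : 1 ≤ κ)
    (hκ : ∀ x, ‖kerSection H x‖ ≤ κ) (hcκ : κ ≤ c) (hC₀ : 1 ≤ C₀) (hl : 0 < lam) (hl1 : lam ≤ 1)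
    (hδ : 0 < δ) (hr1 : 1 / 2 ≤ r) (hs1 : s ≤ 1)
    (hN : effectiveDim ρ.fst hK hH lam ≤ ENNReal.ofReal (C₀ * lam ^ (-s)))
    {p : Seminorm ℝ H} (hpc : Continuous p)
    (hp : ∀ g, p g ^ 2 ≤ ⟪lam • g + LK_H ρ.fst hK hH g, g⟫_ℝ)
    (hM : 0 ≤ M) (hy : ∀ᵐ z ∂ρ, |z.2| ≤ M) {f : H} (hf : f =ᵐ[ρ.fst] regressionFun ρ)
    (hcf : ∀ x, M + |f x| ≤ c) (hB : 0 ≤ B)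
    (hf1 : (lam * ‖resolv (LK_H ρ.fst hK hH) lam f‖) ^ 2 ≤ lam ^ (2 * r - 1) * B ^ 2)
    (hf2 : lam ^ 2 * ⟪resolv (LK_H ρ.fst hK hH) lam f, f⟫_ℝ ≤ lam ^ (2 * r) * B ^ 2)
    {m : ℕ} (hm : 0 < m) {n : Fin m → ℕ} (hn : ∀ j, 0 < n j)
    {z : (j : Fin m) → Fin (n j) → Ω → X × ℝ} {α : ℕ → ℝ}
    (e : Fin (∑ j, n j) ≃ (j : Fin m) × Fin (n j)) (hZ : ∀ j, IsMixingSample P ρ α (z j))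
    (hZ₀ : IsMixingSample P ρ α fun t => z (e t).1 (e t).2)
    (hNl : ((∑ j, n j : ℕ) : ℝ) ^ (-(1 / 2) : ℝ) * lam ^ (-(s / 2)) = lam ^ r) :
    Integrable (fun ω => p (dkrr H lam (fun j i => z j i ω) - f)) P ∧
    ∫ ω, p (dkrr H lam (fun j i => z j i ω) - f) ∂P ≤
      ((10 * c * C₀ * κ) ^ 2 * (1 + B) + 3 * (10 * c * C₀ * κ) * B + 10 * c * C₀ * κ + B) * lam⁻¹ *
      ∑ j, (n j : ℝ) / ((∑ k, n k : ℕ) : ℝ) * (n j : ℝ) ^ (-(1 / 2) : ℝ) *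
        (1 + ∑ l ∈ Finset.Icc 1 (n j), √(α l)) * ((n j : ℝ) ^ (-(1 / 2) : ℝ) * lam ^ (-(s / 2)) +
          lam ^ (-((2 * s + δ + 1) / (2 * δ + 4))) *
            ∑ l ∈ Finset.Icc 1 (n j), α l ^ (δ / (4 + 2 * δ))) +
      ((10 * c * C₀ * κ) ^ 2 * (1 + B) + 3 * (10 * c * C₀ * κ) * B + 10 * c * C₀ * κ + B) *
        (lam ^ r + lam ^ (-((2 * s + δ + 1) / (2 * δ + 4))) *
          ∑ l ∈ Finset.Icc 1 (∑ j, n j), α l ^ (δ / (4 + 2 * δ))) := by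
  have hA0 : 0 ≤ 10 * c * C₀ * κ := by
    have : 0 ≤ c := by linarith
    positivity
  have hα : ∀ l, 1 ≤ l → 0 ≤ α l := fun l hl => hZ₀.alpha_nonneg hl
  have bound := lintegral_seminorm_dkrr_sub_le_rates hK hH ρ (P := P) (r := r) hκ1 hκ hcκ hC₀ hl hl1
    hδ hN hp hM hy hf hcf hB hf1 hf2 hm hn e hZ hZ₀
  set A := 10 * c * C₀ * κ
  have rate := sum_rates_le (δ := δ) hA0 hB hl hl1 hr1 hs1 hα hn
    (Finset.sum_pos (fun j _ => hn j) ⟨⟨0, hm⟩, Finset.mem_univ _⟩) hNl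
  have hw : ∀ k, 0 ≤ weightedRate s δ lam α k := fun k => weightedRate_nonneg hl hα k
  have hb : ∀ k, 0 ≤ basicRate α k := fun k => basicRate_nonneg α k
  refine integrable_and_integral_le_of_lintegral_ofReal_le (fun ω => apply_nonneg p _)
    (hpc.comp_stronglyMeasurable ((stronglyMeasurable_dkrr hK hH hl fun j => (hZ j).measurable).sub
      stronglyMeasurable_const)).aestronglyMeasurable (le_trans ?_ rate)
    (bound.trans (ENNReal.ofReal_le_ofReal rate))
  refine add_nonneg (add_nonneg (mul_nonneg hA0 (hw _)) (by positivity))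
    (Finset.sum_nonneg fun j _ => ?_)
  have := hw (n j)
  have := hb (n j)
  positivity

-- The form of `lam + L_K` therefore dominates the squares of both `‖g‖_ρ` and `√lam ‖g‖_K`.
include hK hH in
lemma inner_smul_add_LK_H (μ : Measure X) [IsProbabilityMeasure μ] (lam : ℝ) (g : H) :
    ⟪lam • g + LK_H μ hK hH g, g⟫_ℝ = lam * ‖g‖ ^ 2 + ‖inclL2 μ hK hH g‖ ^ 2 := by
  rw [inner_add_left, inner_LK_H, inner_smul_left, real_inner_self_eq_norm_sq,
    real_inner_self_eq_norm_sq]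
  rfl

lemma toReal_eLpNorm_sub_eq (μ : Measure X) [IsProbabilityMeasure μ] {f : H} {g : X → ℝ}
    (hf : f =ᵐ[μ] g) (u : H) :
    (eLpNorm (fun x => u x - g x) 2 μ).toReal = ‖inclL2 μ hK hH (u - f)‖ := by
  rw [Lp.norm_def]
  refine congrArg _ (eLpNorm_congr_ae ?_)
  filter_upwards [coeFn_inclL2 hK hH μ (u - f), hf] with x hx hy
  rw [hx, ← hy, RKHS.coe_sub, Pi.sub_apply]

end Rate

end DKRR

/-! ### The main theorem -/

open DKRR

theorem theorem3
    {X H : Type*} [MetricSpace X] [CompactSpace X] [MeasurableSpace X] [BorelSpace X]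
    [NormedAddCommGroup H] [InnerProductSpace ℝ H] [CompleteSpace H] [RKHS ℝ H X ℝ]
    (K : X → X → ℝ) (hK : DKRR.IsMercerKernel K) (hH : DKRR.HasKernel H K)
    (ρ : Measure (X × ℝ)) [IsProbabilityMeasure ρ]
    (M C₀ r s δ : ℝ) (hδ : 0 < δ)
    (hs0 : 0 < s) (hs1 : s ≤ 1) (hr1 : 1 / 2 ≤ r) (hr2 : r ≤ 1) (hrs : 2 ≤ 2 * r + s)
    -- bounded outputs
    (hM : 0 < M) (hyM : ∀ᵐ z ∂ρ, |z.2| ≤ M)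
    -- capacity of the hypothesis space
    (hC₀ : 1 ≤ C₀)
    (hN : ∀ lam : ℝ, 0 < lam →
      DKRR.effectiveDim ρ.fst hK hH lam ≤ ENNReal.ofReal (C₀ * lam ^ (-s)))
    -- regularity of the regression function
    (hreg : ∃ h : Lp ℝ 2 ρ.fst,
      ((DKRR.opPow (DKRR.LK_L2 ρ.fst hK hH) r h : Lp ℝ 2 ρ.fst) : X → ℝ) =ᵐ[ρ.fst]
        DKRR.regressionFun ρ) :
    -- the version of the regression function in the reproducing kernel Hilbert space
    ∃ fρ : H, fρ =ᵐ[ρ.fst] DKRR.regressionFun ρ ∧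
      (∀ g : H, g =ᵐ[ρ.fst] DKRR.regressionFun ρ → ‖fρ‖ ≤ ‖g‖) ∧
      ∃ C : ℝ, 0 < C ∧
        ∀ (Ω : Type*) [MeasurableSpace Ω] (P : Measure Ω) [IsProbabilityMeasure P]
          (m : ℕ) (n : Fin m → ℕ) (z : (j : Fin m) → Fin (n j) → Ω → X × ℝ)
          (e : Fin (∑ j, n j) ≃ (j : Fin m) × Fin (n j)) (α : ℕ → ℝ),
          0 < m → (∀ j, 0 < n j) →
          -- samples drawn from `ρ`
          (∀ j i, Measurable (z j i)) → (∀ j i, P.map (z j i) = ρ) →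
          -- stationarity and strong mixing of the local samples and of the arranged whole sample
          (∀ j, DKRR.IsStationary P (z j)) →
          DKRR.IsStationary P (fun t => z (e t).1 (e t).2) →
          (∀ j l, 1 ≤ l → DKRR.mixingCoeff P (z j) l ≤ α l) →
          (∀ l, 1 ≤ l → DKRR.mixingCoeff P (fun t => z (e t).1 (e t).2) l ≤ α l) →
          Tendsto α atTop (𝓝 0) →
          let N : ℝ := ((∑ j, n j : ℕ) : ℝ)
          let lam : ℝ := N ^ (-1 / (2 * r + s))
          let fbar : Ω → H := fun ω => DKRR.dkrr H lam (fun j i => z j i ω)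
          let errρ : Ω → ℝ := fun ω =>
            (eLpNorm (fun x => fbar ω x - DKRR.regressionFun ρ x) 2 ρ.fst).toReal
          let errK : Ω → ℝ := fun ω => ‖fbar ω - fρ‖
          Integrable errρ P ∧ Integrable errK P ∧
          max (∫ ω, errρ ω ∂P) (N ^ (-1 / (4 * r + 2 * s)) * ∫ ω, errK ω ∂P) ≤
            C * N ^ (1 / (2 * r + s)) *
              ∑ j, (n j : ℝ) / N * (n j : ℝ) ^ (-(1 / 2) : ℝ) *
                (1 + ∑ l ∈ Finset.Icc 1 (n j), √(α l)) *
                ((n j : ℝ) ^ (-(1 / 2) : ℝ) * N ^ (s / (4 * r + 2 * s)) +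
                  N ^ ((2 * s + δ + 1) / ((2 * r + s) * (2 * δ + 4))) *
                    ∑ l ∈ Finset.Icc 1 (n j), α l ^ (δ / (4 + 2 * δ))) +
            C * (N ^ (-r / (2 * r + s)) +
              N ^ ((2 * s + δ + 1) / ((2 * r + s) * (2 * δ + 4))) *
                ∑ l ∈ Finset.Icc 1 (∑ j, n j), α l ^ (δ / (4 + 2 * δ))) := by
  obtain ⟨h, hh⟩ := hreg
  obtain ⟨f, hfh, hfmin, hfsrc⟩ := exists_source_version hK hH ρ.fst hr1 hr2 h
  have hf : f =ᵐ[ρ.fst] regressionFun ρ := by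
    refine (coeFn_inclL2 hK hH ρ.fst f).symm.trans ?_
    rw [hfh]
    exact hh
  refine ⟨f, hf, fun g hg => hfmin g (Lp.ext ?_), ?_⟩
  · exact (coeFn_inclL2 hK hH ρ.fst g).trans
      (hg.trans (hf.symm.trans (coeFn_inclL2 hK hH ρ.fst f).symm))
  -- `1 ≤ κ` allows powers of `κ` with exponent in `[0, 1]` to be bounded by `κ`.
  obtain ⟨κ, hκ1, hκ⟩ : ∃ κ : ℝ, 1 ≤ κ ∧ ∀ x, ‖kerSection H x‖ ≤ κ := by
    obtain ⟨κ, -, hκ⟩ := exists_kerSection_bound hK hH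
    exact ⟨max κ 1, le_max_right _ _, fun x => (hκ x).trans (le_max_left _ _)⟩
  obtain ⟨F, hF0, hF⟩ := exists_abs_coe_le hK hH f
  -- `c` bounds the noise, which is at most `M + F`, as well as the kernel sections, so it serves
  -- for noise and operator deviations alike.
  set c := M + F + κ with hc
  have hcκ : κ ≤ c := by linarith
  have hcf : ∀ x, M + |f x| ≤ c := fun x => by linarith [hF x]
  have hc0 : 0 < c := by linarith
  set A := 10 * c * C₀ * κ with hA
  have hA0 : 0 < A := by positivity
  set B := ‖h‖ with hB
  have hB0 : 0 ≤ B := norm_nonneg h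
  refine ⟨A ^ 2 * (1 + B) + 3 * A * B + A + B, by positivity, ?_⟩
  intro Ω _ P _ m n z e α hm hn hz hzρ _ _ hmix hmix₀ _ N lam fbar errρ errK
  have hNn : 0 < ∑ j, n j := Finset.sum_pos (fun j _ => hn j) ⟨⟨0, hm⟩, Finset.mem_univ _⟩
  have hN1 : 1 ≤ N := Nat.one_le_cast.2 hNn
  have hN0 : 0 < N := by linarith
  have hq : 0 < 2 * r + s := by linarith
  have hl : 0 < lam := Real.rpow_pos_of_pos hN0 _
  have hl1 : lam ≤ 1 := Real.rpow_le_one_of_one_le_of_nonpos hN1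
    (div_nonpos_of_nonpos_of_nonneg (by norm_num) hq.le)
  -- As `N = lam ^ (-(2 r + s))`, every power of `N` in the claim is a power of `lam`.
  have hpow : ∀ x y : ℝ, x = -(y / (2 * r + s)) → N ^ x = lam ^ y := fun x y hxy => by
    change _ = (N ^ (-1 / (2 * r + s))) ^ y
    rw [← Real.rpow_mul hN0.le, hxy]
    congr 1
    ring
  have hZ : ∀ j, IsMixingSample P ρ α (z j) := fun j => ⟨hz j, hzρ j, hmix j⟩
  have hZ₀ : IsMixingSample P ρ α fun t => z (e t).1 (e t).2 :=
    ⟨fun t => hz _ _, fun t => hzρ _ _, hmix₀⟩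
  obtain ⟨hf1, hf2⟩ := hfsrc lam hl
  -- The balance behind the choice of `lam`: the pooled noise has the size of the bias.
  have hNl : N ^ (-(1 / 2) : ℝ) * lam ^ (-(s / 2)) = lam ^ r := by
    rw [hpow (-(1 / 2)) (r + s / 2) (by field_simp), ← Real.rpow_add hl]
    congr 1
    ring
  have bound := fun p hpc hp => integrable_and_integral_seminorm_dkrr_sub_le hK hH ρ (P := P) hκ1
    hκ hcκ hC₀ hl hl1 hδ hr1 hs1 (hN lam hl) (p := p) hpc hp hM.le hyM hf hcf hB0 hf1 hf2 hm hn e hZ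
    hZ₀ hNl
  rw [hpow (1 / (2 * r + s)) (-1) (by ring), Real.rpow_neg_one,
    hpow (s / (4 * r + 2 * s)) (-(s / 2)) (by field_simp; ring),
    hpow ((2 * s + δ + 1) / ((2 * r + s) * (2 * δ + 4))) (-((2 * s + δ + 1) / (2 * δ + 4)))
      (by field_simp), hpow (-r / (2 * r + s)) r (by ring),
    hpow (-1 / (4 * r + 2 * s)) (1 / 2) (by field_simp; ring), ← Real.sqrt_eq_rpow]
  have herr : errρ = fun ω => ‖inclL2 ρ.fst hK hH (fbar ω - f)‖ :=
    funext fun ω => toReal_eLpNorm_sub_eq hK hH ρ.fst hf (fbar ω)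
  obtain ⟨i1, b1⟩ := bound
    ((normSeminorm ℝ (Lp ℝ 2 ρ.fst)).comp (inclL2 ρ.fst hK hH : H →ₗ[ℝ] Lp ℝ 2 ρ.fst))
    (inclL2 ρ.fst hK hH).continuous.norm fun g => by
      rw [inner_smul_add_LK_H]
      exact le_add_of_nonneg_left (by positivity)
  -- For the second seminorm, `√lam ‖·‖_K`, the factor `√lam` is exactly the weight of the `K`-norm
  -- in the claim.
  obtain ⟨i2, b2⟩ := bound ((normSeminorm ℝ H).comp (√lam • LinearMap.id))
    (continuous_const_smul √lam).norm fun g => by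
      rw [inner_smul_add_LK_H]
      change ‖√lam • g‖ ^ 2 ≤ _
      rw [norm_smul, mul_pow, Real.norm_of_nonneg (Real.sqrt_nonneg _), Real.sq_sqrt hl.le]
      exact le_add_of_nonneg_right (by positivity)
  have hsq : (fun ω => ((normSeminorm ℝ H).comp (√lam • LinearMap.id)) (fbar ω - f)) =
      fun ω => √lam * errK ω := funext fun ω => by
    change ‖√lam • (fbar ω - f)‖ = _
    rw [norm_smul, Real.norm_of_nonneg (Real.sqrt_nonneg _)]
  rw [hsq] at i2 b2
  rw [integral_const_mul] at b2
  rw [herr]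
  exact ⟨i1, (integrable_const_mul_iff (Real.sqrt_pos.2 hl).ne'.isUnit _).1 i2, max_le b1 b2⟩
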